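/- **Setting.** For integers $M\ge 2$ and $n\ge 0$, an instance of HORN-SAT-MOD$_M(n)$ consists of constraints on Boolean variables $x_1,\dots,x_n$, each of the form $x_i=0$, $x_i=1$ or $x_{i_1}\wedge\dots\wedge x_{i_k}\to x_j$, together with one linear constraint $\sum_i a_ix_i\equiv a_0 \pmod M$; the problem is to decide whether some $x\in\{0,1\}^n$ satisfies all of them. The running time $T(n)$ (resp. $T(M,n)$) of an algorithm for it is measured over the instances with $n$ variables whose Horn constraints contain at most $n^3$ literals in total, and the algorithm need only be correct on these. A time lower bound is understood to hold for infinitely many $n$, for every algorithm. A multilinear polynomial $p\in\mathbb Z[x_1,\dots,x_d]$ represents NAND$_d$ mod $M$ if for $x\in\{0,1\}^d$ one has $p(x)\equiv 0\pmod M$ exactly when $x=(1,\dots,1)$. Say that NAND mod $M$ has efficiently computable degree-$f$ representations if some algorithm, given $d$, outputs (as a list of monomials with coefficients in $\{0,\dots,M-1\}$) a polynomial of degree $f(d)$ representing NAND$_d$ mod $M$, in time polynomial in $\binom{d}{\le f(d)}=\sum_{i\le f(d)}\binom di$. ETH is the hypothesis that no algorithm solves 3-SAT with $m$ clauses in time $2^{o(m)}$.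 Its form with an explicit exponent, ETH$_{\exp}$, is that for some $\delta>0$ no algorithm solves 3-SAT with $m$ clauses in time at most $2^{\delta m}$ for all large $m$. Below $\log$ is natural, $f(m)\log(em/f(m))$ is read as $0$ when $m=f(m)=0$, and $\varepsilon,c>0$. **Theorem.** (a) Assume ETH. 1. There is an absolute constant $c>0$ such that, whenever $M\ge2$ and NAND mod $M$ has efficiently computable degree-$f$ representations, there is a $k$ (depending on $M,f$) such that for every algorithm solving HORN-SAT-MOD$_M$, with running time $T$, there is $\varepsilon>0$ such that for infinitely many $n$ there is an $m$ with $$f(m)\log\frac{em}{f(m)}\ \ge\ c\log n\qquad\text{and}\qquad T(n)\ \ge\ 2^{\varepsilon m}-(n^k+k).$$ 2. If $M\ge 2$ has exactly $r$ distinct prime factors, then for every algorithm solving HORN-SAT-MOD$_M$ there is $\varepsilon>0$ with $T(n)\ge\exp\big(\varepsilon(\log n/\log\log n)^r\big)$ for infinitely many $n$. 3. No single algorithm solving HORN-SAT-MOD$_M$ for all $M\ge 2$ ($M$ being part of the input) runs in time $n^{o(M/\log M)}$: for each such algorithm there is $\varepsilon>0$ such that for every $k$ there are $M\ge k$ and $n\ge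 \max(M,M^k)$ with $T(M,n)\ge n^{\varepsilon M/\log M}$. (b) Assume ETH$_{\exp}$. Then the constants in the exponents do not depend on the algorithm: (1) holds with an absolute $\varepsilon$ chosen together with $c$ (before $M$, $f$ and the algorithm); (2) holds with an $\varepsilon$ depending only on $M$; and there is an absolute $\varepsilon>0$ such that for every fixed $M\ge2$ every algorithm solving HORN-SAT-MOD$_M$ has $T(n)\ge n^{\varepsilon M/\log M}$ for infinitely many $n$. -/

import Mathlib

open Filter Asymptotics

/-! ### Algorithms and running time

Algorithms are programs over binary trees (pairing, projections, composition, conditional and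
`while`), with unit cost for every elementary operation. Such programs simulate multi-tape Turing
machines, and are simulated by them, with polynomial overhead. -/

/-- Binary trees built from `nil` and `cons`. -/
inductive Data : Type
  | nil : Data
  | cons (l r : Data) : Data

namespace Data

def hd : Data → Data
  | nil => nil
  | cons l _ => l

def tl : Data → Data
  | nil => nil
  | cons _ r => r

/-- Natural numbers are written in unary. -/
def ofNat : ℕ → Data
  | 0 => nil
  | n + 1 => cons nil (ofNat n)

def ofBool : Bool → Data
  | false => nil
  | true => cons nil nil

/-- The list with encoded entries `e a₁, e a₂, …`. -/
def ofList {α : Type*} (e : α → Data) : List α → Data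
  | [] => nil
  | a :: l => cons (e a) (ofList e l)

end Data

/-- Programs; each one computes a partial function from `Data` to `Data`. -/
inductive Prog : Type
  /-- return the input -/
  | id : Prog
  /-- return `nil` -/
  | nil : Prog
  /-- return the left subtree of the input -/
  | hd : Prog
  /-- return the right subtree of the input -/
  | tl : Prog
  /-- run `f` and `g` on the input and pair the results -/
  | cons (f g : Prog) : Prog
  /-- run `f`, then run `g` on the result -/
  | seq (f g : Prog) : Prog
  /-- run `f` if `c` returns a tree other than `nil` on the input, otherwise run `g` -/
  | cond (c f g : Prog) : Prog
  /-- `while c(x) ≠ nil do x := f(x)`; return `x` -/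
  | loop (c f : Prog) : Prog

/-- `p.Runs x y t`: on input `x` the program `p` halts with output `y` after `t` steps. -/
inductive Prog.Runs : Prog → Data → Data → ℕ → Prop
  | id (x : Data) : Runs .id x x 1
  | nil (x : Data) : Runs .nil x .nil 1
  | hd (x : Data) : Runs .hd x x.hd 1
  | tl (x : Data) : Runs .tl x x.tl 1
  | cons {f g : Prog} {x y z : Data} {s t : ℕ} :
      Runs f x y s → Runs g x z t → Runs (.cons f g) x (.cons y z) (s + t + 1)
  | seq {f g : Prog} {x y z : Data} {s t : ℕ} :
      Runs f x y s → Runs g y z t → Runs (.seq f g) x z (s + t + 1)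
  | cond_true {c f g : Prog} {x a b y : Data} {s t : ℕ} :
      Runs c x (.cons a b) s → Runs f x y t → Runs (.cond c f g) x y (s + t + 1)
  | cond_false {c f g : Prog} {x y : Data} {s t : ℕ} :
      Runs c x .nil s → Runs g x y t → Runs (.cond c f g) x y (s + t + 1)
  | loop_stop {c f : Prog} {x : Data} {s : ℕ} :
      Runs c x .nil s → Runs (.loop c f) x x (s + 1)
  | loop_step {c f : Prog} {x a b y z : Data} {s t u : ℕ} :
      Runs c x (.cons a b) s → Runs f x y t → Runs (.loop c f) y z u →
        Runs (.loop c f) x z (s + t + u + 1)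

/-- On input `x` the program `p` halts within `T` steps, and it accepts (its output is not `nil`)
if and only if `Q` holds. -/
def Prog.DecidesWithin (p : Prog) (x : Data) (Q : Prop) (T : ℕ) : Prop :=
  ∃ t ≤ T, ∃ y, p.Runs x y t ∧ (y ≠ Data.nil ↔ Q)

/-! ### 3-SAT and the exponential time hypothesis -/

/-- 3-CNF formulas with `m` clauses. At most `3 * m` variables occur in such a formula, so they are
taken from `x₀, …, x_{3m-1}`. The `k`-th literal `(i, b)` of a clause is satisfied by `x` if
`x i = b`; literals may be repeated in a clause. -/
structure ThreeCNF (m : ℕ) : Type where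
  lit : Fin m → Fin 3 → Fin (3 * m) × Bool

namespace ThreeCNF

def Satisfiable {m : ℕ} (φ : ThreeCNF m) : Prop :=
  ∃ x : Fin (3 * m) → Bool, ∀ j, ∃ k, x (φ.lit j k).1 = (φ.lit j k).2

/-- The list of the clauses, each one a list of three literals. -/
def encode {m : ℕ} (φ : ThreeCNF m) : Data :=
  Data.ofList
    (fun C : Fin 3 → Fin (3 * m) × Bool =>
      Data.ofList (fun l : Fin (3 * m) × Bool => .cons (.ofNat l.1) (.ofBool l.2)) (List.ofFn C))
    (List.ofFn φ.lit)

end ThreeCNF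

/-- `A` decides 3-SAT, in time at most `T m` on the formulas with `m` clauses. -/
def SolvesThreeSAT (A : Prog) (T : ℕ → ℕ) : Prop :=
  ∀ (m : ℕ) (φ : ThreeCNF m), A.DecidesWithin φ.encode φ.Satisfiable (T m)

/-- Exponential time hypothesis: no algorithm solves 3-SAT with `m` clauses in time `2^{o(m)}`. -/
def ETH : Prop :=
  ¬ ∃ (A : Prog) (T : ℕ → ℕ) (g : ℕ → ℝ), SolvesThreeSAT A T ∧
      g =o[atTop] (fun m : ℕ => (m : ℝ)) ∧ ∀ m, (T m : ℝ) ≤ (2 : ℝ) ^ g m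

/-- Exponential time hypothesis with an explicit exponent: for some `δ > 0`, no algorithm solves
3-SAT with `m` clauses in time `2^{δ m}` (for all large `m`). -/
def ExponentETH : Prop :=
  ∃ δ : ℝ, 0 < δ ∧ ∀ (A : Prog) (T : ℕ → ℕ), SolvesThreeSAT A T →
    ∃ᶠ m : ℕ in atTop, (2 : ℝ) ^ (δ * m) < T m

/-! ### HORN-SAT with a modular constraint -/

/-- The constraints of HORN-SAT on the variables `x₀, …, x_{n-1}`. -/
inductive HornClause (n : ℕ) : Type
  /-- `x i = 0` -/
  | isZero (i : Fin n) : HornClause n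
  /-- `x i = 1` -/
  | isOne (i : Fin n) : HornClause n
  /-- the conjunction of the `x i` with `i ∈ body` implies `x head` -/
  | imp (body : List (Fin n)) (head : Fin n) : HornClause n

namespace HornClause

def Holds {n : ℕ} (x : Fin n → Bool) : HornClause n → Prop
  | isZero i => x i = false
  | isOne i => x i = true
  | imp body head => (∀ i ∈ body, x i = true) → x head = true

/-- The number of literals. -/
def size {n : ℕ} : HornClause n → ℕ
  | isZero _ => 1
  | isOne _ => 1
  | imp body _ => body.length + 1

def encode {n : ℕ} : HornClause n → Data
  | isZero i => .cons (.ofNat 0) (.ofNat i)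
  | isOne i => .cons (.ofNat 1) (.ofNat i)
  | imp body head =>
      .cons (.ofNat 2) (.cons (Data.ofList (fun i : Fin n => .ofNat i) body) (.ofNat head))

end HornClause

/-- Instances of HORN-SAT-MOD with modulus `M` on `n` variables: Horn constraints together with the
constraint `∑ i, coeff i * x i = rhs mod M`. -/
structure HornModInstance (M n : ℕ) : Type where
  clauses : List (HornClause n)
  coeff : Fin n → Fin M
  rhs : Fin M

namespace HornModInstance

def Satisfiable {M n : ℕ} (Ψ : HornModInstance M n) : Prop :=
  ∃ x : Fin n → Bool, (∀ C ∈ Ψ.clauses, C.Holds x) ∧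
    (∑ i, if x i then (Ψ.coeff i : ℕ) else 0) ≡ (Ψ.rhs : ℕ) [MOD M]

/-- The total number of literals in the Horn constraints. -/
def size {M n : ℕ} (Ψ : HornModInstance M n) : ℕ :=
  (Ψ.clauses.map HornClause.size).sum

def encode {M n : ℕ} (Ψ : HornModInstance M n) : Data :=
  .cons (.ofNat M)
    (.cons (Data.ofList HornClause.encode Ψ.clauses)
      (.cons (Data.ofList (fun a : Fin M => .ofNat a) (List.ofFn Ψ.coeff)) (.ofNat Ψ.rhs)))

end HornModInstance

/-- `A` solves HORN-SAT-MOD with modulus `M` in time at most `T n` on the instances with `n`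
variables whose Horn constraints have total length at most `n ^ 3`. (Without a polynomial bound on
the length of the instance, no time bound in terms of `n` alone would be possible. Nothing is
required of `A` on longer instances.) -/
def SolvesHornSatMod (M : ℕ) (A : Prog) (T : ℕ → ℕ) : Prop :=
  ∀ (n : ℕ) (Ψ : HornModInstance M n), Ψ.size ≤ n ^ 3 →
    A.DecidesWithin Ψ.encode Ψ.Satisfiable (T n)

/-! ### Polynomials representing NAND -/

/-- The polynomial `p` with integer coefficients represents `NAND_d` mod `M` over `{0,1}^d`: it
vanishes mod `M` at the all-ones vector, and at no other point of `{0,1}^d`. -/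
def RepresentsNAND (M : ℕ) {d : ℕ} (p : MvPolynomial (Fin d) ℤ) : Prop :=
  ∀ x : Fin d → Bool,
    (M : ℤ) ∣ MvPolynomial.eval (fun i => if x i then (1 : ℤ) else 0) p ↔ ∀ i, x i = true

/-- A multilinear polynomial written as a list of terms `a * ∏ i ∈ S, x i` with `0 ≤ a < M`. -/
abbrev TermList (M d : ℕ) : Type := List (Finset (Fin d) × Fin M)

namespace TermList

noncomputable def toPoly {M d : ℕ} (L : TermList M d) : MvPolynomial (Fin d) ℤ :=
  (L.map fun s => MvPolynomial.C ((s.2 : ℕ) : ℤ) * ∏ i ∈ s.1, MvPolynomial.X i).sum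

/-- The list of the terms, each one given by the increasing list of its variables and by its
coefficient. -/
def encode {M d : ℕ} (L : TermList M d) : Data :=
  Data.ofList (fun s : Finset (Fin d) × Fin M =>
    .cons (Data.ofList (fun i : Fin d => .ofNat i) (s.1.sort (· ≤ ·))) (.ofNat s.2)) L

end TermList

/-- For every `d` there is a multilinear polynomial of degree `f d` which represents `NAND_d` mod
`M`, and one algorithm computes it from `d`, in time polynomial in the number of multilinear
monomials of degree at most `f d` in `d` variables. -/
def EfficientNAND (M : ℕ) (f : ℕ → ℕ) : Prop :=
  ∃ (P : Prog) (k : ℕ), ∀ d : ℕ, ∃ L : TermList M d,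
    RepresentsNAND M L.toPoly ∧ L.toPoly.totalDegree = f d ∧
      ∃ t ≤ k * (∑ i ∈ Finset.range (f d + 1), d.choose i) ^ k + k,
        P.Runs (.ofNat d) L.encode t

/-! A 3-CNF formula with m clauses becomes a Horn instance whose variable u_{3j+k} says that clause
j is satisfied through its literal k. Implications to a false variable forbid two choices in one
clause and contradictory choices, so Y_j = u_{3j} + u_{3j+1} + u_{3j+2} is 0 or 1. Horn clauses
cannot express that every clause has a choice; but this says p(Y) ≡ 0 mod M, if p represents NAND
mod M. Multiplying p out in the u's, and giving each product a variable tied to it by Horn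
implications, turns this into one linear congruence (`satisfiable_iff_sat`). A monomial of degree e
costs 3^e variables. Composition with this reduction makes a HORN-SAT-MOD algorithm into a 3-SAT
algorithm of time T(n) plus a polynomial overhead (`exists_solver`), and ETH bounds the total below
by 2^{δm} for infinitely many m.

The bounds differ in the choice of p. For a given representation of degree f, n is at most 3m + 1 +
3^f binom(m, ≤ f), hence log n ≤ 3 f log(em/f) (`log_le_mul_log`). For r prime factors, p is the
symmetric polynomial of Barrington, Beigel and Rudich, of degree O(m^{1/r}): Lucas' theorem lets a
binomial coefficient test divisibility by a prime power, and the primes are combined as in the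
Chinese remainder theorem (`represents_primeTerms`); here log n = O(m^{1/r} log m). For the
exponents M / log M, p is 1 plus M - 1 products over residue classes of indices, with values in {1,
..., M} (`represents_residueTerms`); then n is about M 3^{m/(M-1)}, which even allows an exponent
linear in M. If M is part of the input, it is taken to be √m + 2.

The overhead can exceed 2^{δm} if M is small compared with 1/δ, or if r = 1. The claimed bound is
then at most n for large n, and T(n) ≥ n holds because a program that runs for t steps sees only the
top t levels of its input (`le_of_solvesHornSatMod`).

Both hypotheses provide the exponent δ for the constructed 3-SAT solver. Under ETH it depends on
that solver, hence on the given algorithm; under the explicit form it does not. -/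

/-! ### Polynomially bounded quantities -/

/-- On the indices with `P`, the quantity `f` is bounded by a power of `B + 2`. -/
def PolyBdd {ι : Type} (P : ι → Prop) (B f : ι → ℕ) : Prop :=
  ∃ k : ℕ, ∀ i, P i → f i ≤ (B i + 2) ^ k

namespace PolyBdd

variable {ι κ : Type} {P : ι → Prop} {B f g : ι → ℕ}

theorem mono (hf : PolyBdd P B f) (h : ∀ i, P i → g i ≤ f i) : PolyBdd P B g := by
  obtain ⟨k, hk⟩ := hf
  exact ⟨k, fun i hi => (h i hi).trans (hk i hi)⟩

theorem add (hf : PolyBdd P B f) (hg : PolyBdd P B g) : PolyBdd P B (fun i => f i + g i) := by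
  obtain ⟨k, hk⟩ := hf
  obtain ⟨l, hl⟩ := hg
  refine ⟨k + l + 1, fun i hi => ?_⟩
  have h1 : (B i + 2) ^ k ≤ (B i + 2) ^ (k + l) := Nat.pow_le_pow_right (by omega) (by omega)
  have h2 : (B i + 2) ^ l ≤ (B i + 2) ^ (k + l) := Nat.pow_le_pow_right (by omega) (by omega)
  have := hk i hi
  have := hl i hi
  have h3 : (B i + 2) ^ (k + l) * 2 ≤ (B i + 2) ^ (k + l) * (B i + 2) :=
    Nat.mul_le_mul_left _ (by omega)
  rw [pow_succ]
  show f i + g i ≤ _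
  omega

theorem mul (hf : PolyBdd P B f) (hg : PolyBdd P B g) : PolyBdd P B (fun i => f i * g i) := by
  obtain ⟨k, hk⟩ := hf
  obtain ⟨l, hl⟩ := hg
  refine ⟨k + l, fun i hi => ?_⟩
  rw [pow_add]
  exact Nat.mul_le_mul (hk i hi) (hl i hi)

/-- The base `B i + 2` is at least 2, so that every constant lies below one of its powers. -/
theorem const (c : ℕ) : PolyBdd P B (fun _ => c) :=
  ⟨c, fun i _ => (Nat.lt_two_pow_self).le.trans (Nat.pow_le_pow_left (by omega) _)⟩

theorem self : PolyBdd P B B := ⟨1, fun i _ => by simp⟩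

theorem of_le (h : ∀ i, P i → f i ≤ B i) : PolyBdd P B f := self.mono h

theorem pow (hf : PolyBdd P B f) (c : ℕ) : PolyBdd P B (fun i => f i ^ c) := by
  obtain ⟨k, hk⟩ := hf
  refine ⟨k * c, fun i hi => ?_⟩
  rw [pow_mul]
  exact Nat.pow_le_pow_left (hk i hi) _

theorem reindex {Q : κ → Prop} (hf : PolyBdd P B f) (φ : κ → ι) (h : ∀ q, Q q → P (φ q)) :
    PolyBdd Q (fun q => B (φ q)) (fun q => f (φ q)) := by
  obtain ⟨k, hk⟩ := hf
  exact ⟨k, fun q hq => hk _ (h q hq)⟩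

end PolyBdd

/-! ### Functions computed in polynomial time -/

/-- One program computes `y i` from `x i`, for all indices `i` with `P`, in time polynomial in
`B i`. -/
def PolyComp {ι : Type} (P : ι → Prop) (B : ι → ℕ) (x y : ι → Data) : Prop :=
  ∃ (p : Prog) (τ : ι → ℕ), PolyBdd P B τ ∧ ∀ i, P i → ∃ t ≤ τ i, p.Runs (x i) (y i) t

theorem Prog.Runs.loop_exit {c f : Prog} {x : Data} {s : ℕ} (h : c.Runs x .nil s) :
    (Prog.loop c f).Runs x x (s + 1) := by
  constructor
  exact h

theorem Prog.exists_const (d : Data) : ∃ (p : Prog) (t : ℕ), ∀ x, p.Runs x d t := by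
  induction d with
  | nil => exact ⟨.nil, 1, fun x => .nil x⟩
  | cons l r hl hr =>
    obtain ⟨p, s, hp⟩ := hl
    obtain ⟨q, t, hq⟩ := hr
    exact ⟨.cons p q, s + t + 1, fun x => .cons (hp x) (hq x)⟩

namespace PolyComp

variable {ι κ : Type} {P : ι → Prop} {B : ι → ℕ} {e x y z : ι → Data}

theorem of_program (p : Prog) (c : ℕ) (h : ∀ i, P i → p.Runs (x i) (y i) c) :
    PolyComp P B x y :=
  ⟨p, fun _ => c, .const c, fun i hi => ⟨c, le_rfl, h i hi⟩⟩

theorem congr (h : PolyComp P B x y) (hy : ∀ i, P i → y i = z i) : PolyComp P B x z := by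
  obtain ⟨p, τ, hτ, hp⟩ := h
  refine ⟨p, τ, hτ, fun i hi => ?_⟩
  rw [← hy i hi]
  exact hp i hi

theorem reindex {Q : κ → Prop} (h : PolyComp P B x y) (φ : κ → ι) (hφ : ∀ q, Q q → P (φ q)) :
    PolyComp Q (fun q => B (φ q)) (fun q => x (φ q)) (fun q => y (φ q)) := by
  obtain ⟨p, τ, hτ, hp⟩ := h
  exact ⟨p, _, hτ.reindex φ hφ, fun q hq => hp _ (hφ q hq)⟩

theorem id : PolyComp P B x x := of_program .id 1 fun _ _ => .id _

theorem const (d : Data) : PolyComp P B x (fun _ => d) := by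
  obtain ⟨p, t, hp⟩ := Prog.exists_const d
  exact of_program p t fun i _ => hp _

theorem comp (h : PolyComp P B x y) (h' : PolyComp P B y z) : PolyComp P B x z := by
  obtain ⟨p, τ, hτ, hp⟩ := h
  obtain ⟨q, σ, hσ, hq⟩ := h'
  refine ⟨.seq p q, _, (hτ.add hσ).add (.const 1), fun i hi => ?_⟩
  obtain ⟨s, hs, hs'⟩ := hp i hi
  obtain ⟨t, ht, ht'⟩ := hq i hi
  exact ⟨s + t + 1, by show _ ≤ τ i + σ i + 1; omega, .seq hs' ht'⟩

theorem pair (h : PolyComp P B x y) (h' : PolyComp P B x z) :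
    PolyComp P B x (fun i => .cons (y i) (z i)) := by
  obtain ⟨p, τ, hτ, hp⟩ := h
  obtain ⟨q, σ, hσ, hq⟩ := h'
  refine ⟨.cons p q, _, (hτ.add hσ).add (.const 1), fun i hi => ?_⟩
  obtain ⟨s, hs, hs'⟩ := hp i hi
  obtain ⟨t, ht, ht'⟩ := hq i hi
  exact ⟨s + t + 1, by show _ ≤ τ i + σ i + 1; omega, .cons hs' ht'⟩

theorem hd : PolyComp P B x (fun i => (x i).hd) := of_program .hd 1 fun _ _ => .hd _
theorem tl : PolyComp P B x (fun i => (x i).tl) := of_program .tl 1 fun _ _ => .tl _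

/-- Compute `y`, put it in front of the environment, and go on. -/
theorem bind (h : PolyComp P B e y) (h' : PolyComp P B (fun i => .cons (y i) (e i)) z) :
    PolyComp P B e z :=
  (h.pair id).comp h'

/-- The environment is a stack: `v0`, `v1`, ... read its entries as de Bruijn indices, and `wk`
skips the top entry. -/
theorem v0 : PolyComp P B (fun i => .cons (y i) (e i)) y := hd
theorem wk (h : PolyComp P B e z) : PolyComp P B (fun i => .cons (y i) (e i)) z :=
  PolyComp.comp (y := e) tl h

section
variable {a b c : ι → Data}

theorem v1 : PolyComp P B (fun i => .cons (a i) (.cons (y i) (e i))) y := v0.wk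

theorem v2 : PolyComp P B (fun i => .cons (a i) (.cons (b i) (.cons (y i) (e i)))) y := v1.wk

theorem v3 : PolyComp P B
    (fun i => .cons (a i) (.cons (b i) (.cons (c i) (.cons (y i) (e i))))) y := v2.wk

end

theorem fst (h : PolyComp P B e (fun i => .cons (y i) (z i))) : PolyComp P B e y := h.comp v0
theorem snd (h : PolyComp P B e (fun i => .cons (y i) (z i))) : PolyComp P B e z :=
  h.comp (wk id)

theorem ite {c : ι → Bool} (hc : PolyComp P B e (fun i => .ofBool (c i)))
    (hy : PolyComp (fun i => P i ∧ c i = true) B e y)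
    (hz : PolyComp (fun i => P i ∧ c i = false) B e z) :
    PolyComp P B e (fun i => if c i = true then y i else z i) := by
  obtain ⟨p, τ, hτ, hp⟩ := hc
  obtain ⟨q, σ, ⟨k, hσ⟩, hq⟩ := hy
  obtain ⟨r, ρ, ⟨l, hρ⟩, hr⟩ := hz
  -- The running times `σ` and `ρ` are bounded on their own branches only, so explicit powers
  -- replace them in a bound valid on both.
  refine ⟨.cond p q r, fun i => τ i + (B i + 2) ^ k + (B i + 2) ^ l + 1,
    ((hτ.add ⟨k, fun _ _ => le_rfl⟩).add ⟨l, fun _ _ => le_rfl⟩).add (.const 1), fun i hi => ?_⟩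
  obtain ⟨s, hs, hs'⟩ := hp i hi
  cases hci : c i with
  | true =>
    obtain ⟨t, ht, ht'⟩ := hq i ⟨hi, hci⟩
    have := hσ i ⟨hi, hci⟩
    simp only [hci] at hs'
    exact ⟨s + t + 1, by simp only; omega, by
      simp only [hci, if_true]
      exact .cond_true hs' ht'⟩
  | false =>
    obtain ⟨t, ht, ht'⟩ := hr i ⟨hi, hci⟩
    have := hρ i ⟨hi, hci⟩
    simp only [hci] at hs'
    exact ⟨s + t + 1, by simp only; omega, by
      simp only [hci, Bool.false_eq_true, if_false]
      exact .cond_false hs' ht'⟩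

open Data

/-- Iteration over a list; the step has to be computed for the reachable accumulators only. -/
theorem foldl {α β : Type} {ea : α → Data} {eb : β → Data} {l : ι → List α} {b : ι → β}
    {step : ι → β → α → β}
    (hl : PolyComp P B e (fun i => ofList ea (l i))) (hb : PolyComp P B e (fun i => eb (b i)))
    (hlen : PolyBdd P B (fun i => (l i).length))
    (hstep : PolyComp (fun q : ι × β × α => P q.1 ∧ ∃ l₁ l₂, l q.1 = l₁ ++ q.2.2 :: l₂ ∧
        q.2.1 = l₁.foldl (step q.1) (b q.1)) (fun q => B q.1)
      (fun q => .cons (ea q.2.2) (.cons (eb q.2.1) (e q.1)))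
      (fun q => eb (step q.1 q.2.1 q.2.2))) :
    PolyComp P B e (fun i => eb ((l i).foldl (step i) (b i))) := by
  obtain ⟨q, σ, ⟨k, hσ⟩, hq⟩ := hstep
  -- The loop state is (remaining list, (accumulator, environment)). The guard `.hd` is `nil`
  -- exactly when the list is used up. Apart from `q`, one round has constant cost, for which 20 is
  -- generous.
  set body : Prog := .cons (.seq .hd .tl) (.cons (.seq (.cons (.seq .hd .hd) .tl) q) (.seq .tl .tl))
    with hbody
  have hloop : PolyComp P B (fun i => .cons (ofList ea (l i)) (.cons (eb (b i)) (e i)))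
      (fun i => .cons .nil (.cons (eb ((l i).foldl (step i) (b i))) (e i))) := by
    refine ⟨.loop .hd body, fun i => (l i).length * ((B i + 2) ^ k + 20) + 2,
      (hlen.mul ((PolyBdd.add ⟨k, fun _ _ => le_rfl⟩ (.const 20)))).add (.const 2),
      fun i hi => ?_⟩
    -- The induction is on the unread part `l₂`; the split into `l₁` and `l₂` is what certifies that
    -- the accumulator is reachable.
    suffices H : ∀ l₂ l₁, l i = l₁ ++ l₂ → ∃ t ≤ l₂.length * ((B i + 2) ^ k + 20) + 2,
        (Prog.loop .hd body).Runs
          (.cons (ofList ea l₂) (.cons (eb (l₁.foldl (step i) (b i))) (e i)))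
          (.cons .nil (.cons (eb ((l i).foldl (step i) (b i))) (e i))) t from
      H (l i) [] rfl
    intro l₂
    induction l₂ with
    | nil =>
      intro l₁ h
      rw [List.append_nil] at h
      rw [h]
      exact ⟨2, by simp, .loop_exit (.hd _)⟩
    | cons a l₂ ih =>
      intro l₁ h
      obtain ⟨u, hu, hu'⟩ := ih (l₁ ++ [a]) (by simp [h])
      have hP : P i ∧ ∃ l₁' l₂', l i = l₁' ++ a :: l₂' ∧
        l₁.foldl (step i) (b i) = l₁'.foldl (step i) (b i) := ⟨hi, l₁, l₂, h, rfl⟩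
      obtain ⟨t, ht, ht'⟩ := hq (i, l₁.foldl (step i) (b i), a) hP
      have hb := hσ (i, l₁.foldl (step i) (b i), a) hP
      rw [List.foldl_append, List.foldl_cons, List.foldl_nil] at hu'
      refine ⟨_, ?_, .loop_step (.hd _) (.cons (.seq (.hd _) (.tl _))
        (.cons (.seq (.cons (.seq (.hd _) (.hd _)) (.tl _)) ht') (.seq (.tl _) (.tl _)))) hu'⟩
      simp only [List.length_cons, Nat.add_mul] at hu hb ⊢
      omega
  exact ((hl.pair (hb.pair id)).comp hloop).comp v1

end PolyComp

/-! ### Lists and unary numbers as trees. -/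

namespace Data

/-- A unary number is a list of units, so programs on lists also do arithmetic. -/
theorem ofNat_eq (n : ℕ) : ofNat n = ofList (fun _ : Unit => nil) (List.replicate n ()) := by
  induction n with
  | zero => rfl
  | succ n ih => rw [List.replicate_succ, ofList, ← ih, ofNat]

theorem ofList_unit (l : List Unit) : ofList (fun _ : Unit => nil) l = ofNat l.length := by
  rw [ofNat_eq]
  congr
  exact List.eq_replicate_of_mem fun _ _ => rfl

theorem ofList_map {α β : Type} (e : β → Data) (g : α → β) (l : List α) :
    ofList e (l.map g) = ofList (fun a => e (g a)) l := by
  induction l with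
  | nil => rfl
  | cons a l ih => rw [List.map_cons, ofList, ih, ofList]

theorem tl_ofNat (n : ℕ) : (ofNat n).tl = ofNat (n - 1) := by cases n <;> rfl

theorem tl_ofList {α : Type} (e : α → Data) (l : List α) : (ofList e l).tl = ofList e l.tail := by
  cases l <;> rfl

theorem hd_ofList {α : Type} (e : α → Data) (l : List α) (h : l ≠ []) :
    (ofList e l).hd = e (l.head h) := by
  cases l with
  | nil => exact absurd rfl h
  | cons a l => rfl

end Data

theorem List.foldl_replicate_unit {β : Type} (f : β → β) (n : ℕ) (b : β) :
    (List.replicate n ()).foldl (fun b _ => f b) b = f^[n] b := by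
  induction n generalizing b with
  | zero => rfl
  | succ n ih => rw [List.replicate_succ, List.foldl_cons, ih, Function.iterate_succ_apply]

/-! ### Polynomial-time programs on lists and numbers. -/

namespace PolyComp
open Data

variable {ι : Type} {P : ι → Prop} {B : ι → ℕ} {e : ι → Data} {α β : Type}
  {ea : α → Data} {eb : β → Data} {l l' : ι → List α} {m n : ι → ℕ}

theorem nil_list : PolyComp P B e (fun _ => ofList ea []) := const _

theorem cons_list {a : ι → α} (ha : PolyComp P B e (fun i => ea (a i)))
    (hl : PolyComp P B e (fun i => ofList ea (l i))) :
    PolyComp P B e (fun i => ofList ea (a i :: l i)) := ha.pair hl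

/-- Iterated application of a function. -/
theorem iterate {b : ι → β} {step : ι → β → β}
    (hn : PolyComp P B e (fun i => ofNat (n i))) (hb : PolyComp P B e (fun i => eb (b i)))
    (hlen : PolyBdd P B n)
    (hstep : PolyComp (fun q : ι × β => P q.1 ∧ ∃ k < n q.1, q.2 = (step q.1)^[k] (b q.1))
      (fun q => B q.1) (fun q => .cons (eb q.2) (e q.1)) (fun q => eb (step q.1 q.2))) :
    PolyComp P B e (fun i => eb ((step i)^[n i] (b i))) := by
  have h := foldl (P := P) (B := B) (e := e) (ea := fun _ : Unit => nil) (eb := eb)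
    (l := fun i => List.replicate (n i) ()) (b := b) (step := fun i b _ => step i b)
    (hn.congr fun i _ => ofNat_eq _) hb (hlen.mono fun i _ => by simp)
    (wk (hstep.reindex (fun q : ι × β × Unit => (q.1, q.2.1)) (by
      rintro ⟨i, b', u⟩ ⟨hP, l₁, l₂, h, hb'⟩
      have h1 : l₁ = List.replicate l₁.length () := List.eq_replicate_of_mem fun _ _ => rfl
      have h2 : n i = l₁.length + (l₂.length + 1) := by simpa using congrArg List.length h
      refine ⟨hP, l₁.length, by simp only; omega, ?_⟩
      rw [← List.foldl_replicate_unit, ← h1]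
      exact hb')))
  refine h.congr fun i _ => ?_
  rw [List.foldl_replicate_unit]

theorem reverse (hl : PolyComp P B e (fun i => ofList ea (l i)))
    (hlen : PolyBdd P B (fun i => (l i).length)) :
    PolyComp P B e (fun i => ofList ea (l i).reverse) := by
  refine (foldl (eb := ofList ea) (b := fun _ => []) (step := fun _ b a => a :: b) hl nil_list hlen
    (cons_list v0 v1)).congr fun i _ => ?_
  rw [List.foldl_flip_cons_eq_append', List.append_nil]

theorem reverse_append (hl : PolyComp P B e (fun i => ofList ea (l i)))
    (hl' : PolyComp P B e (fun i => ofList ea (l' i)))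
    (hlen : PolyBdd P B (fun i => (l i).length)) :
    PolyComp P B e (fun i => ofList ea ((l i).reverse ++ l' i)) := by
  refine (foldl (eb := ofList ea) (b := l') (step := fun _ b a => a :: b) hl hl' hlen
    (cons_list v0 v1)).congr fun i _ => ?_
  rw [List.foldl_flip_cons_eq_append']

theorem append (hl : PolyComp P B e (fun i => ofList ea (l i)))
    (hl' : PolyComp P B e (fun i => ofList ea (l' i)))
    (hlen : PolyBdd P B (fun i => (l i).length)) :
    PolyComp P B e (fun i => ofList ea (l i ++ l' i)) := by
  refine (reverse_append (hl.reverse hlen) hl' (hlen.mono fun i _ => by simp)).congr fun i _ => ?_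
  rw [List.reverse_reverse]

/-- Each block is pushed in reverse onto the accumulator, which costs only the length of the block;
one reversal at the end restores the order. -/
theorem flatMap {g : ι → α → List β} (hl : PolyComp P B e (fun i => ofList ea (l i)))
    (hlen : PolyBdd P B (fun i => (l i).length))
    (hlen' : PolyBdd P B (fun i => ((l i).flatMap (g i)).length))
    (hg : PolyComp (fun q : ι × α => P q.1 ∧ q.2 ∈ l q.1) (fun q => B q.1)
      (fun q => .cons (ea q.2) (e q.1)) (fun q => ofList eb (g q.1 q.2))) :
    PolyComp P B e (fun i => ofList eb ((l i).flatMap (g i))) := by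
  have h := foldl (eb := ofList eb) (b := fun _ => []) (step := fun i b a => (g i a).reverse ++ b)
    hl nil_list hlen (reverse_append
      (comp (y := fun q : ι × _ × α => .cons (ea q.2.2) (e q.1)) (pair v0 (wk (wk id)))
        (hg.reindex (fun q : ι × _ × α => (q.1, q.2.2)) fun q hq => by
          obtain ⟨hq, l₁, l₂, h, -⟩ := hq
          exact ⟨hq, by simp [h]⟩)) v1
      ((hlen'.reindex Prod.fst fun q (hq : P q.1 ∧ _) => hq.1).mono fun q hq => by
        obtain ⟨-, l₁, l₂, h, -⟩ := hq
        simp only [h, List.flatMap_append, List.flatMap_cons, List.length_append]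
        omega))
  have H : ∀ i, (l i).foldl (fun b a => (g i a).reverse ++ b) [] =
      ((l i).flatMap (g i)).reverse := by
    intro i
    suffices ∀ (l : List α) b, l.foldl (fun b a => (g i a).reverse ++ b) b =
        (l.flatMap (g i)).reverse ++ b by simpa using this (l i) []
    intro l
    induction l with
    | nil => simp
    | cons a l ih => intro b; simp [ih]
  refine ((h.congr fun i _ => congrArg _ (H i)).reverse
    (hlen'.mono fun i _ => by simp)).congr fun i _ => ?_
  rw [List.reverse_reverse]

theorem map {g : ι → α → β} (hl : PolyComp P B e (fun i => ofList ea (l i)))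
    (hlen : PolyBdd P B (fun i => (l i).length))
    (hg : PolyComp (fun q : ι × α => P q.1 ∧ q.2 ∈ l q.1) (fun q => B q.1)
      (fun q => .cons (ea q.2) (e q.1)) (fun q => eb (g q.1 q.2))) :
    PolyComp P B e (fun i => ofList eb ((l i).map (g i))) := by
  refine (flatMap (g := fun i a => [g i a]) hl hlen (hlen.mono fun i _ => by simp)
    (cons_list hg nil_list)).congr fun i _ => ?_
  rw [← List.map_eq_flatMap]

theorem filter {g : ι → α → Bool} (hl : PolyComp P B e (fun i => ofList ea (l i)))
    (hlen : PolyBdd P B (fun i => (l i).length))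
    (hg : PolyComp (fun q : ι × α => P q.1 ∧ q.2 ∈ l q.1) (fun q => B q.1)
      (fun q => .cons (ea q.2) (e q.1)) (fun q => ofBool (g q.1 q.2))) :
    PolyComp P B e (fun i => ofList ea ((l i).filter (g i))) := by
  have H : ∀ i, (l i).flatMap (fun a => if g i a = true then [a] else []) =
      (l i).filter (g i) := fun i => by
    induction l i with
    | nil => rfl
    | cons a l ih => by_cases h : g i a <;> simp [h, ih]
  refine (flatMap (g := fun i a => if g i a = true then [a] else []) hl hlen
    (hlen.mono fun i _ => by rw [H]; exact List.length_filter_le _ _)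
    ((ite hg (cons_list v0 nil_list) nil_list).congr fun q _ => by split <;> rfl)).congr
      fun i _ => ?_
  rw [H]

theorem all {g : ι → α → Bool} (hl : PolyComp P B e (fun i => ofList ea (l i)))
    (hlen : PolyBdd P B (fun i => (l i).length))
    (hg : PolyComp (fun q : ι × α => P q.1 ∧ q.2 ∈ l q.1) (fun q => B q.1)
      (fun q => .cons (ea q.2) (e q.1)) (fun q => ofBool (g q.1 q.2))) :
    PolyComp P B e (fun i => ofBool ((l i).all (g i))) := by
  refine (foldl (eb := ofBool) (b := fun _ => true)
    (step := fun i b a => if g i a = true then b else false) hl (const _) hlen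
      ((ite (c := fun q : ι × Bool × α => g q.1 q.2.2) (y := fun q => ofBool q.2.1)
        (z := fun _ => ofBool false)
        (comp (y := fun q : ι × _ × α => .cons (ea q.2.2) (e q.1)) (pair v0 (wk (wk id)))
        (hg.reindex (fun q : ι × _ × α => (q.1, q.2.2)) fun q hq => by
          obtain ⟨hq, l₁, l₂, h, -⟩ := hq
          exact ⟨hq, by simp [h]⟩)) v1 (const _)).congr fun q _ => by split <;> rfl)).congr
            fun i _ => ?_
  suffices ∀ (l : List α) b, l.foldl (fun b a => if g i a = true then b else false) b =
      (b && l.all (g i)) by rw [this]; simp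
  intro l
  induction l with
  | nil => simp
  | cons a l ih => intro b; rw [List.foldl_cons, ih]; by_cases h : g i a <;> simp [h]

theorem not {a : ι → Bool} (ha : PolyComp P B e (fun i => ofBool (a i))) :
    PolyComp P B e (fun i => ofBool (!a i)) :=
  (ite ha (const (ofBool false)) (const (ofBool true))).congr fun i _ => by cases a i <;> rfl

theorem and {a b : ι → Bool} (ha : PolyComp P B e (fun i => ofBool (a i)))
    (hb : PolyComp P B e (fun i => ofBool (b i))) :
    PolyComp P B e (fun i => ofBool (a i && b i)) :=
  (ite ha (hb.reindex (fun i => i) fun _ h => h.1) (const (ofBool false))).congr fun i _ => by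
    cases a i <;> rfl

theorem or {a b : ι → Bool} (ha : PolyComp P B e (fun i => ofBool (a i)))
    (hb : PolyComp P B e (fun i => ofBool (b i))) :
    PolyComp P B e (fun i => ofBool (a i || b i)) :=
  (ite ha (const (ofBool true)) (hb.reindex (fun i => i) fun _ h => h.1)).congr fun i _ => by
    cases a i <;> rfl

theorem beq_bool {a b : ι → Bool} (ha : PolyComp P B e (fun i => ofBool (a i)))
    (hb : PolyComp P B e (fun i => ofBool (b i))) :
    PolyComp P B e (fun i => ofBool (a i == b i)) :=
  (ite ha (hb.reindex (fun i => i) fun _ h => h.1)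
    (hb.not.reindex (fun i => i) fun _ h => h.1)).congr fun i _ => by
    cases a i <;> cases b i <;> rfl

theorem any {g : ι → α → Bool} (hl : PolyComp P B e (fun i => ofList ea (l i)))
    (hlen : PolyBdd P B (fun i => (l i).length))
    (hg : PolyComp (fun q : ι × α => P q.1 ∧ q.2 ∈ l q.1) (fun q => B q.1)
      (fun q => .cons (ea q.2) (e q.1)) (fun q => ofBool (g q.1 q.2))) :
    PolyComp P B e (fun i => ofBool ((l i).any (g i))) :=
  (all (g := fun i a => !g i a) hl hlen hg.not).not.congr fun i _ => by
    simp [List.not_all_eq_any_not]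

theorem drop (hl : PolyComp P B e (fun i => ofList ea (l i)))
    (hn : PolyComp P B e (fun i => ofNat (n i))) (hn' : PolyBdd P B n) :
    PolyComp P B e (fun i => ofList ea ((l i).drop (n i))) := by
  refine (iterate (eb := ofList ea) (b := l) (step := fun _ l => l.tail) hn hl hn'
    (comp v0 (tl.congr fun q _ => tl_ofList _ _))).congr fun i _ => ?_
  rw [List.tail_iterate]

theorem getD {d : α} (hl : PolyComp P B e (fun i => ofList ea (l i)))
    (hn : PolyComp P B e (fun i => ofNat (n i))) (hn' : PolyBdd P B n)
    (h : ∀ i, P i → n i < (l i).length) :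
    PolyComp P B e (fun i => ea ((l i).getD (n i) d)) :=
  ((hl.drop hn hn').comp hd).congr fun i hi => by
    rw [hd_ofList _ _ (by simpa using h i hi), List.head_drop, List.getD_eq_getElem _ _ (h i hi)]

/-! #### Natural numbers -/

theorem length (hl : PolyComp P B e (fun i => ofList ea (l i)))
    (hlen : PolyBdd P B (fun i => (l i).length)) :
    PolyComp P B e (fun i => ofNat (l i).length) :=
  (map (eb := fun _ : Unit => nil) (g := fun _ _ => ()) hl hlen (const _)).congr fun i _ => by
    rw [ofList_unit, List.length_map]

theorem add (hm : PolyComp P B e (fun i => ofNat (m i)))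
    (hn : PolyComp P B e (fun i => ofNat (n i))) (hm' : PolyBdd P B m) :
    PolyComp P B e (fun i => ofNat (m i + n i)) :=
  (append (hm.congr fun i _ => ofNat_eq _) (hn.congr fun i _ => ofNat_eq _)
    (hm'.mono fun i _ => by simp)).congr fun i _ => by simp [ofList_unit]

theorem succ (hn : PolyComp P B e (fun i => ofNat (n i))) :
    PolyComp P B e (fun i => ofNat (n i + 1)) := (const .nil).pair hn

theorem sub (hm : PolyComp P B e (fun i => ofNat (m i)))
    (hn : PolyComp P B e (fun i => ofNat (n i))) (hn' : PolyBdd P B n) :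
    PolyComp P B e (fun i => ofNat (m i - n i)) :=
  (iterate (eb := ofNat) (b := m) (step := fun _ k => k - 1) hn hm hn'
    (comp v0 (tl.congr fun q _ => tl_ofNat _))).congr fun i _ => by
      congr
      induction n i with
      | zero => rfl
      | succ n ih => rw [Function.iterate_succ_apply', ih]; omega

theorem sum {g : ι → α → ℕ} (hl : PolyComp P B e (fun i => ofList ea (l i)))
    (hlen : PolyBdd P B (fun i => (l i).length))
    (hsum : PolyBdd P B (fun i => ((l i).map (g i)).sum))
    (hg : PolyComp (fun q : ι × α => P q.1 ∧ q.2 ∈ l q.1) (fun q => B q.1)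
      (fun q => .cons (ea q.2) (e q.1)) (fun q => ofNat (g q.1 q.2))) :
    PolyComp P B e (fun i => ofNat ((l i).map (g i)).sum) :=
  (flatMap (eb := fun _ : Unit => nil) (g := fun i a => List.replicate (g i a) ()) hl hlen
    (hsum.mono fun i _ => by simp [List.length_flatMap])
    (hg.congr fun i _ => ofNat_eq _)).congr fun i _ => by
      simp [ofList_unit, List.length_flatMap]

theorem mul (hm : PolyComp P B e (fun i => ofNat (m i)))
    (hn : PolyComp P B e (fun i => ofNat (n i))) (hm' : PolyBdd P B m) (hn' : PolyBdd P B n) :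
    PolyComp P B e (fun i => ofNat (m i * n i)) :=
  (sum (g := fun i _ => n i) (hm.congr fun i _ => ofNat_eq _) (hm'.mono fun i _ => by simp)
    ((hm'.mul hn').mono fun i _ => by simp)
    (wk (hn.reindex Prod.fst fun q hq => hq.1))).congr fun i _ => by simp

theorem isZero (hn : PolyComp P B e (fun i => ofNat (n i))) :
    PolyComp P B e (fun i => ofBool (n i == 0)) := by
  obtain ⟨p, τ, hτ, hp⟩ := hn
  refine ⟨.cond p .nil (.cons .nil .nil), _, hτ.add (.const 4), fun i hi => ?_⟩
  obtain ⟨t, ht, ht'⟩ := hp i hi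
  cases hn : n i with
  | zero =>
    simp only [hn] at ht'
    exact ⟨t + 3 + 1, Nat.add_le_add_right ht 4, by
      simp only [hn]
      exact .cond_false ht' (.cons (.nil _) (.nil _))⟩
  | succ k =>
    simp only [hn] at ht'
    exact ⟨t + 1 + 1, by omega, by
      simp only [hn]
      exact .cond_true ht' (.nil _)⟩

theorem le (hm : PolyComp P B e (fun i => ofNat (m i)))
    (hn : PolyComp P B e (fun i => ofNat (n i))) (hn' : PolyBdd P B n) :
    PolyComp P B e (fun i => ofBool (decide (m i ≤ n i))) :=
  (hm.sub hn hn').isZero.congr fun i _ => by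
    congr 1
    rw [Bool.eq_iff_iff]
    simp [Nat.sub_eq_zero_iff_le]

theorem lt (hm : PolyComp P B e (fun i => ofNat (m i)))
    (hn : PolyComp P B e (fun i => ofNat (n i))) (hn' : PolyBdd P B n) :
    PolyComp P B e (fun i => ofBool (decide (m i < n i))) :=
  le hm.succ hn hn'

theorem beq (hm : PolyComp P B e (fun i => ofNat (m i)))
    (hn : PolyComp P B e (fun i => ofNat (n i))) (hm' : PolyBdd P B m) (hn' : PolyBdd P B n) :
    PolyComp P B e (fun i => ofBool (m i == n i)) :=
  ((hm.le hn hn').and (hn.le hm hm')).congr fun i _ => by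
    congr 1
    rw [Bool.eq_iff_iff]
    simp [Nat.le_antisymm_iff]

/-- A counter is incremented `m i` times and is reset to 0 whenever it reaches `n i`. -/
theorem mod (hm : PolyComp P B e (fun i => ofNat (m i)))
    (hn : PolyComp P B e (fun i => ofNat (n i))) (hm' : PolyBdd P B m) (hn' : PolyBdd P B n)
    (hpos : ∀ i, P i → 0 < n i) :
    PolyComp P B e (fun i => ofNat (m i % n i)) := by
  have H : ∀ i k, 0 < n i →
      (fun c => if (c + 1 == n i) = true then 0 else c + 1)^[k] 0 = k % n i := by
    intro i k hi
    induction k with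
    | zero => simp
    | succ k ih =>
      rw [Function.iterate_succ_apply', ih]
      have := Nat.mod_lt k hi
      simp only [beq_iff_eq]
      rw [Nat.add_mod]
      split_ifs with h
      · rcases Nat.lt_or_ge 1 (n i) with h1 | h1
        · rw [Nat.mod_eq_of_lt h1, h, Nat.mod_self]
        · rw [show n i = 1 by omega, Nat.mod_one]
      · rw [Nat.mod_eq_of_lt (a := 1) (by omega),
          Nat.mod_eq_of_lt (a := k % n i + 1) (by omega)]
  have hn1 : PolyComp (fun q : ι × ℕ => P q.1 ∧ ∃ k < m q.1,
      q.2 = (fun c => if (c + 1 == n q.1) = true then 0 else c + 1)^[k] 0) (fun q => B q.1)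
      (fun q => .cons (ofNat q.2) (e q.1)) (fun q => ofNat (n q.1)) :=
    wk (hn.reindex Prod.fst fun q hq => hq.1)
  refine (iterate (eb := ofNat) (b := fun _ => 0)
    (step := fun i c => if (c + 1 == n i) = true then 0 else c + 1) hm (const (ofNat 0)) hm'
      ((ite (c := fun q : ι × ℕ => q.2 + 1 == n q.1) (beq (succ v0) hn1
        ((hn'.reindex Prod.fst fun q hq => hq.1).mono (fun q hq => ?_))
        (hn'.reindex Prod.fst fun q hq => hq.1)) (const (ofNat 0)) (succ v0)).congr
          fun q _ => by split <;> rfl)).congr fun i hi => by rw [H i _ (hpos i hi)]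
  obtain ⟨hq, k, -, h⟩ := hq
  rw [H _ _ (hpos _ hq)] at h
  rw [h]
  exact Nat.mod_lt _ (hpos _ hq)

theorem range (hn : PolyComp P B e (fun i => ofNat (n i))) (hn' : PolyBdd P B n) :
    PolyComp P B e (fun i => ofList ofNat (List.range (n i))) := by
  have H : ∀ k, (fun l : List ℕ => l.length :: l)^[k] [] = (List.range k).reverse := by
    intro k
    induction k with
    | zero => rfl
    | succ k ih => rw [Function.iterate_succ_apply', ih, List.range_succ]; simp
  have h := iterate (eb := ofList ofNat) (b := fun _ => [])
    (step := fun _ (l : List ℕ) => l.length :: l) hn nil_list hn'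
      (cons_list (length v0 ((hn'.reindex Prod.fst fun q hq => hq.1).mono fun q hq => by
        obtain ⟨-, k, hk, h⟩ := hq
        rw [h, H]
        simpa using hk.le)) v0)
  refine ((h.congr fun i _ => congrArg _ (H _)).reverse (hn'.mono fun i _ => by simp)).congr
    fun i _ => ?_
  rw [List.reverse_reverse]

end PolyComp

/-! ### From 3-SAT to HORN-SAT-MOD

Formulas are lists of clauses, and polynomials are lists of terms `(S, a)` standing for
`a * ∏ j ∈ S, Y j`. The variable `3 * j + k` of the Horn instance says that clause `j` is satisfied
through its literal `k`. There is one more variable for each product of such variables that occurs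
in the expansion of the polynomial at `Y j = u (3 * j) + u (3 * j + 1) + u (3 * j + 2)`. -/

namespace HornReduction

abbrev Formula : Type := List (List (ℕ × Bool))
abbrev Terms : Type := List (List ℕ × ℕ)

def litAt (F : Formula) (j k : ℕ) : ℕ × Bool := (F.getD j []).getD k (0, false)

def Sat (F : Formula) : Prop :=
  ∃ x : ℕ → Bool, ∀ j < F.length, ∃ k < 3, x (litAt F j k).1 = (litAt F j k).2

/-- The first alternative keeps `Y j` in {0, 1}; the second makes the chosen literals jointly
satisfiable. -/
def conflict (F : Formula) (j k j' k' : ℕ) : Bool :=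
  (j == j' && !(k == k')) ||
    ((litAt F j k).1 == (litAt F j' k').1 && !((litAt F j k).2 == (litAt F j' k').2))

/-- The ways to choose one literal in each of the clauses of `S`. -/
def choices (S : List ℕ) : List (List ℕ) :=
  S.foldl (fun acc j => acc.flatMap fun c => [(3 * j + 0) :: c, (3 * j + 1) :: c, (3 * j + 2) :: c])
    [[]]

def conjs (L : Terms) : Terms := L.flatMap fun t => (choices t.1).map fun c => (c, t.2)

def conflictImps (F : Formula) (last : ℕ) : Terms :=
  (List.range F.length).flatMap fun j => (List.range 3).flatMap fun k =>
    (List.range F.length).flatMap fun j' => (List.range 3).flatMap fun k' =>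
      if conflict F j k j' k' = true then [([3 * j + k, 3 * j' + k'], last)] else []

/-- The implications in the two directions force the variable `3 * m + e` to equal its product. -/
def conjImps (m : ℕ) (Z : Terms) : Terms :=
  (List.range Z.length).flatMap fun e =>
    ((Z.getD e ([], 0)).1, 3 * m + e) ::
      (Z.getD e ([], 0)).1.map fun v => ([3 * m + e], v)

/-- This variable is fixed to 0, so an implication with it as head forbids the body. Its index is
also the number of all the other variables. -/
def lastVar (m : ℕ) (L : Terms) : ℕ := 3 * m + (conjs L).length

def imps (F : Formula) (L : Terms) : Terms :=
  conflictImps F (lastVar F.length L) ++ conjImps F.length (conjs L)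

def coeffs (m : ℕ) (L : Terms) : List ℕ :=
  List.replicate (3 * m) 0 ++ ((conjs L).map Prod.snd ++ [0])

def hornInstance (M : ℕ) [NeZero M] (F : Formula) (L : Terms) :
    HornModInstance M (lastVar F.length L + 1) where
  clauses := .isZero (Fin.ofNat _ (lastVar F.length L)) ::
    (imps F L).map fun c => .imp (c.1.map fun v => Fin.ofNat _ v) (Fin.ofNat _ c.2)
  coeff i := Fin.ofNat M ((coeffs F.length L).getD i 0)
  rhs := Fin.ofNat M 0

def termSum (L : Terms) (Y : ℕ → Bool) : ℕ :=
  (L.map fun t => if ∀ j ∈ t.1, Y j = true then t.2 else 0).sum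

structure ValidTerms (M m : ℕ) (L : Terms) : Prop where
  index_lt : ∀ t ∈ L, ∀ j ∈ t.1, j < m
  coeff_lt : ∀ t ∈ L, t.2 < M

/-- The polynomial given by `L` represents NAND mod `M` in the variables with index below `m`. -/
structure Represents (M m : ℕ) (L : Terms) : Prop extends ValidTerms M m L where
  dvd_iff : ∀ Y : ℕ → Bool, M ∣ termSum L Y ↔ ∀ j < m, Y j = true

/-! #### Choices -/

theorem choices_concat (S : List ℕ) (j : ℕ) :
    choices (S ++ [j]) = (choices S).flatMap fun c =>
      [(3 * j + 0) :: c, (3 * j + 1) :: c, (3 * j + 2) :: c] := by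
  simp [choices]

theorem length_choices (S : List ℕ) : (choices S).length = 3 ^ S.length := by
  induction S using List.reverseRecOn with
  | nil => rfl
  | append_singleton S j ih =>
    rw [choices_concat, List.length_flatMap]
    simp [ih, pow_succ]

theorem mem_choices {S c : List ℕ} (hc : c ∈ choices S) :
    c.length = S.length ∧ ∀ v ∈ c, ∃ j ∈ S, ∃ k < 3, v = 3 * j + k := by
  induction S using List.reverseRecOn generalizing c with
  | nil =>
    have : c = [] := by simpa [choices] using hc
    simp [this]
  | append_singleton S j ih =>
    rw [choices_concat, List.mem_flatMap] at hc
    obtain ⟨c', hc', h⟩ := hc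
    obtain ⟨h1, h2⟩ := ih hc'
    have : ∃ k < 3, c = (3 * j + k) :: c' := by
      simp only [List.mem_cons, List.not_mem_nil, or_false] at h
      rcases h with h | h | h
      exacts [⟨0, by omega, h⟩, ⟨1, by omega, h⟩, ⟨2, by omega, h⟩]
    obtain ⟨k, hk, rfl⟩ := this
    refine ⟨by simp [h1], fun v hv => ?_⟩
    rcases List.mem_cons.1 hv with rfl | hv
    · exact ⟨j, by simp, k, hk, rfl⟩
    · obtain ⟨j', hj', k', hk', h⟩ := h2 v hv
      exact ⟨j', by simp [hj'], k', hk', h⟩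

/-- This is distributivity for the product over `S` of u (3j) + u (3j+1) + u (3j+2). At most one
summand in each factor is 1, so the factor equals the disjunction. -/
theorem sum_choices (S : List ℕ) (u : ℕ → Bool) (a : ℕ)
    (hu : ∀ j ∈ S, ∀ k < 3, ∀ k' < 3, k ≠ k' → ¬ (u (3 * j + k) = true ∧ u (3 * j + k') = true)) :
    ((choices S).map fun c => if ∀ v ∈ c, u v = true then a else 0).sum =
      if ∀ j ∈ S, (u (3 * j + 0) || u (3 * j + 1) || u (3 * j + 2)) = true then a else 0 := by
  induction S using List.reverseRecOn with
  | nil => simp [choices]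
  | append_singleton S j ih =>
    have hS := ih fun i hi => hu i (by simp [hi])
    have h01 := hu j (by simp) 0 (by omega) 1 (by omega) (by omega)
    have h02 := hu j (by simp) 0 (by omega) 2 (by omega) (by omega)
    have h12 := hu j (by simp) 1 (by omega) 2 (by omega) (by omega)
    have key : ∀ acc : List (List ℕ),
        ((acc.flatMap fun c => [(3 * j + 0) :: c, (3 * j + 1) :: c, (3 * j + 2) :: c]).map
          fun c => if ∀ v ∈ c, u v = true then a else 0).sum =
        if (u (3 * j + 0) || u (3 * j + 1) || u (3 * j + 2)) = true then
          (acc.map fun c => if ∀ v ∈ c, u v = true then a else 0).sum else 0 := by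
      intro acc
      induction acc with
      | nil => simp
      | cons c acc ih =>
        rw [List.flatMap_cons, List.map_append, List.sum_append, ih]
        simp only [List.map_cons, List.map_nil, List.sum_cons, List.sum_nil, List.forall_mem_cons]
        clear hS ih hu
        generalize u (3 * j + 0) = b₀ at h01 h02 ⊢
        generalize u (3 * j + 1) = b₁ at h01 h12 ⊢
        generalize u (3 * j + 2) = b₂ at h02 h12 ⊢
        cases b₀ <;> cases b₁ <;> cases b₂ <;> simp at h01 h02 h12 ⊢
    rw [choices_concat, key, hS]
    simp only [List.mem_append, List.mem_singleton, or_imp, forall_and, forall_eq]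
    by_cases h : (u (3 * j + 0) || u (3 * j + 1) || u (3 * j + 2)) = true <;> simp only [h] <;> simp

theorem length_conjs (L : Terms) : (conjs L).length = (L.map fun t => 3 ^ t.1.length).sum := by
  simp [conjs, List.length_flatMap, length_choices]

theorem mem_conjs {L : Terms} {c : List ℕ × ℕ} (hc : c ∈ conjs L) :
    ∃ t ∈ L, c.1 ∈ choices t.1 ∧ c.2 = t.2 := by
  simp only [conjs, List.mem_flatMap, List.mem_map] at hc
  obtain ⟨t, ht, c', hc', rfl⟩ := hc
  exact ⟨t, ht, hc', rfl⟩

theorem termSum_conjs (L : Terms) (u : ℕ → Bool)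
    (hu : ∀ t ∈ L, ∀ j ∈ t.1, ∀ k < 3, ∀ k' < 3, k ≠ k' →
      ¬ (u (3 * j + k) = true ∧ u (3 * j + k') = true)) :
    termSum (conjs L) u =
      termSum L fun j => u (3 * j + 0) || u (3 * j + 1) || u (3 * j + 2) := by
  induction L with
  | nil => rfl
  | cons t L ih =>
    have h1 := ih fun s hs => hu s (by simp [hs])
    have h2 := sum_choices t.1 u t.2 (hu t (by simp))
    simp only [termSum, conjs, List.flatMap_cons, List.map_append, List.sum_append, List.map_map,
      List.map_cons, List.sum_cons] at h1 ⊢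
    rw [h1, ← h2]
    rfl

/-! #### Bounds on indices and sizes -/

theorem ValidTerms.conjs {M m : ℕ} {L : Terms} (hL : ValidTerms M m L) :
    ValidTerms M (3 * m) (conjs L) where
  index_lt c hc v hv := by
    obtain ⟨t, ht, h, -⟩ := mem_conjs hc
    obtain ⟨j, hj, k, hk, rfl⟩ := (mem_choices h).2 v hv
    have := hL.index_lt t ht j hj
    omega
  coeff_lt c hc := by
    obtain ⟨t, ht, -, h⟩ := mem_conjs hc
    rw [h]
    exact hL.coeff_lt t ht

theorem getD_mem {α : Type} {l : List α} {n : ℕ} (h : n < l.length) (d : α) : l.getD n d ∈ l := by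
  rw [List.getD_eq_getElem _ _ h]
  exact List.getElem_mem h

theorem mem_conflictImps {F : Formula} {n : ℕ} {c : List ℕ × ℕ} :
    c ∈ conflictImps F n ↔ ∃ j < F.length, ∃ k < 3, ∃ j' < F.length, ∃ k' < 3,
      conflict F j k j' k' = true ∧ c = ([3 * j + k, 3 * j' + k'], n) := by
  simp only [conflictImps, List.mem_flatMap, List.mem_range]
  refine exists_congr fun j => and_congr_right fun _ => exists_congr fun k => and_congr_right
    fun _ => exists_congr fun j' => and_congr_right fun _ => exists_congr fun k' =>
    and_congr_right fun _ => ?_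
  split_ifs with h <;> simp [h]

theorem mem_conjImps {m : ℕ} {Z : Terms} {c : List ℕ × ℕ} :
    c ∈ conjImps m Z ↔ ∃ e < Z.length, c = ((Z.getD e ([], 0)).1, 3 * m + e) ∨
      ∃ v ∈ (Z.getD e ([], 0)).1, c = ([3 * m + e], v) := by
  simp only [conjImps, List.mem_flatMap, List.mem_range, List.mem_cons, List.mem_map]
  refine exists_congr fun e => and_congr_right fun _ => or_congr_right ?_
  exact exists_congr fun v => and_congr_right fun _ => eq_comm

theorem imps_lt {M : ℕ} {F : Formula} {L : Terms} (hL : ValidTerms M F.length L)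
    {c : List ℕ × ℕ} (hc : c ∈ imps F L) :
    (∀ v ∈ c.1, v < lastVar F.length L + 1) ∧ c.2 < lastVar F.length L + 1 := by
  rw [imps, List.mem_append, mem_conflictImps, mem_conjImps] at hc
  have hZ := hL.conjs
  rcases hc with ⟨j, hj, k, hk, j', hj', k', hk', -, rfl⟩ | ⟨e, he, rfl | ⟨v, hv, rfl⟩⟩
  · simp only [lastVar, List.mem_cons, List.not_mem_nil, or_false, forall_eq_or_imp, forall_eq]
    omega
  · simp only [lastVar]
    refine ⟨fun v hv => ?_, by omega⟩
    have := hZ.index_lt _ (getD_mem he _) v hv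
    omega
  · have := hZ.index_lt _ (getD_mem he _) v hv
    simp only [lastVar, List.mem_cons, List.not_mem_nil, or_false, forall_eq]
    omega

theorem length_flatMap_le {α β : Type} {l : List α} {g : α → List β} {c : ℕ}
    (h : ∀ a ∈ l, (g a).length ≤ c) : (l.flatMap g).length ≤ l.length * c := by
  rw [List.length_flatMap]
  simpa using List.sum_le_card_nsmul (l.map fun a => (g a).length) c (by simpa using h)

theorem length_conflictImps_le (F : Formula) (n : ℕ) :
    (conflictImps F n).length ≤ F.length * (3 * (F.length * (3 * 1))) := by
  refine (length_flatMap_le fun j _ => (length_flatMap_le fun k _ =>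
    (length_flatMap_le fun j' _ => (length_flatMap_le (c := 1) fun k' _ => ?_)))).trans
      (le_of_eq ?_)
  · split_ifs <;> simp
  · simp

theorem size_hornInstance (M : ℕ) [NeZero M] (F : Formula) (L : Terms)
    (hS : ∀ t ∈ L, t.1.length ≤ F.length) :
    (hornInstance M F L).size ≤ (lastVar F.length L + 1) ^ 3 := by
  have h1 : ((conflictImps F (lastVar F.length L)).map fun c => c.1.length + 1).sum ≤
      F.length * (3 * (F.length * (3 * 1))) * 3 := by
    refine (List.sum_le_card_nsmul _ 3 ?_).trans ?_
    · simp only [List.mem_map, forall_exists_index, and_imp, forall_apply_eq_imp_iff₂]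
      intro c hc
      obtain ⟨j, -, k, -, j', -, k', -, -, rfl⟩ := mem_conflictImps.1 hc
      simp
    · rw [List.length_map, smul_eq_mul]
      exact Nat.mul_le_mul_right _ (length_conflictImps_le F _)
  have h2 : ((conjImps F.length (conjs L)).map fun c => c.1.length + 1).sum ≤
      (conjs L).length * (3 * F.length + 1) := by
    rw [conjImps, List.map_flatMap, List.flatMap_def, List.sum_flatten, List.map_map]
    refine (List.sum_le_card_nsmul _ (3 * F.length + 1) ?_).trans (by simp)
    simp only [List.mem_map, List.mem_range, forall_exists_index, and_imp,
      forall_apply_eq_imp_iff₂]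
    intro e he
    obtain ⟨t, ht, h, -⟩ := mem_conjs (getD_mem he ([], 0))
    have h3 := (mem_choices h).1
    have h4 := hS t ht
    simp only [List.getD_eq_getElem?_getD] at h3
    simp [Function.comp_def]
    omega
  have h : (hornInstance M F L).size = 1 + (((conflictImps F (lastVar F.length L)).map
      fun c => c.1.length + 1).sum + ((conjImps F.length (conjs L)).map
      fun c => c.1.length + 1).sum) := by
    simp [HornModInstance.size, hornInstance, imps, HornClause.size, Function.comp_def]
  rw [h]
  simp only [lastVar] at h1 ⊢
  clear h hS
  generalize ((conflictImps F (3 * F.length + (conjs L).length)).map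
    fun c => c.1.length + 1).sum = a at *
  generalize ((conjImps F.length (conjs L)).map fun c => c.1.length + 1).sum = b at *
  generalize (conjs L).length = z at *
  generalize F.length = m at *
  -- In the expansion of (3m + z + 1)^3, the term 3(3m)^2 = 27 m^2 pays for the conflicts, 6(3m)z +
  -- 3z for the conjunctions, and 1 for the unit clause.
  nlinarith [Nat.zero_le (m * z), Nat.zero_le (m ^ 3), Nat.zero_le (z ^ 3), Nat.zero_le (z ^ 2),
    Nat.zero_le (m ^ 2 * z), Nat.zero_le (m * z ^ 2)]

/-! #### Correctness -/

theorem sum_range_getD {α : Type} (l : List α) (d : α) (g : α → ℕ) :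
    ∑ e ∈ Finset.range l.length, g (l.getD e d) = (l.map g).sum := by
  induction l with
  | nil => rfl
  | cons a l ih =>
    rw [List.length_cons, Finset.sum_range_succ', List.map_cons, List.sum_cons, ← ih, add_comm]
    simp

/-- This removes the `Fin` arithmetic: assignments live on `ℕ`, and only the variables for products
enter the congruence, all other coefficients being 0. -/
theorem satisfiable_iff (M : ℕ) [NeZero M] (F : Formula) (L : Terms)
    (hL : ValidTerms M F.length L) :
    (hornInstance M F L).Satisfiable ↔ ∃ u : ℕ → Bool, u (lastVar F.length L) = false ∧
      (∀ c ∈ imps F L, (∀ v ∈ c.1, u v = true) → u c.2 = true) ∧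
      M ∣ ∑ e ∈ Finset.range (conjs L).length,
        if u (3 * F.length + e) = true then ((conjs L).getD e ([], 0)).2 else 0 := by
  set n := lastVar F.length L with hn
  have hval : ∀ v, v < n + 1 → ((Fin.ofNat (n + 1) v : Fin (n + 1)) : ℕ) = v := fun v hv =>
    Nat.mod_eq_of_lt hv
  have hsum : ∀ u : ℕ → Bool, (∑ i : Fin (n + 1), if u i = true then
      (((hornInstance M F L).coeff i : Fin M) : ℕ) else 0) =
      ∑ e ∈ Finset.range (conjs L).length,
        if u (3 * F.length + e) = true then ((conjs L).getD e ([], 0)).2 else 0 := by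
    intro u
    change (∑ i : Fin (n + 1), if u i = true then
      ((Fin.ofNat M ((coeffs F.length L).getD i 0) : Fin M) : ℕ) else 0) = _
    rw [Fin.sum_univ_eq_sum_range (fun i => if u i = true then
      ((Fin.ofNat M ((coeffs F.length L).getD i 0) : Fin M) : ℕ) else 0), hn, lastVar,
      Finset.sum_range_succ, Finset.sum_range_add]
    have h1 : ∀ i < 3 * F.length, (coeffs F.length L).getD i 0 = 0 := fun i hi => by
      rw [coeffs, List.getD_append _ _ _ _ (by simpa using hi)]
      simp [hi]
    have h2 : ∀ e < (conjs L).length, (coeffs F.length L).getD (3 * F.length + e) 0 =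
        ((conjs L).getD e ([], 0)).2 := fun e he => by
      rw [coeffs, List.getD_append_right _ _ _ _ (by simp), List.getD_append _ _ _ _ (by simpa)]
      simp [he]
    have h3 : (coeffs F.length L).getD (3 * F.length + (conjs L).length) 0 = 0 := by
      rw [coeffs, List.getD_append_right _ _ _ _ (by simp),
        List.getD_append_right _ _ _ _ (by simp)]
      simp
    rw [h3, Finset.sum_eq_zero (s := Finset.range (3 * F.length))]
    · simp only [Fin.ofNat, Nat.zero_mod, ite_self, zero_add, add_zero]
      refine Finset.sum_congr rfl fun e he => ?_
      rw [Finset.mem_range] at he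
      rw [h2 e he, Nat.mod_eq_of_lt (hL.conjs.coeff_lt _ (getD_mem he _))]
    · intro i hi
      rw [h1 i (Finset.mem_range.1 hi)]
      simp [Fin.ofNat]
  have hmod : ∀ s : ℕ, s ≡ (((hornInstance M F L).rhs : Fin M) : ℕ) [MOD M] ↔ M ∣ s := fun s => by
    simp [hornInstance, Fin.ofNat, Nat.modEq_zero_iff_dvd]
  have hholds : ∀ u : ℕ → Bool, (∀ C ∈ (hornInstance M F L).clauses,
      C.Holds (fun i : Fin (n + 1) => u i)) ↔ u n = false ∧
      ∀ c ∈ imps F L, (∀ v ∈ c.1, u v = true) → u c.2 = true := by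
    intro u
    simp only [hornInstance, List.forall_mem_cons, List.forall_mem_map, HornClause.Holds]
    rw [hval _ (by omega)]
    refine and_congr_right fun _ => forall₂_congr fun c hc => ?_
    obtain ⟨h1, h2⟩ := imps_lt hL hc
    rw [hval _ h2]
    refine imp_congr_left (forall₂_congr fun v hv => ?_)
    rw [hval v (h1 v hv)]
  constructor
  · rintro ⟨x, hx, hx'⟩
    have hu : x = fun i : Fin (n + 1) => (fun v : ℕ => x (Fin.ofNat (n + 1) v)) i := by
      funext i
      congr 1
      exact Fin.ext (Nat.mod_eq_of_lt i.2).symm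
    rw [hu] at hx hx'
    rw [hmod] at hx'
    have h := hsum (fun v : ℕ => x (Fin.ofNat (n + 1) v))
    refine ⟨fun v => x (Fin.ofNat (n + 1) v), ?_⟩
    obtain ⟨h1, h2⟩ := (hholds fun v => x (Fin.ofNat (n + 1) v)).1 hx
    refine ⟨h1, h2, ?_⟩
    rw [← h]
    exact hx'
  · rintro ⟨u, h0, h1, h2⟩
    refine ⟨fun i => u i, (hholds u).2 ⟨h0, h1⟩, ?_⟩
    rw [hmod, hsum u]
    exact h2

theorem satisfiable_iff_sat (M : ℕ) [NeZero M] (F : Formula) (L : Terms)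
    (hL : Represents M F.length L) : (hornInstance M F L).Satisfiable ↔ Sat F := by
  classical
  rw [satisfiable_iff M F L hL.toValidTerms]
  set Z := conjs L with hZ
  set m := F.length with hm
  have hconj : ∀ u : ℕ → Bool, (∀ e < Z.length, (u (3 * m + e) = true ↔
      ∀ v ∈ (Z.getD e ([], 0)).1, u v = true)) →
      (∑ e ∈ Finset.range Z.length, if u (3 * m + e) = true then (Z.getD e ([], 0)).2 else 0) =
        termSum Z u := by
    intro u hu
    rw [termSum, ← sum_range_getD Z ([], 0)]
    refine Finset.sum_congr rfl fun e he => ?_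
    simp only [hu e (Finset.mem_range.1 he)]
  constructor
  · rintro ⟨u, h0, h1, h2⟩
    have hc : ∀ j < m, ∀ k < 3, ∀ j' < m, ∀ k' < 3, conflict F j k j' k' = true →
        ¬ (u (3 * j + k) = true ∧ u (3 * j' + k') = true) := by
      rintro j hj k hk j' hj' k' hk' h ⟨ha, hb⟩
      have := h1 ([3 * j + k, 3 * j' + k'], lastVar m L)
        (List.mem_append_left _ (mem_conflictImps.2 ⟨j, hj, k, hk, j', hj', k', hk', h, rfl⟩))
        (by simp [ha, hb])
      rw [h0] at this
      exact Bool.false_ne_true this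
    rw [hconj, termSum_conjs, hL.dvd_iff] at h2
    -- A variable is true exactly if some chosen literal asks for it. A chosen negative literal is
    -- then satisfied as well, since a chosen positive literal of the same variable would conflict
    -- with it.
    · obtain ⟨x, hx⟩ : ∃ x : ℕ → Bool, ∀ v, x v = true ↔
          ∃ j < m, ∃ k < 3, u (3 * j + k) = true ∧ litAt F j k = (v, true) :=
        ⟨fun v => decide _, fun v => decide_eq_true_iff⟩
      refine ⟨x, fun j hj => ?_⟩
      have h3 : ∃ k < 3, u (3 * j + k) = true := by
        have := h2 j hj
        simp only [Bool.or_eq_true] at this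
        rcases this with (h | h) | h
        exacts [⟨0, by omega, h⟩, ⟨1, by omega, h⟩, ⟨2, by omega, h⟩]
      obtain ⟨k, hk, hu⟩ := h3
      refine ⟨k, hk, ?_⟩
      cases hb : (litAt F j k).2 with
      | true =>
        rw [hx]
        exact ⟨j, hj, k, hk, hu, Prod.ext rfl hb⟩
      | false =>
        rw [← Bool.not_eq_true, hx]
        rintro ⟨j', hj', k', hk', hu', h⟩
        refine hc j hj k hk j' hj' k' hk' ?_ ⟨hu, hu'⟩
        simp [conflict, h, hb]
    · intro t ht j hj k hk k' hk' hne
      have hjm := hL.index_lt t ht j hj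
      exact hc j hjm k hk j hjm k' hk' (by simp [conflict, hne])
    · intro e he
      constructor
      · intro hu v hv
        exact h1 ([3 * m + e], v) (List.mem_append_right _ (mem_conjImps.2
          ⟨e, he, .inr ⟨v, hv, rfl⟩⟩)) (by simpa using hu)
      · intro hu
        exact h1 (_, 3 * m + e) (List.mem_append_right _ (mem_conjImps.2
          ⟨e, he, .inl rfl⟩)) hu
  · rintro ⟨x, hx⟩
    -- Exactly one satisfied literal is kept in each clause, even if several are satisfied.
    choose! κ hκ hκ' using hx
    set u₀ : ℕ → Bool := fun v => decide (v / 3 < m ∧ v % 3 = κ (v / 3)) with hu₀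
    -- The condition `v < lastVar m L` matters: at the last variable `getD` returns the empty body,
    -- whose conjunction is true, whereas that variable has to be false.
    set u : ℕ → Bool := fun v => if v < 3 * m then u₀ v else
      decide (v < lastVar m L ∧ ∀ w ∈ (Z.getD (v - 3 * m) ([], 0)).1, u₀ w = true) with hu
    have hlit : ∀ j < m, ∀ k < 3, (u (3 * j + k) = true ↔ k = κ j) := by
      intro j hj k hk
      have h1 : 3 * j + k < 3 * m := by omega
      have h2 : (3 * j + k) / 3 = j := by omega
      have h3 : (3 * j + k) % 3 = k := by omega
      simp only [hu, if_pos h1, hu₀, h2, h3, decide_eq_true_eq]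
      exact and_iff_right hj
    have hZu : ∀ e < Z.length, ∀ v ∈ (Z.getD e ([], 0)).1, u v = u₀ v := fun e he v hv => by
      simp only [hu, if_pos (hL.conjs.index_lt _ (getD_mem he _) v hv)]
    have hex : ∀ e < Z.length, (u (3 * m + e) = true ↔
        ∀ v ∈ (Z.getD e ([], 0)).1, u v = true) := by
      intro e he
      have h1 : ¬ 3 * m + e < 3 * m := by omega
      have h2 : 3 * m + e < lastVar m L := by simp only [lastVar, ← hZ]; omega
      simp only [hu, if_neg h1, decide_eq_true_eq, Nat.add_sub_cancel_left]
      rw [and_iff_right h2]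
      refine forall₂_congr fun v hv => ?_
      show u₀ v = true ↔ u v = true
      rw [hZu e he v hv]
    refine ⟨u, ?_, ?_, ?_⟩
    · have h1 : ¬ lastVar m L < 3 * m := by simp only [lastVar]; omega
      simp [hu, if_neg h1]
    · intro c hc hbody
      rw [imps, List.mem_append, mem_conflictImps, mem_conjImps] at hc
      rcases hc with ⟨j, hj, k, hk, j', hj', k', hk', h, rfl⟩ | ⟨e, he, rfl | ⟨v, hv, rfl⟩⟩
      · exfalso
        have ha := (hlit j hj k hk).1 (hbody _ (by simp))
        have hb := (hlit j' hj' k' hk').1 (hbody _ (by simp))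
        subst ha hb
        have h1 := hκ' j hj
        have h2 := hκ' j' hj'
        simp only [conflict, Bool.or_eq_true, Bool.and_eq_true, beq_iff_eq, Bool.not_eq_true',
          beq_eq_false_iff_ne] at h
        rcases h with ⟨rfl, h⟩ | ⟨h, h'⟩
        · exact h rfl
        · rw [← h1, ← h2, h] at h'
          exact h' rfl
      · exact (hex e he).2 hbody
      · exact (hex e he).1 (hbody _ (by simp [hm])) v hv
    · rw [hconj u hex, termSum_conjs, hL.dvd_iff]
      · intro j hj
        have h1 := (hlit j hj (κ j) (hκ j hj)).2 rfl
        have h2 := hκ j hj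
        have : κ j = 0 ∨ κ j = 1 ∨ κ j = 2 := by omega
        rw [Bool.or_eq_true, Bool.or_eq_true]
        rcases this with h | h | h <;> rw [h] at h1
        exacts [.inl (.inl h1), .inl (.inr h1), .inr h1]
      · intro t ht j hj k hk k' hk' hne h
        have hjm := hL.index_lt t ht j hj
        exact hne (((hlit j hjm k hk).1 h.1).trans ((hlit j hjm k' hk').1 h.2).symm)

end HornReduction

/-! ### The reduction runs in polynomial time. -/

theorem PolyBdd.fst {ι γ : Type} {P : ι → Prop} {B f : ι → ℕ} {R : ι × γ → Prop}
    (h : PolyBdd P B f) :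
    PolyBdd (fun q : ι × γ => P q.1 ∧ R q) (fun q => B q.1) (fun q => f q.1) :=
  h.reindex Prod.fst fun _ hq => hq.1

theorem PolyComp.wk_fst {ι γ : Type} {P : ι → Prop} {B : ι → ℕ} {e z : ι → Data}
    {R : ι × γ → Prop} {y : ι × γ → Data} (h : PolyComp P B e z) :
    PolyComp (fun q : ι × γ => P q.1 ∧ R q) (fun q => B q.1) (fun q => .cons (y q) (e q.1))
      (fun q => z q.1) :=
  wk (h.reindex Prod.fst fun _ hq => hq.1)

namespace HornReduction
open Data PolyComp

def encLit (l : ℕ × Bool) : Data := .cons (.ofNat l.1) (.ofBool l.2)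
def encTerm (t : List ℕ × ℕ) : Data := .cons (ofList ofNat t.1) (.ofNat t.2)
def encFormula (F : Formula) : Data := ofList (ofList encLit) F
def encTerms (L : Terms) : Data := ofList encTerm L

def encHorn (M : ℕ) (F : Formula) (L : Terms) : Data :=
  .cons (ofNat M) (.cons (.cons (.cons (ofNat 0) (ofNat (lastVar F.length L)))
    (ofList (fun c => .cons (ofNat 2) (encTerm c)) (imps F L)))
    (.cons (ofList ofNat (coeffs F.length L)) (ofNat 0)))

theorem length_coeffs (m : ℕ) (L : Terms) : (coeffs m L).length = lastVar m L + 1 := by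
  simp [coeffs, lastVar]
  omega

theorem coeffs_lt {M m : ℕ} {L : Terms} (hM : 0 < M) (hL : ValidTerms M m L) :
    ∀ a ∈ coeffs m L, a < M := by
  intro a ha
  simp only [coeffs, List.mem_append, List.mem_replicate, List.mem_map, List.mem_singleton] at ha
  rcases ha with ⟨-, rfl⟩ | ⟨c, hc, rfl⟩ | rfl
  exacts [hM, hL.conjs.coeff_lt c hc, hM]

theorem encode_hornInstance (M : ℕ) [NeZero M] (F : Formula) (L : Terms)
    (hL : ValidTerms M F.length L) :
    (hornInstance M F L).encode = encHorn M F L := by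
  have hval : ∀ v, v < lastVar F.length L + 1 →
      ((Fin.ofNat (lastVar F.length L + 1) v : Fin (lastVar F.length L + 1)) : ℕ) = v :=
    fun v hv => Nat.mod_eq_of_lt hv
  have hcongr : ∀ {α : Type} (e e' : α → Data) (l : List α), (∀ a ∈ l, e a = e' a) →
      ofList e l = ofList e' l := by
    intro α e e' l h
    induction l with
    | nil => rfl
    | cons a l ih => rw [ofList, ofList, h a (by simp), ih fun b hb => h b (by simp [hb])]
  have h1 : ofList (fun a : Fin M => ofNat a) (List.ofFn (hornInstance M F L).coeff) =
      ofList ofNat (coeffs F.length L) := by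
    rw [← ofList_map ofNat (fun a : Fin M => (a : ℕ))]
    congr 1
    refine List.ext_getElem (by simp [length_coeffs]) fun i hi hi' => ?_
    have h := coeffs_lt (NeZero.pos M) hL _ (List.getElem_mem hi')
    simp only [List.getElem_map, List.getElem_ofFn, hornInstance]
    rw [List.getD_eq_getElem _ _ hi']
    exact Nat.mod_eq_of_lt h
  rw [HornModInstance.encode, encHorn, h1]
  simp only [hornInstance, ofList, HornClause.encode, ofList_map]
  rw [hval _ (by omega)]
  congr 3
  refine hcongr _ _ _ fun c hc => ?_
  obtain ⟨h2, h3⟩ := imps_lt hL hc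
  rw [hval _ h3, encTerm, hcongr _ _ _ fun v hv => congrArg ofNat (hval v (h2 v hv))]

section
variable {ι : Type} {P : ι → Prop} {B : ι → ℕ} {e : ι → Data}

theorem polyComp_choices {S : ι → List ℕ} {D : ι → ℕ}
    (hS : PolyComp P B e (fun i => ofList ofNat (S i)))
    (hlen : PolyBdd P B (fun i => (choices (S i)).length))
    (hD : PolyBdd P B D) (hSD : ∀ i, P i → ∀ j ∈ S i, j ≤ D i) :
    PolyComp P B e (fun i => ofList (ofList ofNat) (choices (S i))) := by
  have hlen' : PolyBdd P B (fun i => (S i).length) := hlen.mono fun i _ => by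
    rw [length_choices]
    exact (Nat.lt_pow_self (by omega)).le
  unfold choices
  refine foldl (eb := ofList (ofList ofNat)) (b := fun _ => [[]])
    (step := fun _ acc j => acc.flatMap fun c =>
      [(3 * j + 0) :: c, (3 * j + 1) :: c, (3 * j + 2) :: c]) hS
    (const (ofList (ofList ofNat) [[]])) hlen' ?_
  -- The accumulator holds the choices for a prefix of `S`, and their number is a smaller power of 3
  -- than the final one.
  have hacc : PolyBdd (fun q : ι × List (List ℕ) × ℕ => P q.1 ∧ ∃ l₁ l₂, S q.1 = l₁ ++ q.2.2 :: l₂ ∧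
      q.2.1 = l₁.foldl (fun acc j => acc.flatMap fun c =>
      [(3 * j + 0) :: c, (3 * j + 1) :: c, (3 * j + 2) :: c]) [[]]) (fun q => B q.1)
      (fun q => q.2.1.length) := by
    refine hlen.fst.mono fun q hq => ?_
    obtain ⟨-, l₁, l₂, h, h'⟩ := hq
    rw [h', h]
    change (choices l₁).length ≤ _
    rw [length_choices, length_choices]
    exact Nat.pow_le_pow_right (by omega) (by simp)
  have hj : PolyBdd (fun q : ι × List (List ℕ) × ℕ => P q.1 ∧ ∃ l₁ l₂, S q.1 = l₁ ++ q.2.2 :: l₂ ∧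
      q.2.1 = l₁.foldl (fun acc j => acc.flatMap fun c =>
      [(3 * j + 0) :: c, (3 * j + 1) :: c, (3 * j + 2) :: c]) [[]]) (fun q => B q.1)
      (fun q => q.2.2) := by
    refine hD.fst.mono fun q hq => ?_
    obtain ⟨hq, l₁, l₂, h, -⟩ := hq
    exact hSD _ hq _ (by simp [h])
  refine flatMap v1 hacc ((hacc.mul (.const 3)).mono fun q _ => ?_) ?_
  · simp [List.length_flatMap]
  · have hv : ∀ k, PolyComp (fun q : (ι × List (List ℕ) × ℕ) × List ℕ =>
        (P q.1.1 ∧ ∃ l₁ l₂, S q.1.1 = l₁ ++ q.1.2.2 :: l₂ ∧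
        q.1.2.1 = l₁.foldl (fun acc j => acc.flatMap fun c =>
        [(3 * j + 0) :: c, (3 * j + 1) :: c, (3 * j + 2) :: c]) [[]]) ∧ q.2 ∈ q.1.2.1)
        (fun q => B q.1.1) (fun q => .cons (ofList ofNat q.2) (.cons (ofNat q.1.2.2)
          (.cons (ofList (ofList ofNat) q.1.2.1) (e q.1.1))))
        (fun q => ofList ofNat ((3 * q.1.2.2 + k) :: q.2)) := fun k =>
      cons_list (add (mul (const (ofNat 3)) v1 (.const 3) hj.fst) (const (ofNat k))
        ((PolyBdd.const 3).mul hj.fst)) v0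
    exact cons_list (hv 0) (cons_list (hv 1) (cons_list (hv 2) nil_list))

theorem polyComp_conjs {L : ι → Terms} {D : ι → ℕ}
    (hL : PolyComp P B e (fun i => encTerms (L i)))
    (hlen : PolyBdd P B (fun i => (conjs (L i)).length))
    (hD : PolyBdd P B D) (hLD : ∀ i, P i → ∀ t ∈ L i, ∀ j ∈ t.1, j ≤ D i) :
    PolyComp P B e (fun i => encTerms (conjs (L i))) := by
  have hle : ∀ (L : Terms) t, t ∈ L → (choices t.1).length ≤ (conjs L).length := fun L t ht => by
    rw [length_conjs, length_choices]
    exact List.single_le_sum (by simp) _ (List.mem_map_of_mem ht)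
  have h1 : PolyBdd (fun q : ι × (List ℕ × ℕ) => P q.1 ∧ q.2 ∈ L q.1) (fun q => B q.1)
      (fun q => (choices q.2.1).length) := hlen.fst.mono fun q hq => hle _ _ hq.2
  refine flatMap hL (hlen.mono fun i _ => ?_) hlen (map (polyComp_choices (fst v0) h1 hD.fst
    fun q hq => hLD _ hq.1 _ hq.2) h1 (pair v0 (snd v1)))
  rw [length_conjs]
  refine le_trans (by simp) (List.card_nsmul_le_sum ((L i).map fun t => 3 ^ t.1.length) 1
    (by simp only [List.mem_map]; rintro _ ⟨t, -, rfl⟩; exact Nat.one_le_pow _ _ (by omega)))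

theorem polyComp_conjImps {m : ι → ℕ} {Z : ι → Terms}
    (hm : PolyComp P B e (fun i => ofNat (m i))) (hm' : PolyBdd P B m)
    (hZ : PolyComp P B e (fun i => encTerms (Z i)))
    (hlen : PolyBdd P B (fun i => (Z i).length))
    (hZm : ∀ i, P i → ∀ t ∈ Z i, t.1.length ≤ m i) :
    PolyComp P B e (fun i => encTerms (conjImps (m i) (Z i))) := by
  have he : PolyBdd (fun q : ι × ℕ => P q.1 ∧ q.2 ∈ List.range (Z q.1).length) (fun q => B q.1)
      (fun q => q.2) := hlen.fst.mono fun q hq => (List.mem_range.1 hq.2).le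
  have hb : ∀ q : ι × ℕ, P q.1 ∧ q.2 ∈ List.range (Z q.1).length →
      ((Z q.1).getD q.2 ([], 0)).1.length ≤ m q.1 := fun q hq =>
    hZm _ hq.1 _ (getD_mem (List.mem_range.1 hq.2) _)
  refine flatMap (range (length hZ hlen) hlen) (hlen.mono fun i _ => by simp)
    (((hlen.mul (hm'.add (.const 1)))).mono fun i hi => ?_) ?_
  · refine (length_flatMap_le (c := m i + 1) fun e' he' => ?_).trans (by simp)
    simpa using hb (i, e') ⟨hi, he'⟩
  · have hget : PolyComp (fun q : ι × ℕ => P q.1 ∧ q.2 ∈ List.range (Z q.1).length)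
        (fun q => B q.1) (fun q => .cons (ofNat q.2) (e q.1))
        (fun q => encTerm ((Z q.1).getD q.2 ([], 0))) :=
      getD (wk_fst hZ) v0 he fun q hq => List.mem_range.1 hq.2
    have hidx : PolyComp (fun q : ι × ℕ => P q.1 ∧ q.2 ∈ List.range (Z q.1).length)
        (fun q => B q.1) (fun q => .cons (ofNat q.2) (e q.1)) (fun q => ofNat (3 * m q.1 + q.2)) :=
      add (mul (const (ofNat 3)) (wk_fst hm) (.const 3) hm'.fst)
        v0 ((PolyBdd.const 3).mul hm'.fst)
    refine cons_list (ea := encTerm) (pair (fst hget) hidx) (map (fst hget) (hm'.fst.mono hb) ?_)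
    exact pair (cons_list (wk_fst hidx) nil_list) v0

theorem polyComp_conflictImps {F : ι → Formula} {n : ι → ℕ}
    (hF : PolyComp P B e (fun i => encFormula (F i)))
    (hlen : PolyBdd P B (fun i => (F i).length))
    (hF3 : ∀ i, P i → ∀ C ∈ F i, C.length = 3 ∧ ∀ l ∈ C, l.1 < 3 * (F i).length)
    (hn : PolyComp P B e (fun i => ofNat (n i))) :
    PolyComp P B e (fun i => encTerms (conflictImps (F i) (n i))) := by
  -- One index type serves the body of the four nested loops over j, k, j', k'. The stack `env` has
  -- the innermost variable k' on top.
  let κ := ι × ℕ × ℕ × ℕ × ℕ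
  let Q : κ → Prop := fun q => P q.1 ∧ q.2.1 < (F q.1).length ∧ q.2.2.1 < 3 ∧
    q.2.2.2.1 < (F q.1).length ∧ q.2.2.2.2 < 3
  let env : κ → Data := fun q => .cons (ofNat q.2.2.2.2) (.cons (ofNat q.2.2.2.1)
    (.cons (ofNat q.2.2.1) (.cons (ofNat q.2.1) (e q.1))))
  have hmem : ∀ (j k : κ → ℕ) q, P q.1 → j q < (F q.1).length → k q < 3 →
      k q < ((F q.1).getD (j q) []).length ∧
        (litAt (F q.1) (j q) (k q)).1 < 3 * (F q.1).length := by
    intro j k q hq hj hk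
    have h := hF3 _ hq _ (getD_mem hj [])
    have h' : k q < ((F q.1).getD (j q) []).length := by rw [h.1]; exact hk
    exact ⟨h', h.2 _ (getD_mem h' _)⟩
  have hbd : PolyBdd Q (fun q => B q.1) (fun q => (F q.1).length) := hlen.fst
  have hlit : ∀ j k : κ → ℕ, (∀ q, Q q → j q < (F q.1).length) → (∀ q, Q q → k q < 3) →
      PolyComp Q (fun q => B q.1) env (fun q => ofNat (j q)) →
      PolyComp Q (fun q => B q.1) env (fun q => ofNat (k q)) →
      PolyComp Q (fun q => B q.1) env (fun q => encLit (litAt (F q.1) (j q) (k q))) := by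
    intro j k hj hk hj' hk'
    refine getD (getD (ea := ofList encLit) (wk (wk (wk (wk (hF.reindex Prod.fst
      fun q hq => hq.1))))) hj' (hbd.mono fun q hq => (hj q hq).le) hj) hk'
      ((PolyBdd.const 3).mono fun q hq => (hk q hq).le) fun q hq => ?_
    exact (hmem j k q hq.1 (hj q hq) (hk q hq)).1
  have hvar : ∀ j k : κ → ℕ, (∀ q, Q q → j q < (F q.1).length) →
      PolyComp Q (fun q => B q.1) env (fun q => ofNat (j q)) →
      PolyComp Q (fun q => B q.1) env (fun q => ofNat (k q)) →
      PolyComp Q (fun q => B q.1) env (fun q => ofNat (3 * j q + k q)) := by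
    intro j k hj hj' hk'
    have := hbd.mono (g := j) fun q hq => (hj q hq).le
    exact add (mul (const (ofNat 3)) hj' (.const 3) this) hk' ((PolyBdd.const 3).mul this)
  have h1 : ∀ q, Q q → q.2.1 < (F q.1).length := fun q hq => hq.2.1
  have h2 : ∀ q, Q q → q.2.2.1 < 3 := fun q hq => hq.2.2.1
  have h3 : ∀ q, Q q → q.2.2.2.1 < (F q.1).length := fun q hq => hq.2.2.2.1
  have h4 : ∀ q, Q q → q.2.2.2.2 < 3 := fun q hq => hq.2.2.2.2
  have hl1 := hlit _ _ h1 h2 v3 v2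
  have hl2 := hlit _ _ h3 h4 v1 v0
  have hbody : PolyComp Q (fun q => B q.1) env (fun q => encTerms
      (if conflict (F q.1) q.2.1 q.2.2.1 q.2.2.2.1 q.2.2.2.2 = true then
        [([3 * q.2.1 + q.2.2.1, 3 * q.2.2.2.1 + q.2.2.2.2], n q.1)] else [])) := by
    refine (ite (c := fun q : κ => conflict (F q.1) q.2.1 q.2.2.1 q.2.2.2.1 q.2.2.2.2)
      (y := fun q => encTerms [([3 * q.2.1 + q.2.2.1, 3 * q.2.2.2.1 + q.2.2.2.2], n q.1)])
      (z := fun _ => encTerms []) ?_ ?_ nil_list).congr fun q _ => by split <;> rfl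
    · refine or (and (beq v3 v1 (hbd.mono fun q hq => (h1 q hq).le)
        (hbd.mono fun q hq => (h3 q hq).le)) (not (beq v2 v0
        ((PolyBdd.const 3).mono fun q hq => (h2 q hq).le)
        ((PolyBdd.const 3).mono fun q hq => (h4 q hq).le)))) (and (beq (fst hl1) (fst hl2)
        (((PolyBdd.const 3).mul hbd).mono fun q hq => ?_)
        (((PolyBdd.const 3).mul hbd).mono fun q hq => ?_)) (not (beq_bool (snd hl1) (snd hl2))))
      · exact (hmem (fun q => q.2.1) (fun q => q.2.2.1) q hq.1 (h1 q hq) (h2 q hq)).2.le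
      · exact (hmem (fun q => q.2.2.2.1) (fun q => q.2.2.2.2) q hq.1 (h3 q hq) (h4 q hq)).2.le
    · refine PolyComp.reindex (P := Q) ?_ (fun q => q) fun q hq => hq.1
      exact cons_list (ea := encTerm) (pair (cons_list (hvar _ _ h1 v3 v2)
        (cons_list (hvar _ _ h3 v1 v0) nil_list))
        (wk (wk (wk (wk_fst hn))))) nil_list
  have hlast : ∀ (F : Formula) (n j k j' : ℕ), ((List.range 3).flatMap fun k' =>
      if conflict F j k j' k' = true then [([3 * j + k, 3 * j' + k'], n)] else []).length ≤ 3 :=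
    fun F n j k j' => (length_flatMap_le (c := 1) fun k' _ => by split_ifs <;> simp).trans (by simp)
  have hrange : ∀ {κ : Type} {Q : κ → Prop} {B : κ → ℕ} {e : κ → Data},
      PolyComp Q B e (fun _ => ofList ofNat (List.range 3)) := const _
  have hrangeF := range (length hF hlen) hlen
  have hlenF : PolyBdd P B (fun i => (List.range (F i).length).length) :=
    hlen.mono fun i _ => by simp
  have hc3 : ∀ {κ : Type} {Q : κ → Prop} {B : κ → ℕ},
      PolyBdd Q B (fun _ => (List.range 3).length) := .const 3
  refine flatMap hrangeF hlenF ?_ (flatMap hrange hc3 ?_ (flatMap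
    (wk_fst (wk_fst (R := fun r => r.2 ∈ List.range (F r.1).length) (y := fun r => ofNat r.2)
      hrangeF))
    (hlenF.fst (R := fun r => r.2 ∈ List.range (F r.1).length)).fst ?_ (flatMap hrange hc3 ?_ ?_)))
  · exact ((hlen.mul ((PolyBdd.const 3).mul (hlen.mul ((PolyBdd.const 3).mul
      (.const 1)))))).mono fun i _ => length_conflictImps_le _ _
  · refine ((PolyBdd.const 3).mul (hlen.fst.mul (.const 3))).mono fun q _ => ?_
    refine (length_flatMap_le (c := (F q.1).length * 3) fun k _ => ?_).trans (by simp)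
    exact (length_flatMap_le fun j' _ => hlast _ _ _ _ j').trans (by simp)
  · refine ((hlen.fst (R := fun r => r.2 ∈ List.range (F r.1).length)).fst.mul (.const 3)).mono
      fun q _ => ?_
    exact (length_flatMap_le fun j' _ => hlast _ _ _ _ j').trans (by simp)
  · exact (PolyBdd.const 3).mono fun q _ => hlast _ _ _ _ _
  · refine hbody.reindex (fun q : (((ι × ℕ) × ℕ) × ℕ) × ℕ =>
      (q.1.1.1.1, q.1.1.1.2, q.1.1.2, q.1.2, q.2)) fun q hq => ?_
    obtain ⟨⟨⟨⟨hP, h1⟩, h2⟩, h3⟩, h4⟩ := hq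
    exact ⟨hP, List.mem_range.1 h1, List.mem_range.1 h2, List.mem_range.1 h3, List.mem_range.1 h4⟩

end

theorem polyComp_encHorn {ι : Type} {P : ι → Prop} {B : ι → ℕ} {e : ι → Data} {M : ι → ℕ}
    {F : ι → Formula} {L : ι → Terms}
    (hM : PolyComp P B e (fun i => ofNat (M i)))
    (hF : PolyComp P B e (fun i => encFormula (F i)))
    (hL : PolyComp P B e (fun i => encTerms (L i)))
    (hB : PolyBdd P B (fun i => lastVar (F i).length (L i)))
    (hF3 : ∀ i, P i → ∀ C ∈ F i, C.length = 3 ∧ ∀ l ∈ C, l.1 < 3 * (F i).length)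
    (hLF : ∀ i, P i → ValidTerms (M i) (F i).length (L i))
    (hS : ∀ i, P i → ∀ t ∈ L i, t.1.length ≤ (F i).length) :
    PolyComp P B e (fun i => encHorn (M i) (F i) (L i)) := by
  have hm : PolyBdd P B (fun i => (F i).length) := hB.mono fun i _ => by
    simp only [lastVar]; omega
  have hz : PolyBdd P B (fun i => (conjs (L i)).length) := hB.mono fun i _ => by
    simp only [lastVar]; omega
  refine bind (length hF hm) (bind (wk (polyComp_conjs hL hz hm fun i hi t ht j hj =>
    ((hLF i hi).index_lt t ht j hj).le)) (bind (y := fun i => ofNat (lastVar (F i).length (L i)))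
    (add (mul (const (ofNat 3)) v1 (.const 3) hm) (length v0 hz) ((PolyBdd.const 3).mul hm)) ?_))
  have hFw := wk (y := fun i => ofNat (lastVar (F i).length (L i)))
    (wk (y := fun i => encTerms (conjs (L i))) (wk (y := fun i => ofNat (F i).length) hF))
  have hMw := wk (y := fun i => ofNat (lastVar (F i).length (L i)))
    (wk (y := fun i => encTerms (conjs (L i))) (wk (y := fun i => ofNat (F i).length) hM))
  have hci : PolyBdd P B (fun i => (conflictImps (F i) (lastVar (F i).length (L i))).length) :=
    (hm.mul ((PolyBdd.const 3).mul (hm.mul ((PolyBdd.const 3).mul (.const 1))))).mono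
      fun i _ => length_conflictImps_le _ _
  have hcj : PolyBdd P B (fun i => (conjImps (F i).length (conjs (L i))).length) := by
    refine (hz.mul (hm.add (.const 1))).mono fun i hi => ?_
    refine (length_flatMap_le (c := (F i).length + 1) fun e he => ?_).trans (by simp)
    obtain ⟨t, ht, h, -⟩ := mem_conjs (getD_mem (List.mem_range.1 he) ([], 0))
    rw [List.length_cons, List.length_map, (mem_choices h).1]
    exact Nat.succ_le_succ (hS i hi t ht)
  have himps := append (ea := encTerm) (polyComp_conflictImps hFw hm hF3 v0)
    (polyComp_conjImps v2 hm v1 hz fun i hi c hc => by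
      obtain ⟨t, ht, h, -⟩ := mem_conjs hc
      rw [(mem_choices h).1]
      exact hS i hi t ht) hci
  have himps' := map (eb := fun c => .cons (ofNat 2) (encTerm c)) (g := fun _ c => c) himps
    ((hci.add hcj).mono fun i _ => by simp) (pair (const (ofNat 2)) v0)
  refine pair hMw (pair (pair (pair (const (ofNat 0)) v0) (himps'.congr fun i _ => ?_))
    (pair ?_ (const (ofNat 0))))
  · rw [List.map_id']
    rfl
  · refine append (append (map (g := fun _ _ => 0) (range (mul (const (ofNat 3)) v2 (.const 3) hm)
      ((PolyBdd.const 3).mul hm)) (((PolyBdd.const 3).mul hm).mono fun i _ => by simp)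
      (const (ofNat 0))) (map (eb := ofNat) (g := fun _ t => t.2) v1 hz (snd v0))
      (((PolyBdd.const 3).mul hm).mono fun i _ => by simp)) (const (ofList ofNat [0])) ?_
        |>.congr fun i _ => ?_
    · exact hB.mono fun i _ => by simp [lastVar]
    · congr 1
      simp [coeffs]

/-- The clauses of a formula with `m` clauses, as a list. -/
def formula {m : ℕ} (φ : ThreeCNF m) : Formula :=
  (List.ofFn φ.lit).map fun C => (List.ofFn C).map fun l => ((l.1 : ℕ), l.2)

theorem length_formula {m : ℕ} (φ : ThreeCNF m) : (formula φ).length = m := by simp [formula]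

theorem encode_eq {m : ℕ} (φ : ThreeCNF m) : φ.encode = encFormula (formula φ) := by
  rw [formula, encFormula, ofList_map, ThreeCNF.encode]
  simp only [ofList_map]
  rfl

theorem mem_formula {m : ℕ} (φ : ThreeCNF m) :
    ∀ C ∈ formula φ, C.length = 3 ∧ ∀ l ∈ C, l.1 < 3 * (formula φ).length := by
  rw [length_formula]
  intro C hC
  obtain ⟨C', -, rfl⟩ := List.mem_map.1 hC
  refine ⟨by simp, fun l hl => ?_⟩
  obtain ⟨l', -, rfl⟩ := List.mem_map.1 hl
  exact l'.1.2

theorem litAt_formula {m : ℕ} (φ : ThreeCNF m) (j : Fin m) (k : Fin 3) :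
    litAt (formula φ) j k = (((φ.lit j k).1 : ℕ), (φ.lit j k).2) := by
  simp only [litAt, formula, List.getD_eq_getElem?_getD]
  fin_cases k <;> simp

theorem sat_formula {m : ℕ} (φ : ThreeCNF m) : Sat (formula φ) ↔ φ.Satisfiable := by
  constructor
  · rintro ⟨x, hx⟩
    refine ⟨fun v => x v, fun j => ?_⟩
    obtain ⟨k, hk, h⟩ := hx j (by rw [length_formula]; exact j.2)
    have := litAt_formula φ j ⟨k, hk⟩
    simp only at this
    rw [this] at h
    exact ⟨⟨k, hk⟩, h⟩
  · rintro ⟨x, hx⟩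
    refine ⟨fun v => if h : v < 3 * m then x ⟨v, h⟩ else false, fun j hj => ?_⟩
    rw [length_formula] at hj
    obtain ⟨k, h⟩ := hx ⟨j, hj⟩
    have := litAt_formula φ ⟨j, hj⟩ k
    simp only at this
    refine ⟨k, k.2, ?_⟩
    rw [this]
    simpa using h

/-- The new solver runs `p` to get the parameter `σ m`, builds the Horn instance, and calls `A`. The
parameter carries the modulus: a constant for fixed M, and a function of `m` when M is part of the
input. The exponent `k` comes from the reduction alone and is fixed before `A`. -/
theorem exists_solver {P : ℕ → ℕ → Prop} {M B : ℕ → ℕ → ℕ} {L : ℕ → ℕ → Terms}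
    (hgen : PolyComp (fun i : ℕ × ℕ => P i.1 i.2) (fun i => B i.1 i.2)
      (fun i => .cons (ofNat i.1) (ofNat i.2))
      (fun i => .cons (ofNat (M i.1 i.2)) (encTerms (L i.1 i.2))))
    (hB : PolyBdd (fun i : ℕ × ℕ => P i.1 i.2) (fun i => B i.1 i.2)
      (fun i => lastVar i.2 (L i.1 i.2)))
    (hM : ∀ s m, P s m → 2 ≤ M s m) (hL : ∀ s m, P s m → Represents (M s m) m (L s m))
    (hS : ∀ s m, P s m → ∀ t ∈ L s m, t.1.length ≤ m) :
    ∃ k : ℕ, ∀ (σ c : ℕ → ℕ) (p : Prog), (∀ m, P (σ m) m) →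
      (∀ m (φ : ThreeCNF m), ∃ t ≤ c m, p.Runs φ.encode (ofNat (σ m)) t) →
      ∀ (A : Prog) (T : ℕ → ℕ → ℕ), (∀ m, SolvesHornSatMod (M (σ m) m) A (T m)) →
        ∃ A', SolvesThreeSAT A' fun m =>
          T m (lastVar m (L (σ m) m) + 1) + (B (σ m) m + 2) ^ k + c m := by
  have hm : PolyBdd (fun i : ℕ × (Σ m, ThreeCNF m) => P i.1 i.2.1) (fun i => B i.1 i.2.1)
      (fun i => i.2.1) :=
    (hB.reindex (fun i : ℕ × (Σ m, ThreeCNF m) => (i.1, i.2.1)) fun q hq => hq).mono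
      fun i _ => by simp only [lastVar]; omega
  have hg : PolyComp (fun i : ℕ × (Σ m, ThreeCNF m) => P i.1 i.2.1) (fun i => B i.1 i.2.1)
      (fun i => .cons (ofNat i.1) (encFormula (formula i.2.2)))
      (fun i => encHorn (M i.1 i.2.1) (formula i.2.2) (L i.1 i.2.1)) := by
    have h1 := comp (pair (P := fun i : ℕ × (Σ m, ThreeCNF m) => P i.1 i.2.1)
      (B := fun i => B i.1 i.2.1) (y := fun i => ofNat i.1)
      (x := fun i => .cons (ofNat i.1) (encFormula (formula i.2.2))) (z := fun i => ofNat i.2.1) v0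
      ((length (ea := ofList encLit) (l := fun i => formula i.2.2) (wk id)
        (hm.mono fun i _ => by rw [length_formula])).congr fun i _ => by rw [length_formula]))
      (hgen.reindex (fun i : ℕ × (Σ m, ThreeCNF m) => (i.1, i.2.1)) fun q hq => hq)
    refine polyComp_encHorn (fst h1) (wk id) (snd h1) ?_ (fun i _ => mem_formula i.2.2)
      (fun i hi => ?_) (fun i hi => ?_)
    · exact (hB.reindex (fun i : ℕ × (Σ m, ThreeCNF m) => (i.1, i.2.1)) fun q hq => hq).mono
        fun i _ => by rw [length_formula]
    · rw [length_formula]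
      exact (hL _ _ hi).toValidTerms
    · rw [length_formula]
      exact hS _ _ hi
  obtain ⟨G, τ, hτ, hG⟩ := hg
  obtain ⟨k, hk⟩ := hτ.add (.const 4)
  refine ⟨k, fun σ c p hσ hp A T hA => ⟨.seq (.seq (.cons p .id) G) A, fun m φ => ?_⟩⟩
  obtain ⟨t₁, h₁, h₁'⟩ := hp m φ
  obtain ⟨t₂, h₂, h₂'⟩ := hG (σ m, ⟨m, φ⟩) (hσ m)
  have h₂'' := hk (σ m, ⟨m, φ⟩) (hσ m)
  have hM2 := hM _ _ (hσ m)
  have : NeZero (M (σ m) m) := ⟨by omega⟩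
  have hrep : Represents (M (σ m) m) (formula φ).length (L (σ m) m) := by
    rw [length_formula]
    exact hL _ _ (hσ m)
  obtain ⟨t₃, h₃, y, h₃', hy⟩ := hA m _ (hornInstance (M (σ m) m) (formula φ) (L (σ m) m))
    (size_hornInstance _ _ _ (by rw [length_formula]; exact hS _ _ (hσ m)))
  rw [encode_hornInstance _ _ _ hrep.toValidTerms] at h₃'
  rw [satisfiable_iff_sat _ _ _ hrep, sat_formula] at hy
  rw [length_formula] at h₃
  refine ⟨_, ?_, y, .seq (.seq (.cons h₁' (.id _)) (by rw [encode_eq]; exact h₂')) h₃', hy⟩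
  simp only at h₂ h₂'' ⊢
  omega

end HornReduction

/-! ### Programs see only the top of their input -/

namespace Data

/-- Equality of trees up to depth `d`. -/
def Agree : ℕ → Data → Data → Prop
  | 0, _, _ => True
  | _ + 1, nil, nil => True
  | d + 1, cons l r, cons l' r' => Agree d l l' ∧ Agree d r r'
  | _ + 1, _, _ => False

theorem Agree.of_succ {d : ℕ} {x y : Data} (h : Agree (d + 1) x y) : Agree d x y := by
  induction d generalizing x y with
  | zero => trivial
  | succ d ih =>
    cases x <;> cases y
    · trivial
    · exact h
    · exact h
    · exact ⟨ih h.1, ih h.2⟩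

theorem Agree.mono {c d : ℕ} (hcd : c ≤ d) {x y : Data} (h : Agree d x y) : Agree c x y := by
  induction d, hcd using Nat.le_induction with
  | base => exact h
  | succ d _ ih => exact ih h.of_succ

theorem Agree.refl (d : ℕ) (x : Data) : Agree d x x := by
  induction d generalizing x with
  | zero => trivial
  | succ d ih =>
    cases x
    · trivial
    · exact ⟨ih _, ih _⟩

theorem Agree.hd {d : ℕ} {x y : Data} (h : Agree (d + 1) x y) : Agree d x.hd y.hd := by
  cases x <;> cases y
  · exact .refl _ _
  · exact h.elim
  · exact h.elim
  · exact h.1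

theorem Agree.tl {d : ℕ} {x y : Data} (h : Agree (d + 1) x y) : Agree d x.tl y.tl := by
  cases x <;> cases y
  · exact .refl _ _
  · exact h.elim
  · exact h.elim
  · exact h.2

def depth : Data → ℕ
  | nil => 0
  | cons l r => max l.depth r.depth + 1

theorem length_le_depth {α : Type} (e : α → Data) (l : List α) : l.length ≤ (ofList e l).depth := by
  induction l with
  | nil => simp
  | cons a l ih =>
    rw [List.length_cons, ofList, depth]
    omega

theorem depth_ofNat (n : ℕ) : (ofNat n).depth = n := by
  induction n with
  | zero => rfl
  | succ n ih => rw [ofNat, depth, ih, depth]; omega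

theorem depth_hd_le (x : Data) : x.hd.depth ≤ x.depth := by
  cases x with
  | nil => exact le_rfl
  | cons l r => rw [hd, depth]; omega

theorem depth_tl_le (x : Data) : x.tl.depth ≤ x.depth := by
  cases x with
  | nil => exact le_rfl
  | cons l r => rw [tl, depth]; omega

end Data

open Data

/-- A step adds at most one level to the tree. Hence the number of terms in the output of a NAND
generator is controlled by its running time. -/
theorem Prog.Runs.depth_le {p : Prog} {x y : Data} {t : ℕ} (h : p.Runs x y t) :
    y.depth ≤ x.depth + t := by
  induction h with
  | id => omega
  | nil => exact Nat.zero_le _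
  | hd x => exact (depth_hd_le x).trans (by omega)
  | tl x => exact (depth_tl_le x).trans (by omega)
  | cons _ _ h₁ h₂ => rw [depth]; omega
  | seq => omega
  | cond_true => omega
  | cond_false => omega
  | loop_stop => omega
  | loop_step => omega

/-- A step uncovers at most one further level of the input, so `t` steps cannot notice a difference
that lies deeper than `t`. -/
theorem Prog.Runs.agree {p : Prog} {x y : Data} {t : ℕ} (h : p.Runs x y t) :
    ∀ {d : ℕ} {x' : Data}, Agree (d + t) x x' → ∃ y', p.Runs x' y' t ∧ Agree d y y' := by
  induction h with
  | id x => exact fun {d x'} h => ⟨x', .id _, h.of_succ⟩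
  | nil x => exact fun {d x'} h => ⟨_, .nil _, .refl _ _⟩
  | hd x => exact fun {d x'} h => ⟨_, .hd _, h.hd⟩
  | tl x => exact fun {d x'} h => ⟨_, .tl _, h.tl⟩
  | @cons f g x y z s t _ _ h₁ h₂ =>
    intro d x' h
    obtain ⟨y', hy, hy'⟩ := h₁ (d := d) (h.mono (by omega))
    obtain ⟨z', hz, hz'⟩ := h₂ (d := d) (h.mono (by omega))
    have h' : Agree (d + 1) (.cons y z) (.cons y' z') := ⟨hy', hz'⟩
    exact ⟨_, .cons hy hz, h'.of_succ⟩
  | @seq f g x y z s t _ _ h₁ h₂ =>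
    intro d x' h
    obtain ⟨y', hy, hy'⟩ := h₁ (d := d + t) (h.mono (by omega))
    obtain ⟨z', hz, hz'⟩ := h₂ hy'
    exact ⟨_, .seq hy hz, hz'⟩
  | @cond_true c f g x a b y s t _ _ h₁ h₂ =>
    intro d x' h
    obtain ⟨y', hy, hy'⟩ := h₁ (d := 1) (h.mono (by omega))
    obtain ⟨z', hz, hz'⟩ := h₂ (d := d) (h.mono (by omega))
    cases y' with
    | nil => exact hy'.elim
    | cons a' b' => exact ⟨_, .cond_true hy hz, hz'⟩
  | @cond_false c f g x y s t _ _ h₁ h₂ =>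
    intro d x' h
    obtain ⟨y', hy, hy'⟩ := h₁ (d := 1) (h.mono (by omega))
    obtain ⟨z', hz, hz'⟩ := h₂ (d := d) (h.mono (by omega))
    cases y' with
    | nil => exact ⟨_, .cond_false hy hz, hz'⟩
    | cons a' b' => exact hy'.elim
  | loop_stop =>
    rename_i h₁
    intro d x' h
    obtain ⟨y', hy, hy'⟩ := h₁ (d := 1 + d) (h.mono (by omega))
    cases y' with
    | nil => exact ⟨_, .loop_exit hy, h.mono (by omega)⟩
    | cons a' b' => rw [Nat.add_comm 1 d] at hy'; exact hy'.elim
  | @loop_step c f x a b y z s t u _ _ _ h₁ h₂ h₃ =>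
    intro d x' h
    obtain ⟨w', hw, hw'⟩ := h₁ (d := 1) (h.mono (by omega))
    obtain ⟨y', hy, hy'⟩ := h₂ (d := d + u) (h.mono (by omega))
    obtain ⟨z', hz, hz'⟩ := h₃ hy'
    cases w' with
    | nil => exact hw'.elim
    | cons a' b' => exact ⟨_, .loop_step hw hy hz, hz'⟩

/-- The output of a program is determined by its input. -/
theorem Prog.Runs.det {p : Prog} {x y : Data} {t : ℕ} (h : p.Runs x y t) :
    ∀ {y' t'}, p.Runs x y' t' → y = y' := by
  induction h with
  | id x => rintro _ _ ⟨⟩; rfl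
  | nil x => rintro _ _ ⟨⟩; rfl
  | hd x => rintro _ _ ⟨⟩; rfl
  | tl x => rintro _ _ ⟨⟩; rfl
  | cons _ _ h₁ h₂ =>
    rintro _ _ (_ | _ | _ | _ | ⟨ha, hb⟩)
    rw [h₁ ha, h₂ hb]
  | seq _ _ h₁ h₂ =>
    intro _ _ h
    cases h with
    | seq ha hb => cases h₁ ha; exact h₂ hb
  | cond_true _ _ h₁ h₂ =>
    intro _ _ h
    cases h with
    | cond_true ha hb => exact h₂ hb
    | cond_false ha hb => cases h₁ ha
  | cond_false _ _ h₁ h₂ =>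
    intro _ _ h
    cases h with
    | cond_true ha hb => cases h₁ ha
    | cond_false ha hb => exact h₂ hb
  | loop_stop _ h₁ =>
    intro _ _ h
    cases h with
    | loop_stop ha => rfl
    | loop_step ha hb hc => cases h₁ ha
  | loop_step _ _ _ h₁ h₂ h₃ =>
    intro _ _ h
    cases h with
    | loop_stop ha => cases h₁ ha
    | loop_step ha hb hc => cases h₂ hb; exact h₃ hc

/-! ### The trivial lower bound -/

/-- The instance in which all variables are set to `1`, all coefficients but the last one are `0`,
and the last one is `a`. -/
def lastCoeffInstance (M n : ℕ) (a one : Fin M) (zero : Fin M) : HornModInstance M (n + 1) where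
  clauses := List.ofFn fun i : Fin (n + 1) => .isOne i
  coeff i := if i = Fin.last n then a else zero
  rhs := one

theorem satisfiable_lastCoeffInstance {M n : ℕ} (hM : 2 ≤ M) (a : Fin M) :
    (lastCoeffInstance M n a ⟨1, hM⟩ ⟨0, by omega⟩).Satisfiable ↔ (a : ℕ) = 1 := by
  have hsum : ∀ x : Fin (n + 1) → Bool, (∀ i, x i = true) →
      (∑ i, if x i = true then ((if i = Fin.last n then a else ⟨0, by omega⟩ : Fin M) : ℕ) else 0)
        = a := fun x hx => by
    rw [Finset.sum_eq_single (Fin.last n)]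
    · simp [hx]
    · intro i _ hi
      simp [hi]
    · simp
  have hmod : (a : ℕ) ≡ 1 [MOD M] ↔ (a : ℕ) = 1 := by
    rw [Nat.ModEq, Nat.mod_eq_of_lt a.2, Nat.mod_eq_of_lt hM]
  constructor
  · rintro ⟨x, hx, h⟩
    have hx' : ∀ i, x i = true := fun i => hx (.isOne i) ((List.mem_ofFn' _ _).2 ⟨i, rfl⟩)
    exact hmod.1 ((hsum x hx').symm ▸ h)
  · intro h
    refine ⟨fun _ => true, ?_, ?_⟩
    · intro C hC
      obtain ⟨i, rfl⟩ := (List.mem_ofFn' _ _).1 hC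
      rfl
    · exact (hsum _ fun _ => rfl).symm ▸ hmod.2 h

theorem agree_ofList_append {α : Type} (e : α → Data) (l : List α) (x y : List α) :
    Agree l.length (ofList e (l ++ x)) (ofList e (l ++ y)) := by
  induction l with
  | nil => trivial
  | cons a l ih => exact ⟨.refl _ _, ih⟩

/-- The instances with last coefficient 1 and 0 have opposite answers, but their encodings differ
only beyond all the earlier coefficients in the list. A run with fewer steps than variables would
accept both or neither. -/
theorem le_of_solvesHornSatMod {M : ℕ} (hM : 2 ≤ M) {A : Prog} {T : ℕ → ℕ}
    (h : SolvesHornSatMod M A T) (n : ℕ) : n ≤ T n := by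
  cases n with
  | zero => omega
  | succ n =>
  by_contra! hlt
  let Ψ : Fin M → HornModInstance M (n + 1) := fun a =>
    lastCoeffInstance M n a ⟨1, hM⟩ ⟨0, by omega⟩
  have hsize : ∀ a, (Ψ a).size ≤ (n + 1) ^ 3 := fun a => by
    have : (Ψ a).size = n + 1 := by
      simp [Ψ, HornModInstance.size, lastCoeffInstance, HornClause.size, Function.comp_def,
        List.map_ofFn, Nat.add_comm]
    rw [this]
    exact Nat.le_self_pow (by omega) _
  obtain ⟨t, ht, y, hy, hy'⟩ := h (n + 1) (Ψ ⟨1, hM⟩) (hsize _)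
  obtain ⟨t', -, z, hz, hz'⟩ := h (n + 1) (Ψ ⟨0, by omega⟩) (hsize _)
  have hagree : Agree (n + 2) (Ψ ⟨1, hM⟩).encode (Ψ ⟨0, by omega⟩).encode := by
    have hco : ∀ a : Fin M, List.ofFn (Ψ a).coeff =
        List.replicate n ⟨0, by omega⟩ ++ [a] := fun a => by
      rw [List.ofFn_succ', List.concat_eq_append]
      congr 1
      · rw [← List.ofFn_const]
        congr 1
        funext i
        simp [Ψ, lastCoeffInstance, Fin.castSucc_ne_last]
      · simp [Ψ, lastCoeffInstance]
    have := agree_ofList_append (fun a : Fin M => ofNat a) (List.replicate n ⟨0, by omega⟩)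
    simp only [List.length_replicate] at this
    refine ⟨.refl _ _, .refl _ _, ?_⟩
    cases n with
    | zero => trivial
    | succ n =>
      refine ⟨?_, .refl _ _⟩
      rw [hco, hco]
      exact (this _ _).of_succ
  obtain ⟨z', hz1, hz2⟩ := hy.agree (d := 1) (hagree.mono (by omega))
  rw [hz.det hz1] at hz'
  have h1 : y ≠ .nil := hy'.2 ((satisfiable_lastCoeffInstance hM _).2 rfl)
  have h0 : ¬ z' ≠ .nil := fun hne => by
    have := (satisfiable_lastCoeffInstance (n := n) hM ⟨0, by omega⟩).1 (hz'.1 hne)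
    simp at this
  push Not at h0
  subst h0
  cases y with
  | nil => exact h1 rfl
  | cons a b => exact hz2

/-! ### Consequences of the exponential time hypothesis -/

/-- If every δ failed, then log₂ of the running time would be o(m), contrary to ETH. The maximum
with 1 keeps that logarithm nonnegative. -/
theorem ETH.exists_exponent (h : ETH) {A : Prog} {T : ℕ → ℕ} (hA : SolvesThreeSAT A T) :
    ∃ δ : ℝ, 0 < δ ∧ ∃ᶠ m : ℕ in atTop, (2 : ℝ) ^ (δ * m) < T m := by
  by_contra! hcon
  refine h ⟨A, T, fun m => Real.logb 2 (max (T m) 1), hA, ?_, fun m => ?_⟩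
  · rw [isLittleO_iff]
    intro δ hδ
    filter_upwards [hcon δ hδ] with m hm
    have h1 : (1 : ℝ) ≤ max (T m : ℝ) 1 := le_max_right _ _
    rw [Real.norm_of_nonneg (Real.logb_nonneg (by norm_num) h1),
      Real.norm_of_nonneg (Nat.cast_nonneg m), Real.logb_le_iff_le_rpow (by norm_num) (by linarith)]
    exact max_le hm (Real.one_le_rpow (by norm_num) (by positivity))
  · rw [Real.rpow_logb (by norm_num) (by norm_num) (by positivity)]
    exact le_max_left _ _

/-! ### The polynomial `1 + ∑ i < M - 1, ∏ j ≡ i mod M - 1, Y j` -/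

namespace HornReduction
open Data PolyComp

def residueClass (r m i : ℕ) : List ℕ := (List.range m).filter fun j => j % r == i

def residueTerms (M m : ℕ) : Terms :=
  ([], 1) :: (List.range (M - 1)).map fun i => (residueClass (M - 1) m i, 1)

theorem length_residueClass {r i : ℕ} (m : ℕ) (hi : i < r) :
    (residueClass r m i).length = m / r + if i < m % r then 1 else 0 := by
  have h := Nat.count_modEq_card m (by omega : 0 < r) i
  rw [Nat.mod_eq_of_lt hi, Nat.count, List.countP_eq_length_filter] at h
  rw [← h, residueClass]
  congr 1
  refine List.filter_congr fun j _ => ?_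
  rw [Bool.eq_iff_iff]
  simp [Nat.ModEq, Nat.mod_eq_of_lt hi]

/-- The value is 1 + c, where c is the number of products equal to 1. As c ≤ M - 1, it is divisible
by M only for c = M - 1, and the classes cover all indices. -/
theorem represents_residueTerms {M : ℕ} (hM : 2 ≤ M) (m : ℕ) :
    Represents M m (residueTerms M m) where
  index_lt := by
    simp only [residueTerms, List.forall_mem_cons, List.forall_mem_map]
    refine ⟨by simp, fun i _ j hj => ?_⟩
    exact List.mem_range.1 (List.mem_filter.1 hj).1
  coeff_lt := by
    simp only [residueTerms, List.forall_mem_cons, List.forall_mem_map]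
    exact ⟨hM, fun _ _ => hM⟩
  dvd_iff Y := by
    set c := (List.range (M - 1)).countP fun i => (residueClass (M - 1) m i).all Y with hc
    have hcount : ∀ l : List ℕ, termSum (l.map fun i => (residueClass (M - 1) m i, 1)) Y =
        l.countP fun i => (residueClass (M - 1) m i).all Y := by
      intro l
      induction l with
      | nil => rfl
      | cons i l ih =>
        rw [List.map_cons, termSum, List.map_cons, List.sum_cons, ← termSum, ih, List.countP_cons,
          add_comm]
        simp only [List.all_eq_true]
    have hsum : termSum (residueTerms M m) Y = 1 + c := by
      rw [hc, ← hcount]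
      simp [termSum, residueTerms]
    have hle : c ≤ M - 1 := List.countP_le_length.trans (by simp)
    have h1 : M ∣ 1 + c ↔ c = (List.range (M - 1)).length := by
      rw [List.length_range]
      constructor
      · intro h
        have := Nat.le_of_dvd (by omega) h
        omega
      · intro h
        rw [h, Nat.add_sub_cancel' (by omega)]
    rw [hsum, h1, hc, List.countP_eq_length]
    simp only [List.mem_range, List.all_eq_true]
    constructor
    · intro h j hj
      exact h (j % (M - 1)) (Nat.mod_lt _ (by omega)) j
        (List.mem_filter.2 ⟨List.mem_range.2 hj, by simp⟩)
    · intro h i _ j hj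
      exact h j (List.mem_range.1 (List.mem_filter.1 hj).1)

theorem lastVar_residueTerms_le (M m : ℕ) :
    lastVar m (residueTerms M m) ≤ 3 * m + 1 + M * 3 ^ (m / (M - 1) + 1) := by
  have h : ((List.range (M - 1)).map fun i => 3 ^ (residueClass (M - 1) m i).length).sum ≤
      (M - 1) * 3 ^ (m / (M - 1) + 1) := by
    refine (List.sum_le_card_nsmul _ (3 ^ (m / (M - 1) + 1)) ?_).trans (by simp)
    simp only [List.mem_map, List.mem_range, forall_exists_index, and_imp,
      forall_apply_eq_imp_iff₂]
    intro i hi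
    rw [length_residueClass m hi]
    exact Nat.pow_le_pow_right (by omega) (by split_ifs <;> omega)
  have h' : (M - 1) * 3 ^ (m / (M - 1) + 1) ≤ M * 3 ^ (m / (M - 1) + 1) :=
    Nat.mul_le_mul_right _ (by omega)
  simp only [lastVar, length_conjs, residueTerms, List.map_cons, List.map_map, List.sum_cons,
    Function.comp_def, List.length_nil, pow_zero]
  omega

/-- When M is part of the input, this makes `n` larger than any fixed power of M. -/
theorem le_lastVar_residueTerms {M : ℕ} (hM : 2 ≤ M) (m : ℕ) :
    3 ^ (m / (M - 1)) ≤ lastVar m (residueTerms M m) := by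
  have h : 3 ^ (residueClass (M - 1) m 0).length ≤
      ((List.range (M - 1)).map fun i => 3 ^ (residueClass (M - 1) m i).length).sum :=
    List.single_le_sum (by simp) _
      (List.mem_map.2 ⟨0, List.mem_range.2 (by omega), rfl⟩)
  have h' : 3 ^ (m / (M - 1)) ≤ 3 ^ (residueClass (M - 1) m 0).length := by
    rw [length_residueClass m (by omega)]
    exact Nat.pow_le_pow_right (by omega) (by omega)
  simp only [lastVar, length_conjs, residueTerms, List.map_cons, List.map_map, List.sum_cons,
    Function.comp_def, List.length_nil, pow_zero]
  omega

/-- A bound for the resources needed by the reduction with `residueTerms`. -/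
def residueBound (M m : ℕ) : ℕ := M + 3 * m + 1 + M * 3 ^ (m / (M - 1) + 1)

theorem polyComp_residueTerms :
    PolyComp (fun i : ℕ × ℕ => 2 ≤ i.1) (fun i => residueBound i.1 i.2)
      (fun i => .cons (ofNat i.1) (ofNat i.2))
      (fun i => .cons (ofNat i.1) (encTerms (residueTerms i.1 i.2))) := by
  have hM : PolyBdd (fun i : ℕ × ℕ => 2 ≤ i.1) (fun i => residueBound i.1 i.2) (fun i => i.1) :=
    .of_le fun i _ => by simp only [residueBound]; omega
  have hM1 : PolyBdd (fun i : ℕ × ℕ => 2 ≤ i.1) (fun i => residueBound i.1 i.2)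
    (fun i => i.1 - 1) := hM.mono fun i _ => by omega
  have hm : PolyBdd (fun i : ℕ × ℕ => 2 ≤ i.1) (fun i => residueBound i.1 i.2) (fun i => i.2) :=
    .of_le fun i _ => by simp only [residueBound]; omega
  refine pair v0 (cons_list (ea := encTerm) (const (encTerm ([], 1))) (map (range
    (sub v0 (const (ofNat 1)) (.const 1)) hM1) (hM1.mono fun i _ => by simp)
    (pair (filter (range (wk (wk id)) hm.fst) (hm.fst.mono fun i _ => by simp)
      (beq (mod v0 (sub v2 (const (ofNat 1)) (.const 1)) ?_ ?_ fun q hq => ?_) v1 ?_ ?_))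
      (const (ofNat 1)))))
  · exact (hm.fst (R := fun r => r.2 ∈ List.range (r.1.1 - 1))).fst.mono fun q hq =>
      (List.mem_range.1 hq.2).le
  · exact (hM1.fst (R := fun r => r.2 ∈ List.range (r.1.1 - 1))).fst
  · have := hq.1.1
    omega
  · refine (hM1.fst (R := fun r => r.2 ∈ List.range (r.1.1 - 1))).fst.mono fun q hq => ?_
    have := hq.1.1
    exact (Nat.mod_lt _ (by omega)).le
  · exact (hM1.fst (R := fun r => r.2 ∈ List.range (r.1.1 - 1))).fst.mono fun q hq =>
      (List.mem_range.1 hq.1.2).le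

theorem exists_solver_residueTerms : ∃ k : ℕ, ∀ (σ c : ℕ → ℕ) (p : Prog), (∀ m, 2 ≤ σ m) →
    (∀ m (φ : ThreeCNF m), ∃ t ≤ c m, p.Runs φ.encode (ofNat (σ m)) t) →
    ∀ (A : Prog) (T : ℕ → ℕ → ℕ), (∀ m, SolvesHornSatMod (σ m) A (T m)) →
      ∃ A', SolvesThreeSAT A' fun m =>
        T m (lastVar m (residueTerms (σ m) m) + 1) + (residueBound (σ m) m + 2) ^ k + c m := by
  refine exists_solver (P := fun s _ => 2 ≤ s) (M := fun s _ => s) (B := residueBound)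
    (L := residueTerms) polyComp_residueTerms ?_ (fun _ _ h => h)
    (fun _ m h => represents_residueTerms h m) fun s m _ => ?_
  · refine .of_le fun i _ => (lastVar_residueTerms_le i.1 i.2).trans ?_
    simp only [residueBound]
    omega
  · simp only [residueTerms, List.forall_mem_cons, List.forall_mem_map]
    exact ⟨by simp, fun i _ => (List.length_filter_le _ _).trans (by simp)⟩

end HornReduction

/-! ### Estimates -/

theorem tendsto_two_rpow_mul {a : ℝ} (ha : 0 < a) :
    Tendsto (fun m : ℕ => (2 : ℝ) ^ (a * m)) atTop atTop := by
  have h : ∀ m : ℕ, (2 : ℝ) ^ (a * m) = ((2 : ℝ) ^ a) ^ m := fun m => by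
    rw [Real.rpow_mul (by norm_num), Real.rpow_natCast]
  simp only [h]
  exact tendsto_pow_atTop_atTop_of_one_lt (Real.one_lt_rpow (by norm_num) ha)

/-- An overhead that is small compared to `2 ^ (δ * m)` can be dropped. -/
theorem eventually_le_of_lt_add {δ : ℝ} (hδ : 0 < δ) (c : ℝ) : ∀ᶠ m : ℕ in atTop, ∀ a b : ℝ,
    (2 : ℝ) ^ (δ * m) < a + b → b ≤ (2 : ℝ) ^ (δ / 2 * m) + c → (2 : ℝ) ^ (δ / 2 * m) ≤ a := by
  -- With x = 2^{δm/2} the claim is x² - x - c ≥ x, which holds once x ≥ 2 + |c|.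
  filter_upwards [(tendsto_two_rpow_mul (half_pos hδ)).eventually_ge_atTop (2 + |c|)]
    with m hm a b hab hb
  have h : (2 : ℝ) ^ (δ * m) = (2 : ℝ) ^ (δ / 2 * m) * (2 : ℝ) ^ (δ / 2 * m) := by
    rw [← Real.rpow_add (by norm_num)]
    congr 1
    ring
  have := le_abs_self c
  have := abs_nonneg c
  nlinarith

theorem eventually_pow_le_two_rpow (k : ℕ) {a : ℝ} (ha : 0 < a) :
    ∀ᶠ m : ℕ in atTop, ((m : ℝ) + 2) ^ k ≤ (2 : ℝ) ^ (a * m) := by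
  have h := isLittleO_pow_const_const_pow_of_one_lt (R := ℝ) k
    (Real.one_lt_rpow (by norm_num : (1 : ℝ) < 2) ha)
  filter_upwards [h.def (c := (1 / 3) ^ k) (by positivity), eventually_ge_atTop 1] with m hm hm1
  have hm1' : (1 : ℝ) ≤ m := by exact_mod_cast hm1
  rw [Real.norm_of_nonneg (by positivity), Real.norm_of_nonneg (by positivity)] at hm
  rw [Real.rpow_mul (by norm_num), Real.rpow_natCast]
  calc ((m : ℝ) + 2) ^ k ≤ (3 * m) ^ k := by gcongr; linarith
    _ = 3 ^ k * (m : ℝ) ^ k := mul_pow _ _ _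
    _ ≤ 3 ^ k * ((1 / 3) ^ k * ((2 : ℝ) ^ a) ^ m) := by gcongr
    _ = ((2 : ℝ) ^ a) ^ m := by rw [← mul_assoc, ← mul_pow]; norm_num

theorem eventually_mul_sqrt_le (c : ℕ) :
    ∀ᶠ m : ℕ in atTop, c * (Nat.sqrt m + 1) ≤ m := by
  filter_upwards [eventually_ge_atTop ((2 * c + 1) * (2 * c + 1))] with m hm
  have h1 := Nat.le_sqrt.2 hm
  have h2 := Nat.sqrt_le m
  nlinarith

/-- The reduction gives exponents linear in M; this weakens them to the form M / log M. -/
theorem div_log_le {M : ℕ} (hM : 2 ≤ M) : (M : ℝ) / Real.log M ≤ 2 * M := by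
  have h2 : (1 : ℝ) / 2 ≤ Real.log M := by
    have := Real.log_two_gt_d9
    have h : Real.log 2 ≤ Real.log M := Real.log_le_log (by norm_num) (by exact_mod_cast hM)
    linarith
  rw [div_le_iff₀ (by linarith)]
  nlinarith [(Nat.cast_nonneg M : (0 : ℝ) ≤ M)]

theorem div_log_nonneg (M : ℕ) : (0 : ℝ) ≤ M / Real.log M :=
  div_nonneg (Nat.cast_nonneg _) (Real.log_natCast_nonneg _)

theorem rpow_le_two_rpow {n : ℕ} {a b e : ℝ} (hn : (n : ℝ) ≤ (2 : ℝ) ^ a) (he : 0 ≤ e)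
    (h : a * e ≤ b) : (n : ℝ) ^ e ≤ (2 : ℝ) ^ b := by
  calc (n : ℝ) ^ e ≤ ((2 : ℝ) ^ a) ^ e := Real.rpow_le_rpow (Nat.cast_nonneg _) hn he
    _ = (2 : ℝ) ^ (a * e) := (Real.rpow_mul (by norm_num) _ _).symm
    _ ≤ (2 : ℝ) ^ b := Real.rpow_le_rpow_of_exponent_le (by norm_num) h

/-! ### Lower bounds with exponent M / log M. -/

namespace HornReduction
open Data PolyComp

theorem lastVar_residueTerms_lt (M m : ℕ) :
    lastVar m (residueTerms M m) + 1 ≤ residueBound M m + 2 := by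
  have := lastVar_residueTerms_le M m
  simp only [residueBound]
  omega

/-- With y = m / (M - 1) the right side is 4^y = (4/3)^y 3^y. The factor (4/3)^y absorbs the
constants and, since y ≤ 3^y, the linear term too. -/
theorem eventually_residueBound_le {M : ℕ} (hM : 2 ≤ M) :
    ∀ᶠ m : ℕ in atTop,
      ((residueBound M m + 2 : ℕ) : ℝ) ≤ (2 : ℝ) ^ (2 / ((M - 1 : ℕ) : ℝ) * m) := by
  set r := M - 1 with hr
  have hr0 : (0 : ℝ) < r := by
    have : 0 < r := by omega
    exact_mod_cast this
  have ha : 0 < Real.logb 2 (4 / 3) / r := div_pos (Real.logb_pos (by norm_num) (by norm_num)) hr0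
  filter_upwards [(tendsto_two_rpow_mul ha).eventually_ge_atTop (4 * M + 3 + 3 * r)] with m hm
  set y : ℝ := m / r with hy
  have h1 : (2 : ℝ) ^ (Real.logb 2 (4 / 3) / r * m) = (4 / 3 : ℝ) ^ y := by
    rw [hy, show Real.logb 2 (4 / 3) / r * m = Real.logb 2 (4 / 3) * (m / r) by ring,
      Real.rpow_mul (by norm_num), Real.rpow_logb (by norm_num) (by norm_num) (by norm_num)]
  have h2 : (2 : ℝ) ^ (2 / (r : ℝ) * m) = (4 / 3 : ℝ) ^ y * 3 ^ y := by
    rw [← Real.mul_rpow (by norm_num) (by norm_num), hy,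
      show 2 / (r : ℝ) * m = 2 * (m / r) by ring, Real.rpow_mul (by norm_num)]
    norm_num
  have h3 : ((3 : ℝ)) ^ (m / r : ℕ) ≤ 3 ^ y := by
    rw [← Real.rpow_natCast]
    exact Real.rpow_le_rpow_of_exponent_le (by norm_num) Nat.cast_div_le
  have hy0 : 0 ≤ y := by positivity
  have h4 : y ≤ 3 ^ y := by
    have h := Real.add_one_le_exp y
    have h' : Real.exp y ≤ 3 ^ y := by
      rw [← Real.exp_one_rpow]
      exact Real.rpow_le_rpow (Real.exp_pos 1).le (Real.exp_one_lt_d9.le.trans (by norm_num)) hy0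
    linarith
  have h5 : (1 : ℝ) ≤ 3 ^ y := Real.one_le_rpow (by norm_num) hy0
  have h6 : (m : ℝ) = r * y := by rw [hy]; field_simp
  rw [h1] at hm
  rw [h2, residueBound, ← hr]
  push_cast
  rw [pow_succ, h6]
  have h7 : (0 : ℝ) ≤ M := Nat.cast_nonneg M
  have h8 : (4 * (M : ℝ) + 3 + 3 * r) * 3 ^ y ≤ (4 / 3 : ℝ) ^ y * 3 ^ y := by gcongr
  have h9 : (M : ℝ) * (3 ^ (m / r : ℕ) * 3) ≤ M * (3 ^ y * 3) := by gcongr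
  nlinarith [mul_le_mul_of_nonneg_left h4 hr0.le, mul_le_mul_of_nonneg_left h5 h7]

theorem tendsto_lastVar (L : ℕ → Terms) :
    Tendsto (fun m => lastVar m (L m) + 1) atTop atTop :=
  tendsto_atTop_mono (fun m => by show m ≤ _; simp only [lastVar]; omega) tendsto_id

/-- Here n ≤ 2^{2m/(M-1)}, so 2^{δm/2} is at least n to the power δ(M-1)/4. The overhead, a `k`-th
power of the same bound, is below 2^{δm/2} once M - 1 ≥ 4k/δ. -/
theorem fixed_modulus_bound {δ : ℝ} (hδ : 0 < δ)
    (hETH : ∀ (A : Prog) (T : ℕ → ℕ), SolvesThreeSAT A T →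
      ∃ᶠ m : ℕ in atTop, (2 : ℝ) ^ (δ * m) < T m) :
    ∃ ε : ℝ, 0 < ε ∧ ∀ M : ℕ, 2 ≤ M → ∀ (A : Prog) (T : ℕ → ℕ), SolvesHornSatMod M A T →
      ∃ᶠ n : ℕ in atTop, (n : ℝ) ^ (ε * (M / Real.log M)) ≤ T n := by
  obtain ⟨k, hk⟩ := exists_solver_residueTerms
  -- Below this threshold ε ≤ 1/(2M₀) makes the exponent at most 1, and the trivial bound suffices.
  set M₀ : ℝ := 4 * k / δ + 2 with hM₀
  have hM₀pos : 0 < M₀ := by positivity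
  refine ⟨min (δ / 16) (1 / (2 * M₀)), by positivity, fun M hM A T hA => ?_⟩
  set ε := min (δ / 16) (1 / (2 * M₀)) with hε
  have hε0 : 0 ≤ ε := by positivity
  have hdiv := div_log_le hM
  have hdiv0 := div_log_nonneg M
  by_cases hsmall : (M : ℝ) ≤ M₀
  · refine Eventually.frequently ?_
    filter_upwards [eventually_ge_atTop 1] with n hn
    have h1 : ε * (M / Real.log M) ≤ 1 := by
      calc ε * (M / Real.log M) ≤ 1 / (2 * M₀) * (2 * M₀) := by
            gcongr
            · exact min_le_right _ _
            · linarith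
        _ = 1 := by field_simp
    calc (n : ℝ) ^ (ε * (M / Real.log M)) ≤ (n : ℝ) ^ (1 : ℝ) :=
          Real.rpow_le_rpow_of_exponent_le (by exact_mod_cast hn) h1
      _ = n := Real.rpow_one _
      _ ≤ T n := by exact_mod_cast le_of_solvesHornSatMod hM hA n
  · push Not at hsmall
    obtain ⟨p, t, hp⟩ := Prog.exists_const (ofNat M)
    obtain ⟨A', hA'⟩ := hk (fun _ => M) (fun _ => t) p (fun _ => hM)
      (fun m φ => ⟨t, le_rfl, hp _⟩) A (fun _ => T) (fun _ => hA)
    refine (tendsto_lastVar (residueTerms M)).frequently ?_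
    refine ((hETH A' _ hA').and_eventually ((eventually_residueBound_le hM).and
      (eventually_le_of_lt_add hδ t))).mono fun m hm => ?_
    obtain ⟨h1, h2, h3⟩ := hm
    have hr : ((M - 1 : ℕ) : ℝ) = M - 1 := by
      rw [Nat.cast_sub (by omega)]; simp
    have hM2 : (2 : ℝ) ≤ M := by exact_mod_cast hM
    rw [hr] at h2
    have hr0 : (0 : ℝ) < M - 1 := by linarith
    have hkr : 4 * k / δ ≤ (M : ℝ) - 1 := by linarith
    rw [div_le_iff₀ hδ] at hkr
    have h4 : ((residueBound M m + 2 : ℕ) : ℝ) ^ k ≤ (2 : ℝ) ^ (δ / 2 * m) := by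
      rw [← Real.rpow_natCast]
      refine rpow_le_two_rpow h2 (Nat.cast_nonneg _) ?_
      rw [show 2 / ((M : ℝ) - 1) * m * k = 2 * k / ((M : ℝ) - 1) * m by ring]
      refine mul_le_mul_of_nonneg_right ?_ (Nat.cast_nonneg m)
      rw [div_le_iff₀ hr0]
      linarith
    have h5 := h3 (T (lastVar m (residueTerms M m) + 1))
      (((residueBound M m + 2 : ℕ) : ℝ) ^ k + t) (by push_cast at h1 ⊢; linarith) (by linarith)
    refine le_trans (rpow_le_two_rpow (le_trans ?_ h2) (by positivity) ?_) h5
    · exact_mod_cast lastVar_residueTerms_lt M m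
    · have h6 : ε * (M / Real.log M) ≤ δ / 16 * (4 * (M - 1)) := by
        gcongr
        · exact min_le_left _ _
        · linarith
      calc 2 / ((M : ℝ) - 1) * m * (ε * (M / Real.log M))
          ≤ 2 / ((M : ℝ) - 1) * m * (δ / 16 * (4 * (M - 1))) := by gcongr
        _ = δ / 2 * m := by field_simp; ring

/-- The j with j² ≤ m are 0, ..., √m, so counting them gives √m + 1. -/
theorem polyComp_sqrt : PolyComp (fun _ : Σ m, ThreeCNF m => True) (fun i => i.1)
    (fun i => i.2.encode) (fun i => ofNat (Nat.sqrt i.1 + 2)) := by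
  have hm : PolyBdd (fun _ : Σ m, ThreeCNF m => True) (fun i => i.1) (fun i => i.1) := .self
  have hm1 := hm.add (.const 1)
  have h1 : PolyComp (fun _ : Σ m, ThreeCNF m => True) (fun i => i.1)
      (fun i => i.2.encode) (fun i => ofNat i.1) :=
    ((length (l := fun i : Σ m, ThreeCNF m => formula i.2) (ea := ofList encLit)
      (id.congr fun i _ => encode_eq i.2) (hm.mono fun i _ => by rw [length_formula])).congr
        fun i _ => by rw [length_formula])
  refine (succ (length (filter (g := fun i j => decide (j * j ≤ i.1)) (range (succ h1) hm1)
    (hm1.mono fun i _ => by simp) (le (m := fun q : (Σ m, ThreeCNF m) × ℕ => q.2 * q.2)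
      (n := fun q => q.1.1) (mul v0 v0 ?_ ?_) (wk_fst h1) hm.fst))
    (hm1.mono fun i _ => (List.length_filter_le _ _).trans (by simp)))).congr fun i _ => ?_
  · exact hm1.fst.mono fun q hq => (List.mem_range.1 hq.2).le
  · exact hm1.fst.mono fun q hq => (List.mem_range.1 hq.2).le
  · have h : ((List.range (i.1 + 1)).filter fun j => decide (j * j ≤ i.1)).length =
        Nat.sqrt i.1 + 1 := by
      rw [← List.countP_eq_length_filter, ← Nat.count, Nat.count_eq_card_filter_range,
        ← Finset.card_range (Nat.sqrt i.1 + 1)]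
      congr 1
      ext j
      rw [Finset.mem_filter, Finset.mem_range, Finset.mem_range, ← Nat.le_sqrt]
      have := Nat.sqrt_le_self i.1
      omega
    rw [h]

/-- With M = √m + 2 each residue class has about √m elements, so `n` and the overhead are 2^{O(√m)},
while n^{εM} can still reach 2^{δm/2}. -/
theorem uniform_bound {δ : ℝ} (hδ : 0 < δ) {k c : ℕ} {T : ℕ → ℕ → ℕ}
    (hT : ∃ᶠ m : ℕ in atTop, (2 : ℝ) ^ (δ * m) <
      ((T (Nat.sqrt m + 2) (lastVar m (residueTerms (Nat.sqrt m + 2) m) + 1) +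
        (residueBound (Nat.sqrt m + 2) m + 2) ^ k + (m + 2) ^ c : ℕ) : ℝ)) :
    ∃ ε : ℝ, 0 < ε ∧ ∀ k : ℕ, ∃ M : ℕ, 2 ≤ M ∧ k ≤ M ∧ ∃ n : ℕ, M ^ k ≤ n ∧ M ≤ n ∧
      (n : ℝ) ^ (ε * (M / Real.log M)) ≤ T M n := by
  -- 224 = 2 · 7 · 2 · 8: the factors come from 2^{δm/2}, n ≤ 2^{7(q+1)}, M / log M ≤ 2M, and
  -- (q+1)(q+2) ≤ 8m.
  refine ⟨δ / 224, by positivity, fun K => ?_⟩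
  -- From C(q+1) ≤ m follows 7(q+1)k ≤ δm/4, which bounds the overhead by 2^{δm/4}.
  obtain ⟨C, hC⟩ := exists_nat_ge (28 * k / δ)
  -- The exponent `K + 1` instead of `K` also yields M ≤ n when `K = 0`.
  have h34 : ∀ᶠ q : ℕ in atTop, (q + 2) ^ (K + 1) ≤ 3 ^ (q - 1) := by
    filter_upwards [eventually_pow_le_two_rpow (K + 1) one_pos, eventually_ge_atTop 4]
      with q hq hq4
    rw [one_mul, Real.rpow_natCast] at hq
    have h1 : (q + 2) ^ (K + 1) ≤ 2 ^ q := by exact_mod_cast hq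
    obtain ⟨s, rfl⟩ : ∃ s, q = s + 4 := ⟨q - 4, by omega⟩
    refine h1.trans ?_
    rw [show s + 4 - 1 = s + 3 by omega, pow_add, pow_add]
    exact Nat.mul_le_mul (Nat.pow_le_pow_left (by omega) _) (by norm_num)
  have hsqrt : Tendsto Nat.sqrt atTop atTop := by
    refine tendsto_atTop.2 fun b => ?_
    filter_upwards [eventually_ge_atTop (b * b)] with m hm using Nat.le_sqrt.2 hm
  obtain ⟨m, h1, h2, h3, h4, h5, h6, h7, h8⟩ := (hT.and_eventually
    ((eventually_le_of_lt_add hδ 0).and ((eventually_pow_le_two_rpow c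
      (by positivity : 0 < δ / 4)).and ((eventually_mul_sqrt_le C).and
    ((hsqrt.eventually h34).and ((hsqrt.eventually_ge_atTop (K + 2)).and
      ((eventually_ge_atTop 1).and ((tendsto_two_rpow_mul
        (by positivity : 0 < δ / 4)).eventually_ge_atTop 2)))))))).exists
  set q := Nat.sqrt m with hq
  have hqm : q * q ≤ m := Nat.sqrt_le m
  have hqm' : m < (q + 1) * (q + 1) := Nat.lt_succ_sqrt m
  have hB : residueBound (q + 2) m + 2 ≤ 2 ^ (7 * (q + 1)) := by
    have hd : m / (q + 1) ≤ q := Nat.lt_succ_iff.1 (Nat.div_lt_of_lt_mul hqm')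
    have h3 : 3 ^ (m / (q + 1) + 1) ≤ (2 ^ (q + 1)) ^ 2 := by
      rw [← pow_mul, mul_comm, pow_mul]
      exact (Nat.pow_le_pow_right (by omega) (by omega)).trans (Nat.pow_le_pow_left (by omega) _)
    have hx : q + 2 ≤ 2 ^ (q + 1) := Nat.lt_pow_self (by omega)
    rw [residueBound, mul_comm 7, pow_mul, show q + 2 - 1 = q + 1 by omega]
    generalize 2 ^ (q + 1) = x at *
    have h2x : 2 ≤ x := by omega
    have h4 : (q + 2) * 3 ^ (m / (q + 1) + 1) ≤ x * x ^ 2 := Nat.mul_le_mul hx h3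
    have h5 : m ≤ x ^ 2 := by nlinarith
    have h6 : 2 * x ≤ x ^ 2 := by nlinarith
    have h7 : 2 * x ^ 2 ≤ x ^ 3 := by nlinarith
    have h8 : 8 * x ^ 3 ≤ x ^ 7 := by
      have : 2 ^ 3 ≤ x ^ 4 := (by norm_num : 2 ^ 3 ≤ 2 ^ 4).trans (Nat.pow_le_pow_left h2x 4)
      calc 8 * x ^ 3 ≤ x ^ 4 * x ^ 3 := Nat.mul_le_mul_right _ this
        _ = x ^ 7 := by ring
    have h9 : x * x ^ 2 = x ^ 3 := by ring
    omega
  have hdivm : q - 1 ≤ m / (q + 1) := by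
    rw [Nat.le_div_iff_mul_le (by omega)]
    obtain ⟨s, hs⟩ : ∃ s, q = s + 1 := ⟨q - 1, by omega⟩
    rw [hs] at hqm ⊢
    simp only [Nat.add_sub_cancel]
    nlinarith
  set n := lastVar m (residueTerms (q + 2) m) + 1 with hn
  have hn1 : (q + 2) ^ (K + 1) ≤ n := by
    have h := le_lastVar_residueTerms (by omega : 2 ≤ q + 2) m
    have h' : 3 ^ (q - 1) ≤ 3 ^ (m / (q + 2 - 1)) := Nat.pow_le_pow_right (by omega) hdivm
    omega
  have hBr : ((residueBound (q + 2) m + 2 : ℕ) : ℝ) ≤ (2 : ℝ) ^ (7 * ((q : ℝ) + 1)) := by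
    have : ((residueBound (q + 2) m + 2 : ℕ) : ℝ) ≤ ((2 ^ (7 * (q + 1)) : ℕ) : ℝ) := by
      exact_mod_cast hB
    refine this.trans (le_of_eq ?_)
    rw [show 7 * ((q : ℝ) + 1) = ((7 * (q + 1) : ℕ) : ℝ) by push_cast; ring, Real.rpow_natCast]
    push_cast
    rfl
  refine ⟨q + 2, by omega, by omega, n, ?_, ?_, ?_⟩
  · exact (Nat.pow_le_pow_right (by omega) (by omega)).trans hn1
  · exact (Nat.le_self_pow (by omega) _).trans hn1
  · have h9 : ((residueBound (q + 2) m + 2 : ℕ) : ℝ) ^ k ≤ (2 : ℝ) ^ (δ / 4 * m) := by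
      rw [← Real.rpow_natCast]
      refine rpow_le_two_rpow hBr (Nat.cast_nonneg _) ?_
      have h10 : (C : ℝ) * (q + 1) ≤ m := by exact_mod_cast h4
      rw [div_le_iff₀ hδ] at hC
      have hq0 : (0 : ℝ) ≤ q + 1 := by positivity
      nlinarith
    -- Both overhead terms are at most y = 2^{δm/4}, and 2y ≤ y² because y ≥ 2.
    have h11 : (2 : ℝ) ^ (δ / 2 * m) = (2 : ℝ) ^ (δ / 4 * m) * (2 : ℝ) ^ (δ / 4 * m) := by
      rw [← Real.rpow_add (by norm_num)]
      congr 1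
      ring
    have h12 := h2 (T (q + 2) n) (((residueBound (q + 2) m + 2 : ℕ) : ℝ) ^ k + ((m : ℝ) + 2) ^ c)
      (by push_cast at h1 ⊢; linarith) (by nlinarith)
    refine le_trans (rpow_le_two_rpow (le_trans ?_ hBr)
      (mul_nonneg (by positivity) (div_log_nonneg _)) ?_) h12
    · exact_mod_cast lastVar_residueTerms_lt (q + 2) m
    · have h13 := div_log_le (by omega : 2 ≤ q + 2)
      push_cast at h13 ⊢
      have h14 : ((q : ℝ) + 1) * (q + 2) ≤ 8 * m := by
        have : (q + 1) * (q + 2) ≤ 8 * m := by nlinarith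
        exact_mod_cast this
      calc 7 * ((q : ℝ) + 1) * (δ / 224 * ((q + 2) / Real.log (q + 2)))
          ≤ 7 * ((q : ℝ) + 1) * (δ / 224 * (2 * (q + 2))) := by gcongr
        _ = δ / 16 * ((q + 1) * (q + 2)) := by ring
        _ ≤ δ / 16 * (8 * m) := by gcongr
        _ = δ / 2 * m := by ring

end HornReduction

/-! ### Enumeration of small subsets -/

/-- The sublists of `l` of length at most `s`. -/
def smallSublists {α : Type} (s : ℕ) (l : List α) : List (List α) :=
  l.sublists'.filter fun S => decide (S.length ≤ s)

section smallSublists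
variable {α : Type}

theorem mem_smallSublists {s : ℕ} {S l : List α} :
    S ∈ smallSublists s l ↔ S.Sublist l ∧ S.length ≤ s := by
  simp [smallSublists]

theorem smallSublists_nil (s : ℕ) : smallSublists s ([] : List α) = [[]] := by
  simp [smallSublists]

/-- Only lists that still have room are extended, so the enumeration never passes through all
2^length sublists. -/
theorem smallSublists_cons (s : ℕ) (a : α) (l : List α) :
    smallSublists s (a :: l) = smallSublists s l ++
      ((smallSublists s l).filter fun S => decide (S.length < s)).map (a :: ·) := by
  rw [smallSublists, List.sublists'_cons, List.filter_append, List.filter_map, ← smallSublists,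
    smallSublists, List.filter_filter]
  congr 2
  refine List.filter_congr fun S _ => ?_
  rw [Bool.eq_iff_iff]
  simp
  omega

theorem length_smallSublists (s : ℕ) (l : List α) :
    (smallSublists s l).length = ∑ i ∈ Finset.range (s + 1), l.length.choose i := by
  induction l generalizing s with
  | nil =>
    rw [smallSublists_nil, Finset.sum_range_succ']
    simp
  | cons a l ih =>
    rw [smallSublists_cons, List.length_append, List.length_map, ih, List.length_cons]
    cases s with
    | zero => simp
    | succ s =>
      have : (smallSublists (s + 1) l).filter (fun S => decide (S.length < s + 1)) =
          smallSublists s l := by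
        rw [smallSublists, List.filter_filter, smallSublists]
        refine List.filter_congr fun S _ => ?_
        rw [Bool.eq_iff_iff]
        simp
        omega
      rw [this, ih, Finset.sum_range_succ' (fun i => (l.length + 1).choose i)]
      simp only [Nat.choose_succ_succ, Finset.sum_add_distrib]
      rw [Finset.sum_range_succ' (fun i => l.length.choose i)]
      simp
      omega

theorem length_smallSublists_mono {s : ℕ} {l l' : List α} (h : l.length ≤ l'.length) :
    (smallSublists s l).length ≤ (smallSublists s l').length := by
  rw [length_smallSublists, length_smallSublists]
  exact Finset.sum_le_sum fun i _ => Nat.choose_le_choose i h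

theorem foldr_smallSublists (s : ℕ) (l : List α) :
    l.foldr (fun a T => T ++ (T.filter fun S => decide (S.length < s)).map (a :: ·)) [[]] =
      smallSublists s l := by
  induction l with
  | nil => rw [smallSublists_nil]; rfl
  | cons a l ih => rw [List.foldr_cons, ih, smallSublists_cons]

end smallSublists

namespace PolyComp
open Data

variable {ι : Type} {P : ι → Prop} {B : ι → ℕ} {e : ι → Data} {α : Type} {ea : α → Data}

/-- The fold visits the small sublists of suffixes of `l`, and there are never more of these than in
the final list. -/
protected theorem smallSublists {s : ι → ℕ} {l : ι → List α}
    (hs : PolyComp P B e (fun i => ofNat (s i))) (hl : PolyComp P B e (fun i => ofList ea (l i)))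
    (hs' : PolyBdd P B s) (hlen : PolyBdd P B (fun i => (l i).length))
    (hS : PolyBdd P B (fun i => (smallSublists (s i) (l i)).length)) :
    PolyComp P B e (fun i => ofList (ofList ea) (smallSublists (s i) (l i))) := by
  have H : ∀ i, (l i).reverse.foldl
      (fun T a => T ++ (T.filter fun S => decide (S.length < s i)).map (a :: ·)) [[]] =
        smallSublists (s i) (l i) := fun i => by
    rw [List.foldl_reverse, foldr_smallSublists]
  have hT : ∀ (i : ι) (l₁ l₂ : List α) (a : α) (T : List (List α)),
      (l i).reverse = l₁ ++ a :: l₂ →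
      T = l₁.foldl (fun T a => T ++ (T.filter fun S => decide (S.length < s i)).map (a :: ·)) [[]] →
      T.length ≤ (smallSublists (s i) (l i)).length ∧ ∀ S ∈ T, S.length ≤ s i := by
    intro i l₁ l₂ a T h1 h2
    rw [← List.reverse_reverse l₁, List.foldl_reverse, foldr_smallSublists] at h2
    rw [h2]
    refine ⟨length_smallSublists_mono ?_, fun S hS => (mem_smallSublists.1 hS).2⟩
    have := congrArg List.length h1
    simp at this ⊢
    omega
  let Q : ι × List (List α) × α → Prop := fun q => ∃ l₁ l₂,
    (l q.1).reverse = l₁ ++ q.2.2 :: l₂ ∧ q.2.1 = l₁.foldl (fun T a => T ++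
      (T.filter fun S => decide (S.length < s q.1)).map (a :: ·)) [[]]
  have hT' : PolyBdd (fun q : ι × List (List α) × α => P q.1 ∧ Q q) (fun q => B q.1)
      (fun q => q.2.1.length) := hS.fst.mono fun q hq => by
    obtain ⟨-, l₁, l₂, h1, h2⟩ := hq
    exact (hT _ _ _ _ _ h1 h2).1
  have hs1 : PolyComp (fun q : ι × List (List α) × α => P q.1 ∧ Q q) (fun q => B q.1)
      (fun q => .cons (ea q.2.2) (.cons (ofList (ofList ea) q.2.1) (e q.1)))
      (fun q => ofNat (s q.1)) := wk (wk_fst hs)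
  have hs1' := hs'.fst (R := Q)
  refine (foldl (eb := ofList (ofList ea)) (b := fun _ => [[]])
    (step := fun i T a => T ++ (T.filter fun S => decide (S.length < s i)).map (a :: ·))
    (hl.reverse hlen) (const _) (hlen.mono fun i _ => by simp) (append v1 (map (filter v1 hT'
      (lt (length v0 (hs1'.fst.mono fun q hq => ?_)) (wk_fst hs1) hs1'.fst))
      (hT'.mono fun q _ => List.length_filter_le _ _) (cons_list v1 v0)) hT')).congr
    fun i _ => by rw [H]
  obtain ⟨⟨-, l₁, l₂, h1, h2⟩, h3⟩ := hq
  exact (hT _ _ _ _ _ h1 h2).2 _ h3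

end PolyComp

/-! ### Collecting the terms of a polynomial -/

namespace HornReduction
open Data PolyComp

/-- For sorted lists this is a test for equality. -/
def sameList (S S' : List ℕ) : Bool :=
  S.length == S'.length && S.all fun a => S'.any fun b => a == b

/-- The largest length of a term with a nonzero coefficient, if no length exceeds `m`. -/
def termsDegree (m : ℕ) (N : Terms) : ℕ :=
  ((List.range m).filter fun k => N.any fun t => !(t.2 == 0) && decide (k < t.1.length)).length

def coeffOf (M : ℕ) (N : Terms) (S : List ℕ) : ℕ :=
  (N.map fun t => if sameList S t.1 = true then t.2 else 0).sum % M

/-- A given list of terms may repeat monomials or contain long ones with coefficient 0, each of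
which would cost 3^length variables. Listing every monomial up to the true degree once, with its
total coefficient, bounds the cost by that degree. -/
def collect (M m : ℕ) (N : Terms) : Terms :=
  (smallSublists (termsDegree m N) (List.range m)).map fun S => (S, coeffOf M N S)

theorem sameList_iff {m : ℕ} {S S' : List ℕ} (hS : S.Sublist (List.range m))
    (hS' : S'.Sublist (List.range m)) : sameList S S' = true ↔ S = S' := by
  constructor
  · intro h
    simp only [sameList, Bool.and_eq_true, beq_iff_eq, List.all_eq_true, List.any_eq_true] at h
    have hsub : S ⊆ S' := fun a ha => by
      obtain ⟨b, hb, rfl⟩ := h.2 a ha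
      exact hb
    have hp : S.Perm S' := ((List.nodup_range.sublist hS).subperm hsub).perm_of_length_le h.1.ge
    exact hp.eq_of_pairwise (fun a b _ _ h1 h2 => absurd h1 (Nat.lt_asymm h2))
      (List.pairwise_lt_range.sublist hS) (List.pairwise_lt_range.sublist hS')
  · rintro rfl
    simp [sameList]

theorem length_le_termsDegree {m : ℕ} {N : Terms} {t : List ℕ × ℕ} (ht : t ∈ N) (ht0 : t.2 ≠ 0)
    (htm : t.1.length ≤ m) : t.1.length ≤ termsDegree m N := by
  rw [termsDegree, ← List.countP_eq_length_filter]
  calc t.1.length = (List.range t.1.length).countP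
        fun k => N.any fun t => !(t.2 == 0) && decide (k < t.1.length) := by
        rw [eq_comm]
        refine (List.countP_eq_length.2 fun k hk => ?_).trans List.length_range
        simp only [List.any_eq_true, Bool.and_eq_true, decide_eq_true_eq]
        exact ⟨t, ht, by simpa using ht0, List.mem_range.1 hk⟩
    _ ≤ _ := (List.range_sublist.2 htm).countP_le

theorem termsDegree_le {m D : ℕ} {N : Terms} (h : ∀ t ∈ N, t.2 ≠ 0 → t.1.length ≤ D) :
    termsDegree m N ≤ D := by
  rw [termsDegree, ← List.length_range (n := D)]
  refine ((List.nodup_range.filter _).subperm fun k hk => ?_).length_le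
  simp only [List.mem_filter, List.any_eq_true, Bool.and_eq_true, decide_eq_true_eq] at hk
  obtain ⟨-, t, ht, ht0, hkt⟩ := hk
  exact List.mem_range.2 (hkt.trans_le (h t ht (by simpa using ht0)))

theorem sum_map_sameList {m : ℕ} {Ls : List (List ℕ)} (hLs : Ls.Nodup)
    (hm : ∀ S ∈ Ls, S.Sublist (List.range m)) (t : List ℕ × ℕ)
    (ht : t.1.Sublist (List.range m)) (hmem : t.2 ≠ 0 → t.1 ∈ Ls) (Y : ℕ → Bool) :
    (Ls.map fun S => if ∀ j ∈ S, Y j = true then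
      (if sameList S t.1 = true then t.2 else 0) else 0).sum =
      if ∀ j ∈ t.1, Y j = true then t.2 else 0 := by
  rw [← List.sum_toFinset _ hLs, Finset.sum_eq_single t.1]
  · simp [sameList]
  · intro S hS hne
    have : sameList S t.1 ≠ true := mt (sameList_iff (hm S (List.mem_toFinset.1 hS)) ht).1 hne
    rw [if_neg this, ite_self]
  · intro h
    have : t.2 = 0 := by
      by_contra h0
      exact h (List.mem_toFinset.2 (hmem h0))
    simp [this]

/-- After exchanging the sums, a term of `N` with nonzero coefficient is counted at exactly one
element of `Ls`. -/
theorem sum_map_coeff {m : ℕ} {Ls : List (List ℕ)} (hLs : Ls.Nodup)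
    (hm : ∀ S ∈ Ls, S.Sublist (List.range m)) {N : Terms}
    (hN : ∀ t ∈ N, t.1.Sublist (List.range m)) (hmem : ∀ t ∈ N, t.2 ≠ 0 → t.1 ∈ Ls)
    (Y : ℕ → Bool) :
    (Ls.map fun S => if ∀ j ∈ S, Y j = true then
      (N.map fun t => if sameList S t.1 = true then t.2 else 0).sum else 0).sum =
      termSum N Y := by
  induction N with
  | nil => simp [termSum]
  | cons t N ih =>
    simp only [List.forall_mem_cons] at hN hmem
    rw [termSum, List.map_cons, List.sum_cons, ← termSum, ← ih hN.2 hmem.2,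
      ← sum_map_sameList hLs hm t hN.1 hmem.1 Y, ← List.sum_map_add]
    congr 1
    refine List.map_congr_left fun S _ => ?_
    split_ifs <;> simp [*]

theorem termSum_map_mod (M : ℕ) (Ls : List (List ℕ)) (g : List ℕ → ℕ) (Y : ℕ → Bool) :
    termSum (Ls.map fun S => (S, g S % M)) Y ≡
      (Ls.map fun S => if ∀ j ∈ S, Y j = true then g S else 0).sum [MOD M] := by
  induction Ls with
  | nil => rfl
  | cons S Ls ih =>
    simp only [termSum, List.map_cons, List.sum_cons, List.map_map] at ih ⊢
    refine Nat.ModEq.add ?_ ih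
    split_ifs
    · exact Nat.mod_modEq _ _
    · rfl

theorem nodup_smallSublists (s m : ℕ) : (smallSublists s (List.range m)).Nodup :=
  (List.nodup_sublists'.2 List.nodup_range).filter _

theorem termSum_collect {M m : ℕ} {N : Terms} (hN : ∀ t ∈ N, t.1.Sublist (List.range m))
    (Y : ℕ → Bool) : termSum (collect M m N) Y ≡ termSum N Y [MOD M] := by
  have h := sum_map_coeff (nodup_smallSublists (termsDegree m N) m)
    (fun S hS => (mem_smallSublists.1 hS).1) hN (fun t ht ht0 => mem_smallSublists.2
      ⟨hN t ht, length_le_termsDegree ht ht0 (by simpa using (hN t ht).length_le)⟩) Y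
  rw [← h]
  simp only [collect, coeffOf]
  exact termSum_map_mod M _ _ Y

theorem represents_collect {M m : ℕ} (hM : 0 < M) {N : Terms}
    (hN : ∀ t ∈ N, t.1.Sublist (List.range m))
    (h : ∀ Y : ℕ → Bool, M ∣ termSum N Y ↔ ∀ j < m, Y j = true) :
    Represents M m (collect M m N) where
  index_lt := by
    simp only [collect, List.forall_mem_map]
    intro S hS j hj
    exact List.mem_range.1 ((mem_smallSublists.1 hS).1.subset hj)
  coeff_lt := by
    simp only [collect, List.forall_mem_map]
    exact fun S _ => Nat.mod_lt _ hM
  dvd_iff Y := by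
    rw [← h, (termSum_collect hN Y).dvd_iff dvd_rfl]

theorem polyComp_sameList {ι : Type} {P : ι → Prop} {B : ι → ℕ} {e : ι → Data} {m : ι → ℕ}
    {S S' : ι → List ℕ} (hS : PolyComp P B e (fun i => ofList ofNat (S i)))
    (hS' : PolyComp P B e (fun i => ofList ofNat (S' i))) (hm : PolyBdd P B m)
    (h : ∀ i, P i → (S i).Sublist (List.range (m i)))
    (h' : ∀ i, P i → (S' i).Sublist (List.range (m i))) :
    PolyComp P B e (fun i => ofBool (sameList (S i) (S' i))) := by
  have hl : PolyBdd P B (fun i => (S i).length) :=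
    hm.mono fun i hi => by simpa using (h i hi).length_le
  have hl' : PolyBdd P B (fun i => (S' i).length) :=
    hm.mono fun i hi => by simpa using (h' i hi).length_le
  refine and (beq (length hS hl) (length hS' hl') hl hl') (all hS hl (any (wk_fst hS') hl'.fst
    (beq v1 v0 ?_ ?_)))
  · exact (hm.fst (R := fun q => q.2 ∈ S q.1)).fst.mono fun q hq =>
      (List.mem_range.1 ((h _ hq.1.1).subset hq.1.2)).le
  · exact (hm.fst (R := fun q => q.2 ∈ S q.1)).fst.mono fun q hq =>
      (List.mem_range.1 ((h' _ hq.1.1).subset hq.2)).le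

theorem polyComp_collect {ι : Type} {P : ι → Prop} {B : ι → ℕ} {e : ι → Data} {M m : ι → ℕ}
    {N : ι → Terms} (hM : PolyComp P B e (fun i => ofNat (M i)))
    (hm : PolyComp P B e (fun i => ofNat (m i))) (hN : PolyComp P B e (fun i => encTerms (N i)))
    (hM' : PolyBdd P B M) (hm' : PolyBdd P B m) (hN' : PolyBdd P B (fun i => (N i).length))
    (hMpos : ∀ i, P i → 0 < M i) (hlt : ∀ i, P i → ∀ t ∈ N i, t.2 < M i)
    (hsub : ∀ i, P i → ∀ t ∈ N i, t.1.Sublist (List.range (m i)))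
    (hS : PolyBdd P B
      (fun i => (smallSublists (termsDegree (m i) (N i)) (List.range (m i))).length)) :
    PolyComp P B e (fun i => encTerms (collect (M i) (m i) (N i))) := by
  have hlen : ∀ i, P i → ∀ t ∈ N i, t.1.length ≤ m i := fun i hi t ht => by
    simpa using (hsub i hi t ht).length_le
  have hd : PolyBdd P B (fun i => termsDegree (m i) (N i)) :=
    hm'.mono fun i _ => (List.length_filter_le _ _).trans (by simp)
  have hR : PolyBdd P B (fun i => (List.range (m i)).length) := hm'.mono fun i _ => by simp
  have hsum : PolyBdd (fun q : ι × List ℕ => P q.1 ∧ q.2 ∈ smallSublists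
      (termsDegree (m q.1) (N q.1)) (List.range (m q.1))) (fun q => B q.1)
      (fun q => ((N q.1).map fun t => if sameList q.2 t.1 = true then t.2 else 0).sum) :=
    (hN'.mul hM').fst.mono fun q hq => by
      refine (List.sum_le_card_nsmul _ (M q.1) ?_).trans (by simp)
      simp only [List.forall_mem_map]
      intro t ht
      split_ifs
      exacts [(hlt _ hq.1 t ht).le, Nat.zero_le _]
  have hdeg : PolyComp P B e (fun i => ofNat (termsDegree (m i) (N i))) := by
    refine length (filter (range hm hm') hR (any (ea := encTerm) (wk_fst hN) hN'.fst (and (not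
      (beq (n := fun _ => 0) v0.snd (const (ofNat 0)) ?_ (.const 0))) (lt v1 (length v0.fst ?_)
        ?_)))) hd
    · exact (hM'.fst (R := fun q => q.2 ∈ List.range (m q.1))).fst.mono fun q hq =>
        (hlt _ hq.1.1 _ hq.2).le
    all_goals
      exact (hm'.fst (R := fun q => q.2 ∈ List.range (m q.1))).fst.mono fun q hq =>
        hlen _ hq.1.1 _ hq.2
  refine map (eb := encTerm) (PolyComp.smallSublists hdeg (range hm hm') hd hR hS) hS
    (pair v0 (mod (sum (ea := encTerm) (wk_fst hN) hN'.fst ?_ ((ite (z := fun _ => ofNat 0)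
      (polyComp_sameList
      (m := fun q => m q.1.1) v1 v0.fst ?_ ?_ ?_) v0.snd (const (ofNat 0))).congr
        fun q _ => by split <;> rfl)) (wk_fst hM) ?_ hM'.fst ?_))
  · exact hsum
  · exact (hm'.fst (R := fun q => q.2 ∈ smallSublists
      (termsDegree (m q.1) (N q.1)) (List.range (m q.1)))).fst
  · exact fun q hq => (mem_smallSublists.1 hq.1.2).1
  · exact fun q hq => hsub _ hq.1.1 _ hq.2
  · exact hsum
  · exact fun q hq => hMpos _ hq.1

end HornReduction

/-! ### Polynomials given as lists of terms -/

namespace TermList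
open HornReduction

variable {M d : ℕ}

def toTerms (L : TermList M d) : Terms :=
  L.map fun s => ((s.1.sort (· ≤ ·)).map Fin.val, (s.2 : ℕ))

theorem encode_eq (L : TermList M d) : L.encode = encTerms L.toTerms := by
  simp only [encode, encTerms, toTerms, Data.ofList_map, encTerm]

theorem sublist_of_mem_toTerms (L : TermList M d) :
    ∀ t ∈ L.toTerms, t.1.Sublist (List.range d) := by
  simp only [toTerms, List.forall_mem_map]
  intro s _
  rw [← List.map_coe_finRange_eq_range]
  refine List.Sublist.map _ ?_
  refine List.sublist_of_subperm_of_sortedLE ?_ ?_ ?_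
  · exact (s.1.sort_nodup _).subperm fun i _ => List.mem_finRange i
  · exact (Finset.sortedLT_sort _).sortedLE
  · exact (List.sortedLT_finRange d).sortedLE

theorem lt_of_mem_toTerms (L : TermList M d) : ∀ t ∈ L.toTerms, t.2 < M := by
  simp only [toTerms, List.forall_mem_map]
  exact fun s _ => s.2.isLt

theorem toPoly_cons (s : Finset (Fin d) × Fin M) (L : TermList M d) :
    toPoly (s :: L) = MvPolynomial.monomial (∑ i ∈ s.1, Finsupp.single i 1) ((s.2 : ℕ) : ℤ) +
      toPoly L := by
  rw [toPoly, List.map_cons, List.sum_cons, ← toPoly, MvPolynomial.monomial_sum_index]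
  rfl

theorem eval_toPoly (L : TermList M d) (Y : ℕ → Bool) :
    MvPolynomial.eval (fun i : Fin d => if Y i then (1 : ℤ) else 0) L.toPoly =
      (termSum L.toTerms Y : ℤ) := by
  induction L with
  | nil => simp [toPoly, toTerms, termSum]
  | cons s L ih =>
    rw [toPoly, List.map_cons, List.sum_cons, ← toPoly, map_add, ih]
    simp only [toTerms, List.map_cons, termSum, List.sum_cons, Nat.cast_add, map_mul, map_prod,
      MvPolynomial.eval_X, MvPolynomial.eval_C, List.forall_mem_map, Finset.mem_sort]
    congr 1
    split_ifs with h
    · rw [Finset.prod_eq_one fun i hi => if_pos (h i hi), mul_one]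
    · push Not at h
      obtain ⟨i, hi, h⟩ := h
      rw [Finset.prod_eq_zero hi (if_neg h), mul_zero, Nat.cast_zero]

theorem dvd_termSum_iff {L : TermList M d} (hL : RepresentsNAND M L.toPoly) (Y : ℕ → Bool) :
    M ∣ termSum L.toTerms Y ↔ ∀ j < d, Y j = true := by
  rw [← Int.natCast_dvd_natCast, ← eval_toPoly, hL fun i => Y i]
  exact ⟨fun h j hj => h ⟨j, hj⟩, fun h i => h i i.isLt⟩

theorem coeff_toPoly_nonneg (L : TermList M d) (u : Fin d →₀ ℕ) : 0 ≤ L.toPoly.coeff u := by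
  induction L with
  | nil => simp [toPoly]
  | cons s L ih =>
    rw [toPoly_cons, MvPolynomial.coeff_add, MvPolynomial.coeff_monomial]
    split_ifs <;> positivity

theorem coeff_toPoly_pos {L : TermList M d} {s : Finset (Fin d) × Fin M} (hs : s ∈ L)
    (hs0 : (s.2 : ℕ) ≠ 0) : 0 < L.toPoly.coeff (∑ i ∈ s.1, Finsupp.single i 1) := by
  induction L with
  | nil => simp at hs
  | cons s' L ih =>
    rw [toPoly_cons, MvPolynomial.coeff_add, MvPolynomial.coeff_monomial]
    rcases List.mem_cons.1 hs with rfl | hs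
    · have := coeff_toPoly_nonneg L (∑ i ∈ s.1, Finsupp.single i 1)
      rw [if_pos rfl]
      omega
    · have := ih hs
      split_ifs <;> omega

theorem sum_sum_single (S : Finset (Fin d)) :
    ((∑ i ∈ S, Finsupp.single i 1 : Fin d →₀ ℕ).sum fun _ e => e) = S.card := by
  rw [Finsupp.sum_fintype _ _ fun _ => rfl]
  simp [Finsupp.finsetSum_apply, Finsupp.single_apply]

theorem totalDegree_toPoly_le {L : TermList M d} {D : ℕ}
    (h : ∀ s ∈ L, (s.2 : ℕ) ≠ 0 → s.1.card ≤ D) : L.toPoly.totalDegree ≤ D := by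
  induction L with
  | nil => simp [toPoly]
  | cons s L ih =>
    simp only [List.forall_mem_cons] at h
    rw [toPoly_cons]
    refine (MvPolynomial.totalDegree_add _ _).trans (max_le ?_ (ih h.2))
    by_cases h0 : (s.2 : ℕ) = 0
    · simp [h0]
    · refine (MvPolynomial.totalDegree_monomial_le _ _).trans ?_
      exact (sum_sum_single s.1).trans_le (h.1 h0)

/-- The coefficients are nonnegative integers, so equal monomials cannot cancel over ℤ. The degree
can thus be read off the list, without an algorithm for `f`. -/
theorem termsDegree_toTerms (L : TermList M d) :
    termsDegree d L.toTerms = L.toPoly.totalDegree := by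
  refine le_antisymm (termsDegree_le ?_) (totalDegree_toPoly_le fun s hs hs0 => ?_)
  · simp only [toTerms, List.forall_mem_map]
    intro s hs hs0
    have h := MvPolynomial.le_totalDegree
      (MvPolynomial.mem_support_iff.2 (coeff_toPoly_pos hs hs0).ne')
    rw [sum_sum_single] at h
    simpa using h
  · have ht : ((s.1.sort (· ≤ ·)).map Fin.val, (s.2 : ℕ)) ∈ L.toTerms := List.mem_map_of_mem hs
    have h := length_le_termsDegree ht hs0
      (by simpa using (L.sublist_of_mem_toTerms _ ht).length_le)
    simpa using h

end TermList

/-! ### The reduction for a given NAND representation. -/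

namespace HornReduction
open Data PolyComp

theorem length_collect (M m : ℕ) (N : Terms) :
    (collect M m N).length = ∑ i ∈ Finset.range (termsDegree m N + 1), m.choose i := by
  rw [collect, List.length_map, length_smallSublists, List.length_range]

theorem length_le_length_conjs (L : Terms) : L.length ≤ (conjs L).length := by
  rw [length_conjs, ← List.length_map (f := fun t : List ℕ × ℕ => 3 ^ t.1.length)]
  refine List.length_le_sum_of_one_le _ ?_
  simp only [List.forall_mem_map]
  exact fun t _ => Nat.one_le_pow _ _ (by omega)

theorem length_conjs_collect_le (M m : ℕ) (N : Terms) :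
    (conjs (collect M m N)).length ≤
      3 ^ termsDegree m N * ∑ i ∈ Finset.range (termsDegree m N + 1), m.choose i := by
  rw [← length_collect M, length_conjs, mul_comm]
  refine (List.sum_le_card_nsmul _ (3 ^ termsDegree m N) ?_).trans (by simp)
  simp only [collect, List.forall_mem_map]
  exact fun S hS => Nat.pow_le_pow_right (by omega) (mem_smallSublists.1 hS).2

/-- A constant takes the same value at the zero vector and at the all-ones vector, which NAND
separates. -/
theorem one_le_totalDegree {M d : ℕ} {p : MvPolynomial (Fin d) ℤ} (hp : RepresentsNAND M p)
    (hd : 1 ≤ d) : 1 ≤ p.totalDegree := by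
  by_contra h
  have hC := MvPolynomial.totalDegree_eq_zero_iff_eq_C.1 (by omega : p.totalDegree = 0)
  have h1 := hp fun _ => true
  have h0 := hp fun _ => false
  rw [hC, MvPolynomial.eval_C] at h0 h1
  have := (h0.1 (h1.2 fun _ => rfl)) ⟨0, hd⟩
  simp at this

/-- For n ≥ 2 one has n + 1 ≤ n². This brings the overhead into the form n^k + k. -/
theorem succ_pow_le (n k : ℕ) (hn : 1 ≤ n) : (n + 1) ^ k ≤ n ^ (2 * k) + 2 ^ k := by
  rcases hn.eq_or_lt with rfl | hn
  · simp
  · rw [pow_mul]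
    exact (Nat.pow_le_pow_left (by nlinarith) k).trans (Nat.le_add_right _ _)

/-- After `collect`, the instance has at least one variable per monomial of degree at most `f m`. A
generator polynomial in the number of these monomials is therefore polynomial in `n m`, and so is
the whole overhead. -/
theorem exists_solver_of_efficientNAND {M : ℕ} {f : ℕ → ℕ} (hM : 2 ≤ M)
    (hf : EfficientNAND M f) : ∃ (n : ℕ → ℕ) (k : ℕ), Tendsto n atTop atTop ∧
      (∀ m, 1 ≤ m → 1 ≤ f m ∧ f m ≤ m ∧
        n m ≤ 3 * m + 1 + 3 ^ f m * ∑ i ∈ Finset.range (f m + 1), m.choose i) ∧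
      ∀ (A : Prog) (T : ℕ → ℕ), SolvesHornSatMod M A T →
        ∃ A', SolvesThreeSAT A' fun m => T (n m) + (n m ^ k + k) := by
  obtain ⟨p, k₀, hp⟩ := hf
  choose L hL hdeg t ht hrun using hp
  have htd : ∀ m, termsDegree m (L m).toTerms = f m := fun m => by
    rw [TermList.termsDegree_toTerms, hdeg]
  set C : ℕ → Terms := fun m => collect M m (L m).toTerms with hC
  have hsub := fun m => (L m).sublist_of_mem_toTerms
  have hrep : ∀ m, Represents M m (C m) := fun m =>
    represents_collect (by omega) (hsub m) fun Y => TermList.dvd_termSum_iff (hL m) Y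
  have hlenC : ∀ m, ∑ i ∈ Finset.range (f m + 1), m.choose i ≤ lastVar m (C m) := fun m => by
    have h := length_le_length_conjs (C m)
    rw [hC, length_collect, htd] at h
    exact h.trans (Nat.le_add_left _ _)
  have hB : ∀ {g : ℕ → ℕ}, (∀ m, g m ≤ lastVar m (C m)) → PolyBdd (fun i : ℕ × ℕ => i.1 = M)
      (fun i => lastVar i.2 (C i.2)) (fun i => g i.2) := fun h => .of_le fun i _ => h i.2
  have hm : PolyBdd (fun i : ℕ × ℕ => i.1 = M) (fun i => lastVar i.2 (C i.2)) (fun i => i.2) :=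
    hB (g := fun m => m) fun m => by simp only [lastVar]; omega
  have htime : PolyBdd (fun i : ℕ × ℕ => i.1 = M) (fun i => lastVar i.2 (C i.2))
      (fun i => t i.2) :=
    (((PolyBdd.const k₀).mul ((hB hlenC).pow k₀)).add (.const k₀)).mono fun i _ => ht i.2
  have hprog : PolyComp (fun i : ℕ × ℕ => i.1 = M) (fun i => lastVar i.2 (C i.2))
      (fun i => ofNat i.2) (fun i => encTerms (L i.2).toTerms) := by
    refine ⟨p, _, htime, fun i _ => ⟨_, le_rfl, ?_⟩⟩
    simp only [← TermList.encode_eq]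
    exact hrun i.2
  -- No bound on the number of listed terms is assumed; it follows from the depth that the generator
  -- can build in its running time.
  have hlenL : PolyBdd (fun i : ℕ × ℕ => i.1 = M) (fun i => lastVar i.2 (C i.2))
      (fun i => ((L i.2).toTerms).length) := (hm.add htime).mono fun i _ => by
    have h := (hrun i.2).depth_le
    rw [depth_ofNat, TermList.encode_eq] at h
    exact (length_le_depth _ _).trans h
  have hgen : PolyComp (fun i : ℕ × ℕ => i.1 = M) (fun i => lastVar i.2 (C i.2))
      (fun i => .cons (ofNat i.1) (ofNat i.2))
      (fun i => .cons (ofNat i.1) (encTerms (C i.2))) := by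
    refine pair v0 (polyComp_collect (M := fun _ => M) (const _) (wk id) (wk hprog) (.const M) hm
      hlenL (fun _ _ => by omega) (fun i _ => (L i.2).lt_of_mem_toTerms) (fun i _ => hsub i.2) ?_)
    refine (hB hlenC).mono fun i _ => ?_
    rw [length_smallSublists, List.length_range, htd]
  obtain ⟨k, hk⟩ := exists_solver (P := fun s _ => s = M) (M := fun s _ => s)
    (B := fun _ m => lastVar m (C m)) (L := fun _ => C) hgen .self (fun s m h => h ▸ hM)
    (fun s m h => h ▸ hrep m) fun s m h => by
      simp only [hC, collect, List.forall_mem_map]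
      intro S hS
      simpa using (mem_smallSublists.1 hS).1.length_le
  obtain ⟨q, c, hq⟩ := Prog.exists_const (ofNat M)
  refine ⟨fun m => lastVar m (C m) + 1, 2 * k + c + 2 ^ k, tendsto_lastVar C,
    fun m hm => ⟨?_, ?_, ?_⟩, fun A T hA => ?_⟩
  · rw [← hdeg]
    exact one_le_totalDegree (hL m) hm
  · rw [← htd]
    exact (List.length_filter_le _ _).trans (by simp)
  · have h := length_conjs_collect_le M m (L m).toTerms
    rw [htd] at h
    simp only [lastVar, hC]
    omega
  · obtain ⟨A', hA'⟩ := hk (fun _ => M) (fun _ => c) q (fun _ => rfl)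
      (fun m φ => ⟨c, le_rfl, hq _⟩) A (fun _ => T) fun _ => hA
    refine ⟨A', fun m φ => ?_⟩
    obtain ⟨s, hs, h⟩ := hA' m φ
    refine ⟨s, hs.trans ?_, h⟩
    have h1 : (lastVar m (C m) + 2) ^ k ≤ (lastVar m (C m) + 1) ^ (2 * k) + 2 ^ k :=
      succ_pow_le (lastVar m (C m) + 1) k (by omega)
    have : (lastVar m (C m) + 1) ^ (2 * k) ≤ (lastVar m (C m) + 1) ^ (2 * k + c + 2 ^ k) :=
      Nat.pow_le_pow_right (by omega) ((Nat.le_add_right _ c).trans (Nat.le_add_right _ _))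
    simp only
    generalize 2 ^ k = K at *
    omega

end HornReduction

/-! ### Numerical estimate for degree f. -/

theorem sum_choose_le {m f : ℕ} (hf : 1 ≤ f) (hfm : f ≤ m) :
    ((∑ i ∈ Finset.range (f + 1), m.choose i : ℕ) : ℝ) ≤ (Real.exp 1 * m / f) ^ f := by
  have hf0 : (0 : ℝ) < f := by exact_mod_cast hf
  have hm0 : (0 : ℝ) < m := hf0.trans_le (by exact_mod_cast hfm)
  -- As x ≤ 1, the weights x^i with i ≤ f are at least x^f, so x^f times the sum is at most (1 +
  -- x)^m ≤ e^{xm} = e^f.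
  set x : ℝ := f / m with hx
  have hx0 : 0 < x := div_pos hf0 hm0
  have hx1 : x ≤ 1 := (div_le_one hm0).2 (by exact_mod_cast hfm)
  have h : x ^ f * ((∑ i ∈ Finset.range (f + 1), m.choose i : ℕ) : ℝ) ≤ Real.exp 1 ^ f := by
    push_cast
    rw [Finset.mul_sum]
    calc ∑ i ∈ Finset.range (f + 1), x ^ f * (m.choose i : ℝ)
        ≤ ∑ i ∈ Finset.range (f + 1), x ^ i * (m.choose i : ℝ) := by
          refine Finset.sum_le_sum fun i hi => ?_
          gcongr ?_ * _
          exact pow_le_pow_of_le_one hx0.le hx1 (Nat.lt_succ_iff.1 (Finset.mem_range.1 hi))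
      _ ≤ ∑ i ∈ Finset.range (m + 1), x ^ i * (m.choose i : ℝ) :=
          Finset.sum_le_sum_of_subset_of_nonneg (Finset.range_subset_range.2 (by omega))
            fun i _ _ => by positivity
      _ = (x + 1) ^ m := by rw [add_pow]; simp
      _ ≤ Real.exp x ^ m := by gcongr; exact Real.add_one_le_exp x
      _ = Real.exp 1 ^ f := by
          rw [← Real.exp_nat_mul, ← Real.exp_nat_mul, hx]
          congr 1
          field_simp
  have h' : Real.exp 1 * m / f = Real.exp 1 / x := by rw [hx]; field_simp
  rw [h', div_pow, le_div_iff₀ (by positivity), mul_comm]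
  exact h

/-- With s = (em/f)^f one has n ≤ 6^f C ≤ s² · s, because 6 ≤ e² and e^f ≤ s. The cube explains the
constant 1/3. -/
theorem log_le_mul_log {m f n : ℕ} (hf : 1 ≤ f) (hfm : f ≤ m)
    (hn : n ≤ 3 * m + 1 + 3 ^ f * ∑ i ∈ Finset.range (f + 1), m.choose i) :
    1 / 3 * Real.log n ≤ f * Real.log (Real.exp 1 * m / f) := by
  set C := ∑ i ∈ Finset.range (f + 1), m.choose i with hC
  set s : ℝ := (Real.exp 1 * m / f) ^ f with hs
  have hCs : (C : ℝ) ≤ s := sum_choose_le hf hfm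
  have hmC : m + 1 ≤ C := by
    calc m + 1 = ∑ i ∈ Finset.range 2, m.choose i := by simp [Finset.sum_range_succ, add_comm]
      _ ≤ C := Finset.sum_le_sum_of_subset (Finset.range_subset_range.2 (by omega))
  have hf0 : (0 : ℝ) < f := by exact_mod_cast hf
  have he : Real.exp 1 ^ f ≤ s := by
    rw [hs]
    gcongr
    rw [le_div_iff₀ hf0]
    have : (f : ℝ) ≤ m := by exact_mod_cast hfm
    gcongr
  have hn1 : n ≤ 6 ^ f * C := by
    have h3 : 3 ≤ 3 ^ f := Nat.le_self_pow (by omega) 3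
    have h6 : 2 * 3 ^ f ≤ 6 ^ f := by
      rw [show 6 = 2 * 3 by rfl, mul_pow]
      exact Nat.mul_le_mul_right _ (Nat.le_self_pow (by omega) 2)
    nlinarith
  have h6 : (6 : ℝ) ^ f ≤ (Real.exp 1 ^ f) ^ 2 := by
    rw [← pow_mul, mul_comm, pow_mul]
    have := Real.exp_one_gt_d9
    gcongr
    nlinarith
  have hn2 : (n : ℝ) ≤ s ^ 3 := by
    have h : (n : ℝ) ≤ 6 ^ f * C := by exact_mod_cast hn1
    have he0 : (0 : ℝ) ≤ Real.exp 1 ^ f := by positivity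
    calc (n : ℝ) ≤ 6 ^ f * C := h
      _ ≤ s ^ 2 * s := by gcongr; exact h6.trans (by gcongr)
      _ = s ^ 3 := by ring
  rcases Nat.eq_zero_or_pos n with rfl | hn0
  · have : 0 ≤ Real.log s := Real.log_nonneg ((one_le_pow₀ (Real.one_le_exp zero_le_one)).trans he)
    rw [hs, Real.log_pow] at this
    simpa using this
  · have h := Real.log_le_log (by exact_mod_cast hn0) hn2
    rw [Real.log_pow, hs, Real.log_pow] at h
    push_cast at h
    linarith

namespace HornReduction

/-- The exponent `δ` is quantified after the solver `A'`, so that this serves both ETH, where `δ`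
depends on `A'`, and its explicit form. -/
theorem efficientNAND_bound {M : ℕ} {f : ℕ → ℕ} (hM : 2 ≤ M) (hf : EfficientNAND M f) :
    ∃ k : ℕ, ∀ (A : Prog) (T : ℕ → ℕ), SolvesHornSatMod M A T →
      ∃ (A' : Prog) (T' : ℕ → ℕ), SolvesThreeSAT A' T' ∧ ∀ δ : ℝ,
        (∃ᶠ m : ℕ in atTop, (2 : ℝ) ^ (δ * m) < T' m) →
          ∃ᶠ n : ℕ in atTop, ∃ m : ℕ,
            1 / 3 * Real.log n ≤ f m * Real.log (Real.exp 1 * m / f m) ∧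
            (2 : ℝ) ^ (δ * m) - ((n : ℝ) ^ k + k) ≤ T n := by
  obtain ⟨n, k, hn, hfn, h⟩ := exists_solver_of_efficientNAND hM hf
  refine ⟨k, fun A T hA => ?_⟩
  obtain ⟨A', hA'⟩ := h A T hA
  refine ⟨A', _, hA', fun δ hδ => hn.frequently
    ((hδ.and_eventually (eventually_ge_atTop 1)).mono fun m hm => ⟨m, ?_, ?_⟩)⟩
  · obtain ⟨h1, h2, h3⟩ := hfn m hm.2
    exact log_le_mul_log h1 h2 h3
  · have := hm.1
    push_cast at this
    linarith

end HornReduction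

/-! ### Binomial coefficients modulo primes -/

/-- In base p all k digits of p^k - 1 are p - 1. By Lucas, the binomial coefficient is 1 mod p if
the last k digits of w are all p - 1, which means p^k ∣ w + 1, and 0 otherwise. The induction strips
the last digit. -/
theorem dvd_choose_prime_pow_iff {p : ℕ} (hp : p.Prime) (k w : ℕ) :
    p ∣ w.choose (p ^ k - 1) + (p - 1) ↔ p ^ k ∣ w + 1 := by
  induction k generalizing w with
  | zero => simp [Nat.add_sub_cancel' hp.one_le]
  | succ k ih =>
    have := Fact.mk hp
    have hp2 := hp.two_le
    have hpk : 1 ≤ p ^ k := Nat.one_le_pow _ _ hp.pos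
    have hexp : p ^ (k + 1) - 1 = p * (p ^ k - 1) + (p - 1) := by
      rw [pow_succ', Nat.mul_sub, mul_one]
      have : p ≤ p * p ^ k := Nat.le_mul_of_pos_right _ hpk
      omega
    have hl := Choose.choose_modEq_choose_mod_mul_choose_div_nat (n := w) (k := p ^ (k + 1) - 1)
      (p := p)
    rw [hexp, Nat.mul_add_mod, Nat.mod_eq_of_lt (by omega : p - 1 < p),
      Nat.mul_add_div hp.pos, Nat.div_eq_of_lt (by omega : p - 1 < p), add_zero] at hl
    rw [hexp, (hl.add_right (p - 1)).dvd_iff dvd_rfl]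
    have hw := Nat.div_add_mod w p
    have hmod := Nat.mod_lt w hp.pos
    by_cases h : w % p = p - 1
    · rw [h, Nat.choose_self, one_mul, ih,
        show w + 1 = p * (w / p + 1) by rw [Nat.mul_add, mul_one]; omega, pow_succ',
        Nat.mul_dvd_mul_iff_left hp.pos]
    · rw [Nat.choose_eq_zero_of_lt (by omega), zero_mul, zero_add]
      constructor
      · intro h'
        have := Nat.le_of_dvd (by omega) h'
        omega
      · intro h'
        have h1 : p ∣ w + 1 := (dvd_pow_self p (by omega)).trans h'
        have h2 := (Nat.dvd_iff_mod_eq_zero ..).1 h1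
        rw [Nat.add_mod, Nat.mod_eq_of_lt (by omega : 1 < p), Nat.mod_eq_of_lt (by omega)] at h2
        omega

/-- If p^{a+1} is the exact power of p in M, it divides M / p' for every other prime p', while M / p
contains only p^a. So the sum detects whether p divides `h p`, for each p separately. -/
theorem dvd_sum_div_mul_iff {M : ℕ} (hM : M ≠ 0) (h : ℕ → ℕ) :
    M ∣ ∑ p ∈ M.primeFactors, M / p * h p ↔ ∀ p ∈ M.primeFactors, p ∣ h p := by
  constructor
  · intro hdvd p hp
    have hpp := Nat.prime_of_mem_primeFactors hp
    have hpM := Nat.dvd_of_mem_primeFactors hp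
    obtain ⟨a, b, hb, hab⟩ := Nat.exists_eq_pow_mul_and_not_dvd hM p hpp.ne_one
    have ha : a ≠ 0 := by
      rintro rfl
      rw [pow_zero, one_mul] at hab
      exact hb (hab ▸ hpM)
    obtain ⟨a, rfl⟩ := Nat.exists_eq_succ_of_ne_zero ha
    have hpa : p ^ (a + 1) ∣ M := ⟨b, hab⟩
    have h1 : p ^ (a + 1) ∣ M / p * h p := by
      rw [← Finset.add_sum_erase _ _ hp] at hdvd
      refine (Nat.dvd_add_left (Finset.dvd_sum fun p' hp' => ?_)).1 (hpa.trans hdvd)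
      have hne := Finset.ne_of_mem_erase hp'
      have hp'' := Finset.mem_of_mem_erase hp'
      refine Dvd.dvd.mul_right ?_ _
      refine (Nat.Coprime.dvd_of_dvd_mul_left (m := p') (Nat.Coprime.pow_left _
        ((Nat.coprime_primes hpp (Nat.prime_of_mem_primeFactors hp'')).2 hne.symm)) ?_)
      rwa [Nat.mul_div_cancel' (Nat.dvd_of_mem_primeFactors hp'')]
    have h2 : M / p = p ^ a * b := by
      rw [hab, pow_succ', mul_assoc, Nat.mul_div_cancel_left _ hpp.pos]
    rw [h2, pow_succ, mul_assoc] at h1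
    exact ((hpp.dvd_mul).1 (Nat.dvd_of_mul_dvd_mul_left (pow_pos hpp.pos a) h1)).resolve_left hb
  · intro hdvd
    refine Finset.dvd_sum fun p hp => ?_
    conv_lhs => rw [← Nat.div_mul_cancel (Nat.dvd_of_mem_primeFactors hp)]
    exact Nat.mul_dvd_mul_left _ (hdvd p hp)

/-- This evaluates an elementary symmetric polynomial at a 0/1 point. -/
theorem countP_sublists' {α : Type} (l : List α) (Y : α → Bool) (k : ℕ) :
    l.sublists'.countP (fun S => S.length == k && S.all Y) = (l.countP Y).choose k := by
  induction l generalizing k with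
  | nil => cases k <;> simp
  | cons a l ih =>
    rw [List.sublists'_cons, List.countP_append, ih, List.countP_map, List.countP_cons]
    cases k with
    | zero => simp [Function.comp_def]
    | succ k =>
      by_cases h : Y a = true
      · have := ih k
        simp [Function.comp_def, h, Nat.choose_succ_succ] at this ⊢
        omega
      · simp [Function.comp_def, h]

/-- The first power of `p`, other than `1`, whose `r`-th power exceeds `m`. -/
def primePow (r m p : ℕ) : ℕ := (fun q => if decide (q ^ r ≤ m) = true then p * q else q)^[m + 1] p

section primePow
variable {r p : ℕ}

/-- A multiplication by p takes place only while q^r ≤ m, so the r-th power overshoots m by at most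
the factor p^r. -/
theorem iterate_primePow_le (m k : ℕ) :
    ((fun q => if decide (q ^ r ≤ m) = true then p * q else q)^[k] p) ^ r ≤ p ^ r * (m + 1) := by
  induction k with
  | zero => exact Nat.le_mul_of_pos_right _ (by omega)
  | succ k ih =>
    rw [Function.iterate_succ_apply']
    generalize (fun q => if decide (q ^ r ≤ m) = true then p * q else q)^[k] p = q at ih ⊢
    simp only [decide_eq_true_eq]
    split_ifs with h
    · rw [mul_pow]
      exact Nat.mul_le_mul_left _ (by omega)
    · exact ih

theorem primePow_pow_le (r m p : ℕ) : primePow r m p ^ r ≤ p ^ r * (m + 1) :=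
  iterate_primePow_le m (m + 1)

theorem exists_primePow_eq (r m p : ℕ) : ∃ k, k ≠ 0 ∧ primePow r m p = p ^ k := by
  have : ∀ j, ∃ k, k ≠ 0 ∧ (fun q => if decide (q ^ r ≤ m) = true then p * q else q)^[j] p =
      p ^ k := by
    intro j
    induction j with
    | zero => exact ⟨1, one_ne_zero, (pow_one p).symm⟩
    | succ j ih =>
      obtain ⟨k, hk, h⟩ := ih
      rw [Function.iterate_succ_apply', h]
      split_ifs
      exacts [⟨k + 1, by omega, (pow_succ' p k).symm⟩, ⟨k, hk, rfl⟩]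
  exact this (m + 1)

/-- As long as the iteration has not stopped, the value after j rounds exceeds j; hence `m + 1`
rounds are enough. -/
theorem lt_primePow_pow (hr : r ≠ 0) (hp : 2 ≤ p) (m : ℕ) : m < primePow r m p ^ r := by
  have : ∀ j, j < ((fun q => if decide (q ^ r ≤ m) = true then p * q else q)^[j] p) ∨
      m < ((fun q => if decide (q ^ r ≤ m) = true then p * q else q)^[j] p) ^ r := by
    intro j
    induction j with
    | zero => exact Or.inl (by simp; omega)
    | succ j ih =>
      rw [Function.iterate_succ_apply']
      generalize (fun q => if decide (q ^ r ≤ m) = true then p * q else q)^[j] p = q at ih ⊢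
      simp only [decide_eq_true_eq]
      split_ifs with h
      · left
        have := ih.resolve_right (by omega)
        nlinarith
      · right
        omega
  rcases this (m + 1) with h | h
  · have h1 : m < primePow r m p := by rw [primePow]; omega
    exact h1.trans_le (Nat.le_self_pow hr _)
  · exact h

theorem primePow_le (hr : r ≠ 0) (m p : ℕ) : primePow r m p ≤ p ^ r * (m + 1) :=
  (Nat.le_self_pow hr _).trans (primePow_pow_le r m p)

end primePow

/-! ### The polynomial of degree `O (m ^ (1 / r))` for a modulus with `r` prime factors -/

namespace HornReduction
open Data PolyComp

/-- `a` plus `b` times the elementary symmetric polynomial of degree `k` in `d` variables, where the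
variables with index at least `m` are set to one. -/
def symmTerms (m d k a b : ℕ) : Terms :=
  ([], a) :: ((smallSublists k (List.range d)).filter fun S => S.length == k).map fun S =>
    (S.filter fun j => decide (j < m), b)

theorem termSum_symmTerms (m d k a b : ℕ) (Y : ℕ → Bool) :
    termSum (symmTerms m d k a b) Y =
      a + ((List.range d).countP fun j => !decide (j < m) || Y j).choose k * b := by
  have h1 : (smallSublists k (List.range d)).filter (fun S => S.length == k) =
      (List.range d).sublists'.filter fun S => S.length == k := by
    rw [smallSublists, List.filter_filter]
    refine List.filter_congr fun S _ => ?_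
    rw [Bool.eq_iff_iff]
    simp
    omega
  have h2 : ∀ l : List (List ℕ), termSum ((l.filter fun S => S.length == k).map fun S =>
      (S.filter fun j => decide (j < m), b)) Y =
      l.countP (fun S => S.length == k && S.all fun j => !decide (j < m) || Y j) * b := by
    intro l
    induction l with
    | nil => simp [termSum]
    | cons S l ih =>
      rw [List.countP_cons, add_mul, ← ih, List.filter_cons]
      by_cases h : S.length == k
      · rw [if_pos h, List.map_cons, termSum, List.map_cons, List.sum_cons, ← termSum, add_comm]
        simp only [h, Bool.true_and, List.mem_filter, and_imp, decide_eq_true_eq, List.all_eq_true,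
          Bool.or_eq_true, Bool.not_eq_true', decide_eq_false_iff_not, ← imp_iff_not_or]
        split_ifs <;> simp
      · simp [h]
  rw [symmTerms, termSum, List.map_cons, List.sum_cons, ← termSum, h1, h2, countP_sublists']
  simp

theorem length_smallSublists_le {α : Type} (k : ℕ) (l : List α) :
    (smallSublists k l).length ≤ (l.length + 1) ^ k := by
  rw [length_smallSublists]
  induction k with
  | zero => simp
  | succ k ih =>
    have h : l.length.choose (k + 1) ≤ l.length * (l.length + 1) ^ k :=
      (Nat.choose_le_pow _ _).trans (by
        rw [pow_succ']
        exact Nat.mul_le_mul_left _ (Nat.pow_le_pow_left (by omega) k))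
    rw [Finset.sum_range_succ, pow_succ', add_mul, one_mul]
    omega

theorem length_conjs_symmTerms_le (m d k a b : ℕ) :
    (conjs (symmTerms m d k a b)).length ≤ 1 + (3 * (d + 1)) ^ k := by
  rw [length_conjs, symmTerms, List.map_cons, List.sum_cons, List.length_nil, pow_zero,
    List.map_map]
  refine Nat.add_le_add_left ((List.sum_le_card_nsmul _ (3 ^ k) ?_).trans ?_) _
  · simp only [List.mem_map, List.mem_filter, beq_iff_eq]
    rintro _ ⟨S, ⟨-, rfl⟩, rfl⟩
    exact Nat.pow_le_pow_right (by omega) (List.length_filter_le _ _)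
  · rw [mul_pow, smul_eq_mul, mul_comm, List.length_map]
    refine Nat.mul_le_mul_left _ ((List.length_filter_le _ _).trans ?_)
    simpa using length_smallSublists_le k (List.range d)

/-- The linear combination of the `symmTerms` for the prime factors of `M`. -/
noncomputable def primeTerms (M m d : ℕ) (q : ℕ → ℕ) : Terms :=
  M.primeFactors.toList.flatMap fun p => symmTerms m d (q p - 1) (M / p * (p - 1)) (M / p)

theorem termSum_primeTerms (M m d : ℕ) (q : ℕ → ℕ) (Y : ℕ → Bool) :
    termSum (primeTerms M m d q) Y = ∑ p ∈ M.primeFactors,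
      M / p * (((List.range d).countP fun j => !decide (j < m) || Y j).choose (q p - 1) +
        (p - 1)) := by
  rw [primeTerms, ← Finset.sum_map_toList]
  induction M.primeFactors.toList with
  | nil => rfl
  | cons p l ih =>
    rw [List.flatMap_cons, termSum, List.map_append, List.sum_append, ← termSum, ← termSum, ih,
      termSum_symmTerms, List.map_cons, List.sum_cons]
    ring

/-- Let w be the number of ones after padding to d variables. The prime p tests q p ∣ w + 1, and by
coprimality all tests together say d + 1 ∣ w + 1, which for w ≤ d means w = d. The padding variables
are constant 1, so this is the condition on the first m. -/
theorem represents_primeTerms {M m d : ℕ} (hM : 2 ≤ M) {q : ℕ → ℕ}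
    (hq : ∀ p ∈ M.primeFactors, ∃ k, k ≠ 0 ∧ q p = p ^ k)
    (hd : d + 1 = ∏ p ∈ M.primeFactors, q p) (hmd : m ≤ d) :
    Represents M m (primeTerms M m d q) where
  index_lt := by
    simp only [primeTerms, List.mem_flatMap, symmTerms, List.mem_cons, List.mem_map,
      List.mem_filter]
    rintro t ⟨p, hp, rfl | ⟨S, hS, rfl⟩⟩ j hj
    · simp at hj
    · simpa using (List.mem_filter.1 hj).2
  coeff_lt := by
    simp only [primeTerms, List.mem_flatMap, symmTerms, List.mem_cons, List.mem_map,
      List.mem_filter, Finset.mem_toList]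
    rintro t ⟨p, hp, h⟩
    have hpp := Nat.prime_of_mem_primeFactors hp
    have h1 : M / p * p = M := Nat.div_mul_cancel (Nat.dvd_of_mem_primeFactors hp)
    have h2 : 0 < M / p := Nat.div_pos (Nat.le_of_mem_primeFactors hp) hpp.pos
    rcases h with rfl | ⟨S, hS, rfl⟩
    · calc M / p * (p - 1) < M / p * p := Nat.mul_lt_mul_of_pos_left (Nat.sub_lt hpp.pos one_pos) h2
        _ = M := h1
    · exact Nat.div_lt_self (by omega) hpp.one_lt
  dvd_iff Y := by
    set w := (List.range d).countP fun j => !decide (j < m) || Y j with hw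
    have hwd : w ≤ d := List.countP_le_length.trans (by simp)
    have h1 : ∀ p ∈ M.primeFactors, (p ∣ w.choose (q p - 1) + (p - 1) ↔ q p ∣ w + 1) := by
      intro p hp
      obtain ⟨k, -, hk⟩ := hq p hp
      rw [hk, dvd_choose_prime_pow_iff (Nat.prime_of_mem_primeFactors hp)]
    have h2 : (∀ p ∈ M.primeFactors, q p ∣ w + 1) ↔ d + 1 ∣ w + 1 := by
      rw [hd]
      refine ⟨Finset.prod_dvd_of_isRelPrime fun p hp p' hp' hne => ?_, fun h p hp =>
        (Finset.dvd_prod_of_mem q hp).trans h⟩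
      obtain ⟨k, -, hk⟩ := hq p hp
      obtain ⟨k', -, hk'⟩ := hq p' hp'
      rw [Function.onFun, ← Nat.coprime_iff_isRelPrime, hk, hk']
      exact Nat.Coprime.pow _ _ ((Nat.coprime_primes (Nat.prime_of_mem_primeFactors hp)
        (Nat.prime_of_mem_primeFactors hp')).2 hne)
    have h3 : d + 1 ∣ w + 1 ↔ w = (List.range d).length := by
      rw [List.length_range]
      constructor
      · intro h
        have := Nat.le_of_dvd (by omega) h
        omega
      · rintro h
        rw [h]
    rw [termSum_primeTerms, dvd_sum_div_mul_iff (by omega), forall₂_congr h1, h2, h3, hw,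
      List.countP_eq_length]
    simp only [List.mem_range, Bool.or_eq_true, Bool.not_eq_true', decide_eq_false_iff_not,
      ← imp_iff_not_or]
    exact ⟨fun h j hj => h j (by omega) hj, fun h j _ hj => h j hj⟩

end HornReduction

namespace PolyComp
open Data

variable {ι : Type} {P : ι → Prop} {B : ι → ℕ} {e : ι → Data}

theorem pow_const {n : ι → ℕ} (hn : PolyComp P B e (fun i => ofNat (n i))) (hn' : PolyBdd P B n)
    (r : ℕ) : PolyComp P B e (fun i => ofNat (n i ^ r)) := by
  induction r with
  | zero => exact (const (ofNat 1)).congr fun i _ => by rw [pow_zero]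
  | succ r ih => exact (mul ih hn (hn'.pow r) hn').congr fun i _ => by rw [pow_succ]

/-- The list `l` is fixed (the primes dividing M), so the program is unrolled along it instead of
reading it. -/
theorem list_prod {n : ι → ℕ → ℕ} (l : List ℕ)
    (hn : ∀ p ∈ l, PolyComp P B e (fun i => ofNat (n i p)))
    (hn' : ∀ p ∈ l, PolyBdd P B (fun i => n i p)) :
    PolyComp P B e (fun i => ofNat (l.map (n i)).prod) ∧
      PolyBdd P B (fun i => (l.map (n i)).prod) := by
  induction l with
  | nil => exact ⟨const _, .const 1⟩
  | cons p l ih =>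
    rw [List.forall_mem_cons] at hn hn'
    obtain ⟨h, h'⟩ := ih hn.2 hn'.2
    simp only [List.map_cons, List.prod_cons]
    exact ⟨mul hn.1 h hn'.1 h', hn'.1.mul h'⟩

theorem list_flatMap {β : Type} {eb : β → Data} {g : ι → ℕ → List β} (l : List ℕ)
    (hg : ∀ p ∈ l, PolyComp P B e (fun i => ofList eb (g i p)))
    (hg' : ∀ p ∈ l, PolyBdd P B (fun i => (g i p).length)) :
    PolyComp P B e (fun i => ofList eb (l.flatMap (g i))) := by
  induction l with
  | nil => exact const _
  | cons p l ih =>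
    rw [List.forall_mem_cons] at hg hg'
    simp only [List.flatMap_cons]
    exact append hg.1 (ih hg.2 hg'.2) hg'.1

end PolyComp

namespace HornReduction
open Data PolyComp

variable {ι : Type} {P : ι → Prop} {B : ι → ℕ} {e : ι → Data}

theorem polyComp_primePow {r : ℕ} (hr : r ≠ 0) (p : ℕ) {m : ι → ℕ}
    (hm : PolyComp P B e (fun i => ofNat (m i))) (hm' : PolyBdd P B m) :
    PolyComp P B e (fun i => ofNat (primePow r (m i) p)) := by
  have hm1 : PolyBdd P B (fun i => m i + 1) := hm'.add (.const 1)
  have hq : PolyBdd (fun q : ι × ℕ => P q.1 ∧ ∃ k < m q.1 + 1,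
      q.2 = (fun x => if decide (x ^ r ≤ m q.1) = true then p * x else x)^[k] p)
      (fun q => B q.1) (fun q => q.2) :=
    ((PolyBdd.const (p ^ r)).mul hm1).fst.mono fun q hq => by
      obtain ⟨-, k, -, h⟩ := hq
      rw [h]
      exact (Nat.le_self_pow hr _).trans (iterate_primePow_le (m q.1) k)
  refine iterate (eb := ofNat) (n := fun i => m i + 1) (b := fun _ => p)
    (step := fun i x => if decide (x ^ r ≤ m i) = true then p * x else x) hm.succ (const _) hm1
    ((ite (le (pow_const v0 hq r) (wk_fst hm) hm'.fst) (mul (m := fun _ => p) (n := fun q => q.2)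
      (const (ofNat p)) v0 (.const p) ?_) v0).congr fun q _ => by split <;> rfl)
  exact hq.reindex (fun q => q) fun q hq => hq.1

theorem polyComp_symmTerms {m d k a b : ι → ℕ} (hm : PolyComp P B e (fun i => ofNat (m i)))
    (hd : PolyComp P B e (fun i => ofNat (d i))) (hk : PolyComp P B e (fun i => ofNat (k i)))
    (ha : PolyComp P B e (fun i => ofNat (a i))) (hb : PolyComp P B e (fun i => ofNat (b i)))
    (hm' : PolyBdd P B m) (hd' : PolyBdd P B d) (hk' : PolyBdd P B k)
    (hS : PolyBdd P B (fun i => (smallSublists (k i) (List.range (d i))).length)) :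
    PolyComp P B e (fun i => encTerms (symmTerms (m i) (d i) (k i) (a i) (b i))) := by
  have hR : PolyBdd P B (fun i => (List.range (d i)).length) := hd'.mono fun i _ => by simp
  let R : ι × List ℕ → Prop := fun q => q.2 ∈
    (smallSublists (k q.1) (List.range (d q.1))).filter fun S => S.length == k q.1
  have hm1 := wk_fst (R := R) (y := fun q => ofList ofNat q.2) hm
  refine cons_list (ea := encTerm) (a := fun i => ([], a i)) (pair (const (ofList ofNat [])) ha)
    (map (filter (PolyComp.smallSublists hk (range hd hd') hk' hR hS) hS (beq (length v0
      (hk'.fst.mono fun q hq => ?_)) (wk_fst hk) (hk'.fst.mono fun q hq => ?_) hk'.fst))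
      (hS.mono fun i _ => List.length_filter_le _ _) (pair (filter v0 (hk'.fst.mono fun q hq => ?_)
        (lt v0 (wk_fst hm1) (hm'.fst (R := R)).fst)) (wk_fst hb)))
  · exact (mem_smallSublists.1 hq.2).2
  · exact (mem_smallSublists.1 hq.2).2
  · exact (mem_smallSublists.1 (List.mem_filter.1 hq.2).1).2

/-- The number of variables used by `modulusTerms`. -/
noncomputable def primeProd (M m : ℕ) : ℕ :=
  ∏ p ∈ M.primeFactors, primePow M.primeFactors.card m p

/-- A bound for the resources needed by the reduction with `modulusTerms`. -/
noncomputable def primeBound (M m : ℕ) : ℕ :=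
  m + (3 * primeProd M m) ^ ∑ p ∈ M.primeFactors, primePow M.primeFactors.card m p

/-- A polynomial representing NAND mod `M` in `m` variables. -/
noncomputable def modulusTerms (M m : ℕ) : Terms :=
  primeTerms M m (primeProd M m - 1) (primePow M.primeFactors.card m)

theorem card_primeFactors_ne_zero {M : ℕ} (hM : 2 ≤ M) :
    M.primeFactors.card ≠ 0 :=
  (Finset.card_pos.2 (Nat.nonempty_primeFactors.2 hM)).ne'

/-- There are r factors, each with r-th power above m, so the r-th power of the product exceeds m^r.
-/
theorem lt_primeProd {M : ℕ} (hM : 2 ≤ M) (m : ℕ) : m < primeProd M m := by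
  have hr := card_primeFactors_ne_zero hM
  refine lt_of_pow_lt_pow_left₀ M.primeFactors.card (Nat.zero_le _) ?_
  rw [primeProd, ← Finset.prod_pow]
  calc m ^ M.primeFactors.card < (m + 1) ^ M.primeFactors.card :=
        Nat.pow_lt_pow_left (by omega) hr
    _ ≤ _ := Finset.pow_card_le_prod _ _ _ fun p hp =>
        lt_primePow_pow hr (Nat.prime_of_mem_primeFactors hp).two_le m

theorem represents_modulusTerms {M : ℕ} (hM : 2 ≤ M) (m : ℕ) :
    Represents M m (modulusTerms M m) := by
  have h := lt_primeProd hM m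
  exact represents_primeTerms hM (fun p _ => exists_primePow_eq _ m p)
    (by rw [Nat.sub_add_cancel (by omega)]; rfl) (by omega)

theorem pow_primePow_le_primeBound {M : ℕ} (hM : 2 ≤ M) (m : ℕ) {p : ℕ} (hp : p ∈ M.primeFactors) :
    m + (3 * primeProd M m) ^ primePow M.primeFactors.card m p ≤ primeBound M m := by
  have h := lt_primeProd hM m
  exact Nat.add_le_add_left (Nat.pow_le_pow_right (by omega)
    (Finset.single_le_sum (f := primePow M.primeFactors.card m) (fun _ _ => Nat.zero_le _) hp)) _

theorem length_conjs_flatMap (l : List ℕ) (g : ℕ → Terms) :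
    (conjs (l.flatMap g)).length = (l.map fun p => (conjs (g p)).length).sum := by
  rw [conjs, List.flatMap_assoc, List.length_flatMap]
  rfl

theorem lastVar_modulusTerms_le {M : ℕ} (hM : 2 ≤ M) (m : ℕ) :
    lastVar m (modulusTerms M m) ≤
      (3 + 2 * M.primeFactors.card) * primeBound M m := by
  have hD := lt_primeProd hM m
  have h : (conjs (modulusTerms M m)).length ≤ M.primeFactors.card * (2 * primeBound M m) := by
    rw [modulusTerms, primeTerms, length_conjs_flatMap, Finset.sum_map_toList, ← smul_eq_mul]
    refine Finset.sum_le_card_nsmul _ _ _ fun p hp => (length_conjs_symmTerms_le _ _ _ _ _).trans ?_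
    rw [Nat.sub_add_cancel (by omega)]
    have h1 := pow_primePow_le_primeBound hM m hp
    have h2 : (3 * primeProd M m) ^ (primePow M.primeFactors.card m p - 1) ≤
        (3 * primeProd M m) ^ primePow M.primeFactors.card m p :=
      Nat.pow_le_pow_right (by omega) (Nat.sub_le _ _)
    have h3 : 1 ≤ (3 * primeProd M m) ^ primePow M.primeFactors.card m p :=
      Nat.one_le_pow _ _ (by omega)
    omega
  have : m ≤ primeBound M m := Nat.le_add_right _ _
  rw [lastVar]
  nlinarith

theorem length_le_of_mem_modulusTerms {M : ℕ} (m : ℕ) :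
    ∀ t ∈ modulusTerms M m, t.1.length ≤ m := by
  simp only [modulusTerms, primeTerms, List.mem_flatMap, symmTerms, List.mem_cons, List.mem_map,
    List.mem_filter]
  rintro t ⟨p, -, rfl | ⟨S, ⟨hS, -⟩, rfl⟩⟩
  · exact Nat.zero_le _
  · refine ((((List.nodup_range.sublist (mem_smallSublists.1 hS).1).filter _).subperm
      (l₂ := List.range m) fun j hj => ?_).length_le).trans (by simp)
    simpa using (List.mem_filter.1 hj).2

theorem exists_solver_modulusTerms {M : ℕ} (hM : 2 ≤ M) :
    ∃ k, ∀ (A : Prog) (T : ℕ → ℕ), SolvesHornSatMod M A T →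
    ∃ A', SolvesThreeSAT A' fun m =>
      T (lastVar m (modulusTerms M m) + 1) + ((primeBound M m + 2) ^ k + k) := by
  set r := M.primeFactors.card with hr
  have hDm := lt_primeProd hM
  have hm : PolyBdd (fun i : ℕ × ℕ => i.1 = M) (fun i => primeBound M i.2) (fun i => i.2) :=
    .of_le fun i _ => Nat.le_add_right _ _
  have hpow : ∀ p ∈ M.primeFactors, PolyBdd (fun i : ℕ × ℕ => i.1 = M)
      (fun i => primeBound M i.2) (fun i => (3 * primeProd M i.2) ^ primePow r i.2 p) :=
    fun p hp => .of_le fun i _ =>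
      (Nat.le_add_left _ _).trans (pow_primePow_le_primeBound hM i.2 hp)
  have hq : ∀ p ∈ M.primeFactors, PolyBdd (fun i : ℕ × ℕ => i.1 = M)
      (fun i => primeBound M i.2) (fun i => primePow r i.2 p) :=
    fun p hp => (hpow p hp).mono fun i _ => by
      have := hDm i.2
      exact (Nat.lt_pow_self (by omega : 1 < 3 * primeProd M i.2)).le
  have hqc : ∀ p, PolyComp (fun i : ℕ × ℕ => i.1 = M) (fun i => primeBound M i.2)
      (fun i => .cons (ofNat i.1) (ofNat i.2)) (fun i => ofNat (primePow r i.2 p)) :=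
    fun p => polyComp_primePow (card_primeFactors_ne_zero hM) p (wk id) hm
  obtain ⟨hDc, hDb⟩ := list_prod (n := fun (i : ℕ × ℕ) p => primePow r i.2 p) M.primeFactors.toList
    (fun p _ => hqc p) fun p hp => hq p (Finset.mem_toList.1 hp)
  simp only [Finset.prod_map_toList] at hDc hDb
  have hd : PolyBdd (fun i : ℕ × ℕ => i.1 = M) (fun i => primeBound M i.2)
      (fun i => primeProd M i.2 - 1) := hDb.mono fun i _ => Nat.sub_le _ _
  have hS : ∀ p ∈ M.primeFactors, PolyBdd (fun i : ℕ × ℕ => i.1 = M)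
      (fun i => primeBound M i.2)
      (fun i => (smallSublists (primePow r i.2 p - 1) (List.range (primeProd M i.2 - 1))).length) :=
    fun p hp => (hpow p hp).mono fun i _ => by
      have := hDm i.2
      refine (length_smallSublists_le _ _).trans ?_
      rw [List.length_range, Nat.sub_add_cancel (by omega)]
      exact (Nat.pow_le_pow_right (n := primeProd M i.2) (by omega) (Nat.sub_le _ _)).trans
        (Nat.pow_le_pow_left (by omega) _)
  have hgen : PolyComp (fun i : ℕ × ℕ => i.1 = M) (fun i => primeBound M i.2)
      (fun i => .cons (ofNat i.1) (ofNat i.2))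
      (fun i => .cons (ofNat i.1) (encTerms (modulusTerms M i.2))) := by
    refine pair v0 (list_flatMap (g := fun (i : ℕ × ℕ) p => symmTerms i.2 (primeProd M i.2 - 1)
      (primePow r i.2 p - 1) (M / p * (p - 1)) (M / p)) M.primeFactors.toList
        (fun p hp => ?_) fun p hp => ?_)
    all_goals rw [Finset.mem_toList] at hp
    · exact polyComp_symmTerms (a := fun _ => M / p * (p - 1)) (b := fun _ => M / p) (wk id)
        (sub hDc (const (ofNat 1)) (.const 1)) (sub (hqc p) (const (ofNat 1)) (.const 1)) (const _)
        (const _) hm hd ((hq p hp).mono fun i _ => Nat.sub_le _ _) (hS p hp)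
    · refine ((hS p hp).add (.const 1)).mono fun i _ => ?_
      rw [symmTerms, List.length_cons, List.length_map]
      exact Nat.succ_le_succ (List.length_filter_le _ _)
  obtain ⟨k, hk⟩ := exists_solver (P := fun s _ => s = M) (M := fun s _ => s)
    (B := fun _ m => primeBound M m) (L := fun _ => modulusTerms M) hgen
    (((PolyBdd.const (3 + 2 * r)).mul .self).mono fun i _ => lastVar_modulusTerms_le hM i.2)
    (fun s m h => h ▸ hM) (fun s m h => h ▸ represents_modulusTerms hM m)
    fun _ m _ => length_le_of_mem_modulusTerms m
  obtain ⟨q, c, hq⟩ := Prog.exists_const (ofNat M)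
  refine ⟨k + c, fun A T hA => ?_⟩
  obtain ⟨A', hA'⟩ := hk (fun _ => M) (fun _ => c) q (fun _ => rfl)
    (fun m φ => ⟨c, le_rfl, hq _⟩) A (fun _ => T) fun _ => hA
  refine ⟨A', fun m φ => ?_⟩
  obtain ⟨s, hs, h⟩ := hA' m φ
  refine ⟨s, hs.trans ?_, h⟩
  have : (primeBound M m + 2) ^ k ≤ (primeBound M m + 2) ^ (k + c) :=
    Nat.pow_le_pow_right (by omega) (by omega)
  simp only
  omega

end HornReduction

/-! ### Estimates for the polynomial of degree `O (m ^ (1 / r))` -/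

theorem eventually_one_le_rpow_mul_log (r : ℕ) :
    ∀ᶠ m : ℕ in atTop, 1 ≤ (m : ℝ) ^ (r : ℝ)⁻¹ ∧ 1 ≤ Real.log m ∧
      1 ≤ (m : ℝ) ^ (r : ℝ)⁻¹ * Real.log m := by
  filter_upwards [eventually_ge_atTop 3] with m hm
  have hm3 : (3 : ℝ) ≤ m := by exact_mod_cast hm
  have h1 : 1 ≤ (m : ℝ) ^ (r : ℝ)⁻¹ := Real.one_le_rpow (by linarith) (by positivity)
  have h2 : 1 ≤ Real.log m := by
    rw [Real.le_log_iff_exp_le (by linarith)]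
    have := Real.exp_one_lt_d9
    linarith
  exact ⟨h1, h2, one_le_mul_of_one_le_of_one_le h1 h2⟩

/-- Let y = log n and a = m^{1/r}. If y ≤ a, the bound holds since log y ≥ 1. Otherwise log y ≥ (log
m)/r, and dividing by it cancels the factor log m. -/
theorem exists_div_log_pow_le {r : ℕ} (hr : r ≠ 0) {C : ℝ} (hC : 0 ≤ C) :
    ∃ K : ℝ, 0 < K ∧ ∀ᶠ m : ℕ in atTop, ∀ n : ℕ, m ≤ n →
      Real.log n ≤ C * ((m : ℝ) ^ (r : ℝ)⁻¹ * Real.log m) →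
      (Real.log n / Real.log (Real.log n)) ^ r ≤ K * m := by
  refine ⟨1 + (r * C) ^ r, by positivity, ?_⟩
  have hlog : Tendsto (fun m : ℕ => Real.log m) atTop atTop :=
    Real.tendsto_log_atTop.comp tendsto_natCast_atTop_atTop
  filter_upwards [hlog.eventually_ge_atTop (Real.exp 1), eventually_ge_atTop 1]
    with m hm hm1 n hmn hn
  have hm0 : (0 : ℝ) < m := by exact_mod_cast hm1
  set a := (m : ℝ) ^ (r : ℝ)⁻¹ with ha
  have ha0 : 0 < a := Real.rpow_pos_of_pos hm0 _
  have har : a ^ r = m := Real.rpow_inv_natCast_pow hm0.le hr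
  set y := Real.log n with hy
  have hL : Real.exp 1 ≤ y := hm.trans (Real.log_le_log hm0 (by exact_mod_cast hmn))
  have hy0 : 0 < y := (Real.exp_pos 1).trans_le hL
  have hly : 1 ≤ Real.log y := (Real.le_log_iff_exp_le hy0).2 hL
  have hlm : 0 < Real.log m := (Real.exp_pos 1).trans_le hm
  have hr0 : (0 : ℝ) < r := by exact_mod_cast Nat.pos_of_ne_zero hr
  rcases le_total y a with h | h
  · calc (y / Real.log y) ^ r ≤ a ^ r := by
          gcongr
          exact (div_le_self hy0.le hly).trans h
      _ = 1 * m := by rw [har, one_mul]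
      _ ≤ (1 + (r * C) ^ r) * m := by
          gcongr
          have : (0 : ℝ) ≤ (r * C) ^ r := by positivity
          linarith
  · have h1 : (r : ℝ)⁻¹ * Real.log m ≤ Real.log y := by
      rw [← Real.log_rpow hm0]
      exact Real.log_le_log ha0 h
    have h2 : y / Real.log y ≤ r * C * a := by
      rw [div_le_iff₀ (by linarith)]
      calc y ≤ C * (a * Real.log m) := hn
        _ = r * C * a * ((r : ℝ)⁻¹ * Real.log m) := by field_simp
        _ ≤ r * C * a * Real.log y := by gcongr
    calc (y / Real.log y) ^ r ≤ (r * C * a) ^ r := by gcongr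
      _ = (r * C) ^ r * m := by rw [mul_pow, har]
      _ ≤ (1 + (r * C) ^ r) * m := by gcongr; linarith

/-- This makes the overhead subexponential in m, and it is the reason why r = 1 is treated
separately. -/
theorem eventually_rpow_mul_log_le {r : ℕ} (hr : 2 ≤ r) {η : ℝ} (hη : 0 < η) :
    ∀ᶠ m : ℕ in atTop, (m : ℝ) ^ (r : ℝ)⁻¹ * Real.log m ≤ η * m := by
  have h := (isLittleO_log_rpow_atTop (by norm_num : (0 : ℝ) < 1 / 2)).comp_tendsto
    tendsto_natCast_atTop_atTop
  filter_upwards [h.def hη, eventually_ge_atTop 1] with m hm hm1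
  have hm1' : (1 : ℝ) ≤ m := by exact_mod_cast hm1
  simp only [Function.comp_apply] at hm
  rw [Real.norm_of_nonneg (Real.log_nonneg hm1'), Real.norm_of_nonneg (by positivity)] at hm
  have hr2 : (r : ℝ)⁻¹ ≤ 1 / 2 := by
    rw [one_div]
    exact inv_anti₀ (by norm_num) (by exact_mod_cast hr)
  calc (m : ℝ) ^ (r : ℝ)⁻¹ * Real.log m
      ≤ (m : ℝ) ^ (1 / 2 : ℝ) * (η * (m : ℝ) ^ (1 / 2 : ℝ)) := by gcongr
    _ = η * ((m : ℝ) ^ (1 / 2 : ℝ) * (m : ℝ) ^ (1 / 2 : ℝ)) := by ring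
    _ = η * m := by
      rw [← Real.rpow_add (by linarith)]
      norm_num

/-! ### The lower bound for a modulus with r prime factors. -/

namespace HornReduction

/-- The prime powers are O(m^{1/r}) and the number of padded variables is polynomial in m, so the
logarithm is O(m^{1/r} log m). -/
theorem exists_primeBound_le {M : ℕ} (hM : 2 ≤ M) : ∃ C : ℝ, 0 ≤ C ∧ ∀ᶠ m : ℕ in atTop,
    ((primeBound M m + 2 : ℕ) : ℝ) ≤
      Real.exp (C * ((m : ℝ) ^ (M.primeFactors.card : ℝ)⁻¹ * Real.log m)) := by
  set r := M.primeFactors.card with hr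
  have hr0 : r ≠ 0 := card_primeFactors_ne_zero hM
  -- The exponent is at most r · 2M · m^{1/r} and the base at most m^{2r}, which gives 4r²M. The
  -- extra 1 provides a factor of at least 2 for the sum of the two parts of `primeBound`.
  refine ⟨4 * r ^ 2 * M + 1, by positivity, ?_⟩
  filter_upwards [eventually_one_le_rpow_mul_log r, eventually_ge_atTop (3 * M ^ r * 2 + 2)]
    with m hm hm1
  obtain ⟨h1, h2, h3⟩ := hm
  set x := (m : ℝ) ^ (r : ℝ)⁻¹ with hx
  have hMpos : 0 < M ^ r := pow_pos (by omega) r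
  have hxr : x ^ r = m := Real.rpow_inv_natCast_pow (Nat.cast_nonneg m) hr0
  have hq : ∀ p ∈ M.primeFactors, (primePow r m p : ℝ) ≤ 2 * M * x := by
    intro p hp
    refine le_of_pow_le_pow_left₀ hr0 (by positivity) ?_
    rw [mul_pow, hxr]
    have h4 : primePow r m p ^ r ≤ (2 * M) ^ r * m := by
      refine (primePow_pow_le r m p).trans ?_
      have h5 : p ^ r ≤ M ^ r := Nat.pow_le_pow_left (Nat.le_of_mem_primeFactors hp) r
      have h6 : 2 ≤ 2 ^ r := Nat.le_self_pow hr0 2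
      rw [mul_pow]
      calc p ^ r * (m + 1) ≤ M ^ r * (2 * m) := Nat.mul_le_mul h5 (by omega)
        _ ≤ M ^ r * (2 ^ r * m) := Nat.mul_le_mul_left _ (Nat.mul_le_mul_right _ h6)
        _ = 2 ^ r * M ^ r * m := by ring
    exact_mod_cast h4
  set s := ∑ p ∈ M.primeFactors, primePow r m p with hs
  have hs' : (s : ℝ) ≤ r * (2 * M * x) := by
    rw [hs]
    push_cast
    exact (Finset.sum_le_card_nsmul _ _ _ hq).trans (by rw [nsmul_eq_mul])
  have hD : 3 * primeProd M m ≤ m ^ (2 * r) := by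
    have h4 : primeProd M m ≤ (M ^ r * (m + 1)) ^ r := by
      refine Finset.prod_le_pow_card _ _ _ fun p hp => (primePow_le hr0 m p).trans ?_
      exact Nat.mul_le_mul_right _ (Nat.pow_le_pow_left (Nat.le_of_mem_primeFactors hp) r)
    calc 3 * primeProd M m ≤ 3 ^ r * (M ^ r * (m + 1)) ^ r :=
          Nat.mul_le_mul (Nat.le_self_pow hr0 3) h4
      _ = (3 * (M ^ r * (m + 1))) ^ r := (mul_pow _ _ _).symm
      _ ≤ (m ^ 2) ^ r := Nat.pow_le_pow_left (by nlinarith) r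
      _ = m ^ (2 * r) := (pow_mul _ _ _).symm
  have hm0 : (0 : ℝ) < m := by exact_mod_cast (by omega : 0 < m)
  have hE : (((3 * primeProd M m) ^ s : ℕ) : ℝ) ≤
      Real.exp (4 * r ^ 2 * M * (x * Real.log m)) := by
    have h4 : (((3 * primeProd M m) ^ s : ℕ) : ℝ) ≤ ((m ^ (2 * r)) ^ s : ℕ) := by
      exact_mod_cast Nat.pow_le_pow_left hD s
    refine h4.trans ?_
    rw [← pow_mul]
    push_cast
    rw [← Real.rpow_natCast, Real.rpow_def_of_pos hm0, Real.exp_le_exp]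
    push_cast
    calc Real.log m * (2 * r * s) ≤ Real.log m * (2 * r * (r * (2 * M * x))) := by gcongr
      _ = 4 * r ^ 2 * M * (x * Real.log m) := by ring
  have hm2 : (m : ℝ) + 2 ≤ Real.exp (4 * r ^ 2 * M * (x * Real.log m)) := by
    have h4 : (m : ℝ) + 2 ≤ m ^ 2 := by
      have : m + 2 ≤ m ^ 2 := by nlinarith
      exact_mod_cast this
    refine h4.trans ?_
    rw [← Real.rpow_natCast, Real.rpow_def_of_pos hm0, Real.exp_le_exp]
    have h5 : (2 : ℝ) ≤ 4 * r ^ 2 * M := by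
      have : 1 ≤ r ^ 2 := Nat.one_le_pow _ _ (Nat.pos_of_ne_zero hr0)
      have : 2 ≤ 4 * r ^ 2 * M := by nlinarith
      exact_mod_cast this
    push_cast
    calc Real.log m * 2 = 2 * (1 * Real.log m) := by ring
      _ ≤ 4 * r ^ 2 * M * (x * Real.log m) := by gcongr
  have h2e : (2 : ℝ) ≤ Real.exp (x * Real.log m) := by
    have := Real.add_one_le_exp (x * Real.log m)
    linarith
  rw [add_mul, one_mul, Real.exp_add, primeBound]
  push_cast at hE ⊢
  have := Real.exp_pos (4 * r ^ 2 * M * (x * Real.log m))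
  nlinarith

/-- The constant is a function of δ, chosen before the algorithm: the same statement covers δ
depending on the algorithm and δ absolute. -/
theorem modulus_bound {M : ℕ} (hM : 2 ≤ M) : ∃ ε : ℝ → ℝ, (∀ δ, 0 < δ → 0 < ε δ) ∧
    ∀ (A : Prog) (T : ℕ → ℕ), SolvesHornSatMod M A T →
      ∃ (A' : Prog) (T' : ℕ → ℕ), SolvesThreeSAT A' T' ∧ ∀ δ : ℝ, 0 < δ →
        (∃ᶠ m : ℕ in atTop, (2 : ℝ) ^ (δ * m) < T' m) →
          ∃ᶠ n : ℕ in atTop, Real.exp (ε δ *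
            (Real.log n / Real.log (Real.log n)) ^ M.primeFactors.card) ≤ T n := by
  obtain ⟨k, hk⟩ := exists_solver_modulusTerms hM
  obtain ⟨C, hC, hB⟩ := exists_primeBound_le hM
  have hr := card_primeFactors_ne_zero hM
  -- For r = 1 the claim is exp(log n / log log n) ≤ T n, which follows from n ≤ T n.
  rcases (Nat.one_le_iff_ne_zero.2 hr).eq_or_lt with hr1 | hr2
  · refine ⟨fun _ => 1, fun _ _ => one_pos, fun A T hA => ?_⟩
    obtain ⟨A', hA'⟩ := hk A T hA
    refine ⟨A', _, hA', fun δ _ _ => Eventually.frequently ?_⟩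
    have hlog : Tendsto (fun m : ℕ => Real.log m) atTop atTop :=
      Real.tendsto_log_atTop.comp tendsto_natCast_atTop_atTop
    filter_upwards [hlog.eventually_ge_atTop (Real.exp 1), eventually_ge_atTop 1] with n hn hn1
    have h0 : 0 < Real.log n := (Real.exp_pos 1).trans_le hn
    rw [← hr1, pow_one, one_mul]
    refine le_trans ?_ (Nat.cast_le.2 (le_of_solvesHornSatMod hM hA n))
    rw [← Real.le_log_iff_exp_le (by exact_mod_cast hn1)]
    exact div_le_self h0.le ((Real.le_log_iff_exp_le h0).2 hn)
  set r := M.primeFactors.card with hr_def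
  obtain ⟨K, hK, hKm⟩ := exists_div_log_pow_le hr
    (by positivity : 0 ≤ C + ((3 + 2 * r : ℕ) : ℝ))
  -- The expression (log n / log log n)^r is at most K m, and exp((δ/2) m log 2) = 2^{δm/2}.
  refine ⟨fun δ => δ / 2 * Real.log 2 / K, fun δ hδ => by positivity, fun A T hA => ?_⟩
  obtain ⟨A', hA'⟩ := hk A T hA
  refine ⟨A', _, hA', fun δ hδ hT => ?_⟩
  have hev := (eventually_le_of_lt_add hδ k).and (hB.and (hKm.and
    ((eventually_one_le_rpow_mul_log r).and (eventually_rpow_mul_log_le hr2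
      (by positivity : 0 < δ / 2 * Real.log 2 / (k * C + 1))))))
  refine (tendsto_lastVar (modulusTerms M)).frequently ((hT.and_eventually hev).mono fun m hm => ?_)
  obtain ⟨h1, h2, h3, h4, ⟨-, -, h5⟩, h6⟩ := hm
  set x := (m : ℝ) ^ (r : ℝ)⁻¹ * Real.log m with hx
  have hover : ((primeBound M m + 2 : ℕ) : ℝ) ^ k ≤ (2 : ℝ) ^ (δ / 2 * m) := by
    calc ((primeBound M m + 2 : ℕ) : ℝ) ^ k ≤ Real.exp (C * x) ^ k := by gcongr
      _ = Real.exp (k * (C * x)) := (Real.exp_nat_mul _ _).symm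
      _ ≤ Real.exp (Real.log 2 * (δ / 2 * m)) := by
        rw [Real.exp_le_exp]
        have h7 : (0 : ℝ) ≤ k * C := by positivity
        calc k * (C * x) ≤ (k * C + 1) * x := by nlinarith
          _ ≤ (k * C + 1) * (δ / 2 * Real.log 2 / (k * C + 1) * m) := by gcongr
          _ = Real.log 2 * (δ / 2 * m) := by field_simp
      _ = (2 : ℝ) ^ (δ / 2 * m) := (Real.rpow_def_of_pos (by norm_num) _).symm
  have hTm := h2 (T (lastVar m (modulusTerms M m) + 1))
    (((primeBound M m + 2 : ℕ) : ℝ) ^ k + k) (by push_cast at h1 ⊢; linarith) (by linarith)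
  refine le_trans ?_ hTm
  have hn : ((lastVar m (modulusTerms M m) + 1 : ℕ) : ℝ) ≤
      Real.exp ((C + ((3 + 2 * r : ℕ) : ℝ)) * x) := by
    have h7 : lastVar m (modulusTerms M m) + 1 ≤ (3 + 2 * r) * (primeBound M m + 2) := by
      have := lastVar_modulusTerms_le hM m
      nlinarith
    calc ((lastVar m (modulusTerms M m) + 1 : ℕ) : ℝ)
        ≤ ((3 + 2 * r : ℕ) : ℝ) * ((primeBound M m + 2 : ℕ) : ℝ) := by exact_mod_cast h7
      _ ≤ Real.exp (((3 + 2 * r : ℕ) : ℝ) * x) * Real.exp (C * x) := by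
        gcongr
        have h8 := Real.add_one_le_exp (((3 + 2 * r : ℕ) : ℝ) * x)
        have h9 : (0 : ℝ) ≤ ((3 + 2 * r : ℕ) : ℝ) := Nat.cast_nonneg _
        nlinarith
      _ = _ := by rw [← Real.exp_add]; ring_nf
  have hlogn := (Real.log_le_iff_le_exp (by positivity)).2 hn
  have hmn : m ≤ lastVar m (modulusTerms M m) + 1 := by rw [lastVar]; omega
  have h7 := h4 _ hmn hlogn
  calc _ ≤ Real.exp (δ / 2 * Real.log 2 / K * (K * m)) := by gcongr
    _ = Real.exp (Real.log 2 * (δ / 2 * m)) := by congr 1; field_simp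
    _ = (2 : ℝ) ^ (δ / 2 * m) := (Real.rpow_def_of_pos (by norm_num) _).symm

end HornReduction

theorem mainTheorem9 :
    -- Consequences of ETH in the form "3-SAT has no algorithm with running time `2^{o(m)}`".
    (ETH →
      (∃ c : ℝ, 0 < c ∧
        ∀ (M : ℕ) (f : ℕ → ℕ), 2 ≤ M → EfficientNAND M f →
          ∃ k : ℕ, ∀ (A : Prog) (T : ℕ → ℕ), SolvesHornSatMod M A T →
            ∃ ε : ℝ, 0 < ε ∧ ∃ᶠ n : ℕ in atTop, ∃ m : ℕ,
              c * Real.log n ≤ f m * Real.log (Real.exp 1 * m / f m) ∧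
              (2 : ℝ) ^ (ε * m) - ((n : ℝ) ^ k + k) ≤ T n) ∧
      (∀ M : ℕ, 2 ≤ M →
        ∀ (A : Prog) (T : ℕ → ℕ), SolvesHornSatMod M A T →
          ∃ ε : ℝ, 0 < ε ∧ ∃ᶠ n : ℕ in atTop,
            Real.exp (ε * (Real.log n / Real.log (Real.log n)) ^ M.primeFactors.card) ≤ T n) ∧
      (∀ (A : Prog) (T : ℕ → ℕ → ℕ), (∀ M, 2 ≤ M → SolvesHornSatMod M A (T M)) →
        ∃ ε : ℝ, 0 < ε ∧ ∀ k : ℕ, ∃ M : ℕ, 2 ≤ M ∧ k ≤ M ∧ ∃ n : ℕ, M ^ k ≤ n ∧ M ≤ n ∧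
          (n : ℝ) ^ (ε * (M / Real.log M)) ≤ T M n)) ∧
    -- Consequences of ETH in the form "for some `δ > 0`, 3-SAT has no algorithm with running time
    -- `2^{δ m}`"; here the constants in the exponents do not depend on the algorithm.
    (ExponentETH →
      (∃ c ε : ℝ, 0 < c ∧ 0 < ε ∧
        ∀ (M : ℕ) (f : ℕ → ℕ), 2 ≤ M → EfficientNAND M f →
          ∃ k : ℕ, ∀ (A : Prog) (T : ℕ → ℕ), SolvesHornSatMod M A T →
            ∃ᶠ n : ℕ in atTop, ∃ m : ℕ,
              c * Real.log n ≤ f m * Real.log (Real.exp 1 * m / f m) ∧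
              (2 : ℝ) ^ (ε * m) - ((n : ℝ) ^ k + k) ≤ T n) ∧
      (∀ M : ℕ, 2 ≤ M →
        ∃ ε : ℝ, 0 < ε ∧ ∀ (A : Prog) (T : ℕ → ℕ), SolvesHornSatMod M A T →
          ∃ᶠ n : ℕ in atTop,
            Real.exp (ε * (Real.log n / Real.log (Real.log n)) ^ M.primeFactors.card) ≤ T n) ∧
      (∃ ε : ℝ, 0 < ε ∧ ∀ M : ℕ, 2 ≤ M →
        ∀ (A : Prog) (T : ℕ → ℕ), SolvesHornSatMod M A T →
          ∃ᶠ n : ℕ in atTop, (n : ℝ) ^ (ε * (M / Real.log M)) ≤ T n)) := by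
  refine ⟨fun h => ⟨⟨1 / 3, by norm_num, fun M f hM hf => ?_⟩, fun M hM A T hA => ?_,
    fun A T hA => ?_⟩, fun ⟨δ, hδ, h⟩ => ⟨⟨1 / 3, δ, by norm_num, hδ, fun M f hM hf => ?_⟩,
    fun M hM => ?_, HornReduction.fixed_modulus_bound hδ h⟩⟩
  · obtain ⟨k, hk⟩ := HornReduction.efficientNAND_bound hM hf
    refine ⟨k, fun A T hA => ?_⟩
    obtain ⟨A', T', hA', hT'⟩ := hk A T hA
    obtain ⟨δ, hδ, hfreq⟩ := h.exists_exponent hA'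
    exact ⟨δ, hδ, hT' δ hfreq⟩
  · obtain ⟨ε, hε, hM'⟩ := HornReduction.modulus_bound hM
    obtain ⟨A', T', hA', hT'⟩ := hM' A T hA
    obtain ⟨δ, hδ, hfreq⟩ := h.exists_exponent hA'
    exact ⟨ε δ, hε δ hδ, hT' δ hδ hfreq⟩
  -- The modulus √m + 2 grows with the formula, so it has to be computed from the input.
  · obtain ⟨p, τ, ⟨c, hc⟩, hp⟩ := HornReduction.polyComp_sqrt
    obtain ⟨k, hk⟩ := HornReduction.exists_solver_residueTerms
    obtain ⟨A', hA'⟩ := hk (fun m => Nat.sqrt m + 2) (fun m => (m + 2) ^ c) p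
      (fun m => by omega) (fun m φ => by
        obtain ⟨t, ht, hrun⟩ := hp ⟨m, φ⟩ trivial
        exact ⟨t, ht.trans (hc ⟨m, φ⟩ trivial), hrun⟩)
      A (fun m => T (Nat.sqrt m + 2)) fun m => hA _ (by omega)
    obtain ⟨δ, hδ, hfreq⟩ := h.exists_exponent hA'
    exact HornReduction.uniform_bound hδ hfreq
  · obtain ⟨k, hk⟩ := HornReduction.efficientNAND_bound hM hf
    refine ⟨k, fun A T hA => ?_⟩
    obtain ⟨A', T', hA', hT'⟩ := hk A T hA
    exact hT' δ (h A' T' hA')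
  · obtain ⟨ε, hε, hM'⟩ := HornReduction.modulus_bound hM
    refine ⟨ε δ, hε δ hδ, fun A T hA => ?_⟩
    obtain ⟨A', T', hA', hT'⟩ := hM' A T hA
    exact hT' δ hδ (h A' T' hA')
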